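/- \textbf{Lemma.} Consider a channel that replaces every transmitted bit, independently, by a random number of copies of it, with law $G=(G_k)_{k\ge 0}$. For the binary deletion channel $\mathrm{BDC}_d$, $0\le d<1$, take $G_0=d$, $G_1=1-d$; for the Poisson repeat channel $\mathrm{PRC}_\lambda$, $\lambda>0$, take $G_k=e^{-\lambda}\lambda^k/k!$. Let $P_{i\to j}$ be the probability that $i$ transmitted bits yield exactly $j\ge 0$ received bits, and $D_r=P_{r\to 0}=G_0^{\,r}$ the probability that a run of length $r$ is deleted. For a run-length distribution $\mathcal P$, that is, a probability distribution on the positive integers with finite mean, and a parameter $\Delta\ge 0$, put \[ R_{\mathrm{heuristic}}(\mathcal P)=\frac{1}{\sum_r \mathcal P_r\, r}\left[\sum_{i,j}\mathcal P_i P_{i\to j}\log_2\!\left(\frac{P_{i\to j}}{\sum_{i'}\mathcal P_{i'}P_{i'\to j}}\right)-\sum_r \mathcal P_r\,\Delta\, D_r\right], \] where terms with $\mathcal P_iP_{i\to j}=0$ are $0$. For each of the two channel families there is a single algorithm which, for all real inputs $\varepsilon>0$, $\Delta\ge 0$ and $d\in[0,1)$ (respectively $\lambda>0$), returns a run-length distribution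 $\mathcal P$, given as the finite list of its weights on $\{1,\dots,N\}$ for some $N$, such that \[ R_{\mathrm{heuristic}}(\mathcal P)\ \ge\ \sup_{\mathcal P'}R_{\mathrm{heuristic}}(\mathcal P')-\varepsilon , \] where the supremum is over all run-length distributions and is finite. The running time is at most $T\bigl(1/\varepsilon,\,1/(1-d),\,\Delta\bigr)$ for $\mathrm{BDC}_d$ and at most $T'\bigl(1/\varepsilon,\,\lambda,\,1/\lambda,\,\Delta\bigr)$ for $\mathrm{PRC}_\lambda$, for fixed polynomials $T$ and $T'$. The algorithms are programs for a real RAM: the parameters are given as exact real numbers, and each field operation $+,-,\times,\div$ on reals, each comparison, each addition, subtraction or constant assignment of an integer variable, each conversion from an integer to a real, and each output weight costs one unit of time. -/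

import Mathlib

noncomputable section

/-! ## Channels with i.i.d. repetitions

Such a channel replaces every transmitted bit, independently, by a random number of copies of it;
`G k` is the probability that a bit is replaced by exactly `k` copies. Logarithms are to base 2. -/

/-- The binary deletion channel: a bit is deleted with probability `d` and otherwise kept. -/
def bdc (d : ℝ) : ℕ → ℝ
  | 0 => d
  | 1 => 1 - d
  | _ + 2 => 0

/-- The Poisson repeat channel: the number of copies of a bit is Poisson with mean `lam`. -/
def prc (lam : ℝ) (k : ℕ) : ℝ := Real.exp (-lam) * lam ^ k / (k.factorial : ℝ)

/-- `transition G i j` is the probability that `i` transmitted bits yield exactly `j` received bits: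
the numbers of copies of the `i` bits are independent with law `G`, so this is the `i`-fold
convolution of `G`, evaluated at `j`. -/
def transition (G : ℕ → ℝ) : ℕ → ℕ → ℝ
  | 0, j => if j = 0 then 1 else 0
  | i + 1, j => ∑ k ∈ Finset.range (j + 1), G k * transition G i (j - k)

/-! ## Run-length distributions and their score -/

/-- A probability distribution on the positive integers with finite mean. -/
structure RunLengthDist where
  prob : ℕ → ℝ
  nonneg : ∀ r, 0 ≤ prob r
  prob_zero : prob 0 = 0
  hasSum_one : HasSum prob 1
  finite_mean : Summable fun r : ℕ => (r : ℝ) * prob r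

/-- The mean run length `∑ r, P_r r`. -/
def RunLengthDist.mean (P : RunLengthDist) : ℝ := ∑' r : ℕ, (r : ℝ) * P.prob r

/-- The information rate (in bits per run) of the memoryless channel on run lengths,
`∑ i, ∑ j, P_i P_{i → j} log₂ (P_{i → j} / ∑ i', P_{i'} P_{i' → j})`.
Terms with `P_i P_{i → j} = 0` are zero. -/
def memorylessRate (G : ℕ → ℝ) (P : RunLengthDist) : ℝ :=
  ∑' i : ℕ, ∑' j : ℕ, P.prob i * transition G i j *
    Real.logb 2 (transition G i j / ∑' i' : ℕ, P.prob i' * transition G i' j)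

/-- The heuristic score
`(1 / ∑ r, P_r r) * (R_memoryless - ∑ r, P_r Δ D_r)`, where `D_r = (G 0) ^ r` is the probability
that all bits of a run of length `r` are deleted. -/
def heuristicRate (G : ℕ → ℝ) (Δ : ℝ) (P : RunLengthDist) : ℝ :=
  1 / P.mean * (memorylessRate G P - ∑' r : ℕ, P.prob r * Δ * G 0 ^ r)

/-! ## A real RAM

A program is a finite piece of code over named integer variables and named arrays of real numbers.
An array cell is addressed as `a[x]`: the array with name `a`, at the index that is the current value
of the integer variable `x`. Every integer operation, every field operation on real numbers, every
conversion from an integer to a real number and every comparison takes one step. There are no roots,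
exponentials, logarithms or rounding of reals, and the only constants are natural numbers. -/

namespace RealRAM

/-- The field operations on real numbers (with `x / 0 = 0`). -/
inductive Op
  | add | sub | mul | div

def Op.eval : Op → ℝ → ℝ → ℝ
  | .add, x, y => x + y
  | .sub, x, y => x - y
  | .mul, x, y => x * y
  | .div, x, y => x / y

/-- The content of the memory: the integer variables, and the cells of the real arrays. -/
structure Memory where
  int : ℕ → ℕ
  real : ℕ → ℕ → ℝ

def Memory.setInt (s : Memory) (x n : ℕ) : Memory :=
  { s with int := Function.update s.int x n }

/-- The content of `a[x]`. -/
def Memory.get (s : Memory) (a x : ℕ) : ℝ := s.real a (s.int x)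

/-- Overwrite `a[x]`. -/
def Memory.set (s : Memory) (a x : ℕ) (v : ℝ) : Memory :=
  { s with real := Function.update s.real a (Function.update (s.real a) (s.int x) v) }

/-- Tests. -/
inductive Test
  /-- `x ≤ y` for integer variables -/
  | intLe (x y : ℕ)
  /-- `a[x] ≤ b[y]` -/
  | realLe (a x b y : ℕ)

def Test.Holds : Test → Memory → Prop
  | .intLe x y, s => s.int x ≤ s.int y
  | .realLe a x b y, s => s.get a x ≤ s.get b y

/-- Programs. -/
inductive Program
  /-- `x := n`, for a constant `n` -/
  | const (x n : ℕ)
  /-- `x := y + z` -/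
  | intAdd (x y z : ℕ)
  /-- `x := y - z`, or `0` if `y < z` -/
  | intSub (x y z : ℕ)
  /-- `a[x] := y`, for an integer variable `y` -/
  | ofInt (a x y : ℕ)
  /-- `a[x] := b[y] op c[z]` -/
  | op (o : Op) (a x b y c z : ℕ)
  /-- first `p`, then `q` -/
  | seq (p q : Program)
  /-- if `t` then `p` else `q` -/
  | branch (t : Test) (p q : Program)
  /-- while `t` do `p` -/
  | loop (t : Test) (p : Program)

/-- `Runs p s n s'`: started on the memory `s`, the program `p` halts after exactly `n` steps and
leaves the memory `s'`. -/
inductive Runs : Program → Memory → ℕ → Memory → Prop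
  | const (x n : ℕ) (s : Memory) : Runs (.const x n) s 1 (s.setInt x n)
  | intAdd (x y z : ℕ) (s : Memory) : Runs (.intAdd x y z) s 1 (s.setInt x (s.int y + s.int z))
  | intSub (x y z : ℕ) (s : Memory) : Runs (.intSub x y z) s 1 (s.setInt x (s.int y - s.int z))
  | ofInt (a x y : ℕ) (s : Memory) : Runs (.ofInt a x y) s 1 (s.set a x (s.int y : ℝ))
  | op (o : Op) (a x b y c z : ℕ) (s : Memory) :
      Runs (.op o a x b y c z) s 1 (s.set a x (o.eval (s.get b y) (s.get c z)))
  | seq {p q : Program} {s₁ s₂ s₃ : Memory} {m n : ℕ} :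
      Runs p s₁ m s₂ → Runs q s₂ n s₃ → Runs (.seq p q) s₁ (m + n) s₃
  | branch_true {t : Test} {p q : Program} {s s' : Memory} {n : ℕ} :
      t.Holds s → Runs p s n s' → Runs (.branch t p q) s (n + 1) s'
  | branch_false {t : Test} {p q : Program} {s s' : Memory} {n : ℕ} :
      ¬ t.Holds s → Runs q s n s' → Runs (.branch t p q) s (n + 1) s'
  | loop_true {t : Test} {p : Program} {s₁ s₂ s₃ : Memory} {m n : ℕ} :
      t.Holds s₁ → Runs p s₁ m s₂ → Runs (.loop t p) s₂ n s₃ → Runs (.loop t p) s₁ (m + n + 1) s₃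
  | loop_false {t : Test} {p : Program} {s : Memory} :
      ¬ t.Holds s → Runs (.loop t p) s 1 s

/-- The initial memory: the input numbers are in array `0`, everything else is zero. -/
def initial (input : List ℝ) : Memory where
  int := fun _ => 0
  real := fun a i => if a = 0 then input.getD i 0 else 0

/-- On the given input, `p` halts and returns the distribution `P`, within time `T`: at the end the
integer variable `0` holds a number `N`, and `P` is supported on `{1, …, N}`, where its weights are
the entries `1, …, N` of array `1`. Reading out each of the `N` weights is charged as one step. -/
def Returns (p : Program) (input : List ℝ) (P : RunLengthDist) (T : ℝ) : Prop :=
  ∃ (n : ℕ) (s : Memory), Runs p (initial input) n s ∧ ((n + s.int 0 : ℕ) : ℝ) ≤ T ∧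
    ∀ r : ℕ, P.prob r = if 1 ≤ r ∧ r ≤ s.int 0 then s.real 1 r else 0

end RealRAM

end

noncomputable section

open Finset

/-! Let `y i` be the fraction of transmitted bits that lie in runs of length `i`, so that `y i` is
proportional to `i * P_i`. In these coordinates the score per bit, in nats, is a concave function
`value` on the simplex, homogeneous of degree one. Its gradient is the vector of `score`s: the
relative entropy of row `i` to the output law, less the deletion penalty, divided by `i`. By
homogeneity `value = ∑ y i * score i`, so the Frank-Wolfe gap is the largest score minus the value.
A large gap gives progress, and a small gap gives a proof of near-optimality.

Progress: `tangent_sub_le_value` bounds the curvature of `value` by a chi-square distance of output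
masses. Steps go towards smoothed vertices, which keeps all weights at least `μ / N` and the
chi-square distance small; `value_add_le_value_simplexStep` then gives a definite increase while the
gap is large. Since `value` lies between `-D` and `N`, polynomially many steps suffice.

Near-optimality: by duality (`tsum_mul_rowDiv_le`), any output law `q` for which row `i` has
relative entropy at most `i κ + D W_{i0}` for every `i ≥ 1` bounds the score of all run-length laws
by `κ`. The output law of the last iterate controls only `i ≤ N` and `j ≤ J`. Mixing in a small
share `β` of the output law of heavy-tailed run lengths bounds every row by `log (i (i + 1) / β)`,
which is far below `i κ` for `i > N`. This is `InSimplex.heuristicRate_le_add`; it also shows that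
the supremum is finite. The loss from cutting the outputs at `J` is controlled by Markov's
inequality and `InSimplex.value_sub_le_heuristicRate`.

Field operations suffice: logarithms become Riemann sums, the factor `exp (-lam)` cancels when rows
are normalised, and rounding is replaced by counting. Let `L` bound the mean number of copies of a
bit. With `M ≥ 100` an integer exceeding `1 / ε + Δ + L`, the choices are `N = M ^ 4 + 1`, `J = M ^
20 + 1`, smoothing `1 / M ^ 8`, step size `1 / M ^ 16` and gap threshold `1 / M ^ 2`; the running
time is of order `M ^ 66`. -/

/-! ## A logarithm by field operations -/

/-- A Riemann sum for `log (1 + t) = ∫₀¹ t / (1 + u t) du` with `K` nodes. -/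
def logSum (K : ℕ) (t : ℝ) : ℝ := ∑ k ∈ Icc 1 K, t / (K + k * t)

/-- The integrand decreases in `u`, so right endpoints underestimate the integral, and the error is
at most its total drop `(r - 1) - (r - 1) / r` times the mesh `1 / K`. The induction proves this
cell by cell, without integrals. -/
lemma logSum_bounds {K : ℕ} (hK : 0 < K) {r : ℝ} (hr : 0 < r) :
    logSum K (r - 1) ≤ Real.log r ∧ Real.log r ≤ logSum K (r - 1) + (r - 1) ^ 2 / (K * r) := by
  have hK' : (0 : ℝ) < K := by exact_mod_cast hK
  have key : ∀ n : ℕ, n ≤ K →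
      (∑ k ∈ Icc 1 n, (r - 1) / (K + k * (r - 1)) ≤ Real.log ((K + n * (r - 1)) / K)) ∧
      Real.log ((K + n * (r - 1)) / K) ≤ (∑ k ∈ Icc 1 n, (r - 1) / (K + k * (r - 1))) +
        (r - 1) * (1 / K - 1 / (K + n * (r - 1))) := by
    intro n
    induction n with
    | zero => intro _; simp [hK'.ne']
    | succ n ih =>
      intro hn
      obtain ⟨h1, h2⟩ := ih (by omega)
      -- For `r < 1` this holds because the node equals `(K - m) + m r`.
      have pos : ∀ m : ℕ, m ≤ K → 0 < (K : ℝ) + m * (r - 1) := by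
        intro m hm
        have : (m : ℝ) ≤ K := by exact_mod_cast hm
        rcases Nat.eq_zero_or_pos m with rfl | h
        · simpa using hK'
        · have : (0 : ℝ) < m := by exact_mod_cast h
          nlinarith [mul_pos this hr]
      have ha := pos n (by omega)
      have hb := pos (n + 1) hn
      push_cast at hb ⊢
      set a := (K : ℝ) + n * (r - 1) with hadef
      set b := (K : ℝ) + (n + 1) * (r - 1) with hbdef
      have hab : b - a = r - 1 := by simp only [hadef, hbdef]; ring
      rw [Finset.sum_Icc_succ_top (by omega)]
      push_cast
      rw [← hbdef]
      have e : Real.log (b / K) = Real.log (a / K) + Real.log (b / a) := by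
        rw [← Real.log_mul (by positivity) (by positivity)]; congr 1; field_simp
      have u := Real.log_le_sub_one_of_pos (div_pos hb ha)
      have l := Real.one_sub_inv_le_log_of_pos (div_pos hb ha)
      have l' : 1 - (b / a)⁻¹ = (r - 1) / b := by rw [← hab]; field_simp
      have u' : b / a - 1 = (r - 1) / a := by rw [← hab]; field_simp
      rw [l'] at l
      rw [u'] at u
      rw [e]
      refine ⟨by linarith, ?_⟩
      have : (r - 1) * (1 / ↑K - 1 / b) = (r - 1) * (1 / ↑K - 1 / a) + (r - 1) / a - (r - 1) / b := by
        ring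
      rw [this]; linarith
  obtain ⟨h1, h2⟩ := key K le_rfl
  have e : ((K : ℝ) + K * (r - 1)) = K * r := by ring
  rw [e, mul_div_cancel_left₀ _ hK'.ne'] at h1 h2
  refine ⟨h1, h2.trans_eq ?_⟩
  simp only [logSum]
  congr 1
  field_simp

/-! ## Information rate per unit of length, for a finite channel -/

section Finite

variable (N J : ℕ) (V : ℕ → ℕ → ℝ)

/-- The number of runs per transmitted bit, if run length `i` accounts for a fraction `y i` of the
transmitted bits. -/
def runDensity (y : ℕ → ℝ) : ℝ := ∑ i ∈ Icc 1 N, y i / i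

/-- The law of the run lengths, if run length `i` accounts for a fraction `y i` of the bits. -/
def runLaw (y : ℕ → ℝ) (i : ℕ) : ℝ := y i / i / runDensity N y

/-- The law of the output. -/
def outLaw (y : ℕ → ℝ) (j : ℕ) : ℝ := ∑ i ∈ Icc 1 N, runLaw N y i * V i j

/-- The relative entropy of the `i`-th row with respect to the law of the output. -/
def rowEntropy (y : ℕ → ℝ) (i : ℕ) : ℝ :=
  ∑ j ∈ range (J + 1), V i j * Real.log (V i j / outLaw N V y j)

/-- The marginal score of run length `i`, per bit. -/
def score (D : ℝ) (y : ℕ → ℝ) (i : ℕ) : ℝ := (rowEntropy N J V y i - D * V i 0) / i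

/-- The score of the run-length law described by `y`, per bit. -/
def value (D : ℝ) (y : ℕ → ℝ) : ℝ := ∑ i ∈ Icc 1 N, y i * score N J V D y i

/-- The approximation of `score` that is computed by field operations. -/
def approxScore (K : ℕ) (Δ : ℝ) (y : ℕ → ℝ) (i : ℕ) : ℝ :=
  ((∑ j ∈ range (J + 1), V i j * logSum K (V i j / outLaw N V y j - 1)) -
    Δ * logSum K 1 * V i 0) / i

/-- The approximation of `value` that is computed by field operations. -/
def approxValue (K : ℕ) (Δ : ℝ) (y : ℕ → ℝ) : ℝ :=
  ∑ i ∈ Icc 1 N, y i * approxScore N J V K Δ y i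

/-- Rows `1, …, N` are probability vectors on `{0, …, J}`. -/
structure IsFiniteChannel : Prop where
  nonneg : ∀ i j, 0 ≤ V i j
  sum_eq : ∀ i ∈ Icc 1 N, ∑ j ∈ range (J + 1), V i j = 1

/-- A probability vector on `{1, …, N}` with entries at least `b`. -/
structure InSimplex (b : ℝ) (y : ℕ → ℝ) : Prop where
  le : ∀ i ∈ Icc 1 N, b ≤ y i
  sum_eq : ∑ i ∈ Icc 1 N, y i = 1

variable {N J V} {b : ℝ} {y : ℕ → ℝ}

lemma InSimplex.pos (hb : 0 < b) (hy : InSimplex N b y) {i : ℕ} (hi : i ∈ Icc 1 N) : 0 < y i :=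
  hb.trans_le (hy.le i hi)

lemma cast_pos_of_mem_Icc {i : ℕ} (hi : i ∈ Icc 1 N) : (0 : ℝ) < i := by
  have := (mem_Icc.1 hi).1
  exact_mod_cast this

lemma InSimplex.le_one (hb : 0 < b) (hy : InSimplex N b y) {i : ℕ} (hi : i ∈ Icc 1 N) :
    y i ≤ 1 := by
  rw [← hy.sum_eq]
  exact single_le_sum (f := y) (fun k hk => (hy.pos hb hk).le) hi

lemma InSimplex.runDensity_pos (hb : 0 < b) (hN : 0 < N) (hy : InSimplex N b y) :
    0 < runDensity N y :=
  sum_pos (fun i hi => div_pos (hy.pos hb hi) (cast_pos_of_mem_Icc hi)) ⟨1, by simp; omega⟩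

lemma InSimplex.runDensity_le_one (hb : 0 < b) (hy : InSimplex N b y) :
    runDensity N y ≤ 1 := by
  rw [← hy.sum_eq]
  refine sum_le_sum fun i hi => div_le_self (hy.pos hb hi).le ?_
  have := (mem_Icc.1 hi).1
  exact_mod_cast this

lemma InSimplex.runLaw_pos (hb : 0 < b) (hN : 0 < N) (hy : InSimplex N b y) {i : ℕ}
    (hi : i ∈ Icc 1 N) : 0 < runLaw N y i :=
  div_pos (div_pos (hy.pos hb hi) (cast_pos_of_mem_Icc hi)) (hy.runDensity_pos hb hN)

lemma InSimplex.sum_runLaw (hb : 0 < b) (hN : 0 < N) (hy : InSimplex N b y) :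
    ∑ i ∈ Icc 1 N, runLaw N y i = 1 := by
  unfold runLaw
  rw [← sum_div]
  exact div_self (hy.runDensity_pos hb hN).ne'

lemma InSimplex.sum_mul_runLaw (hy : InSimplex N b y) :
    ∑ i ∈ Icc 1 N, (i : ℝ) * runLaw N y i = 1 / runDensity N y := by
  rw [← hy.sum_eq, sum_div]
  refine sum_congr rfl fun i hi => ?_
  have := cast_pos_of_mem_Icc hi
  unfold runLaw
  field_simp

lemma InSimplex.runLaw_mul_le_outLaw (hb : 0 < b) (hN : 0 < N) (hy : InSimplex N b y)
    (hV : IsFiniteChannel N J V) {i : ℕ} (hi : i ∈ Icc 1 N) (j : ℕ) :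
    runLaw N y i * V i j ≤ outLaw N V y j :=
  single_le_sum (f := fun i => runLaw N y i * V i j)
    (fun k hk => mul_nonneg (hy.runLaw_pos hb hN hk).le (hV.nonneg k j)) hi

lemma InSimplex.outLaw_nonneg (hb : 0 < b) (hN : 0 < N) (hy : InSimplex N b y)
    (hV : IsFiniteChannel N J V) (j : ℕ) : 0 ≤ outLaw N V y j :=
  sum_nonneg fun k hk => mul_nonneg (hy.runLaw_pos hb hN hk).le (hV.nonneg k j)

lemma InSimplex.outLaw_pos (hb : 0 < b) (hN : 0 < N) (hy : InSimplex N b y)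
    (hV : IsFiniteChannel N J V) {i j : ℕ} (hi : i ∈ Icc 1 N) (h : 0 < V i j) :
    0 < outLaw N V y j :=
  (mul_pos (hy.runLaw_pos hb hN hi) h).trans_le (hy.runLaw_mul_le_outLaw hb hN hV hi j)

lemma InSimplex.sum_outLaw (hb : 0 < b) (hN : 0 < N) (hy : InSimplex N b y)
    (hV : IsFiniteChannel N J V) : ∑ j ∈ range (J + 1), outLaw N V y j = 1 := by
  unfold outLaw
  rw [sum_comm, ← hy.sum_runLaw hb hN]
  refine sum_congr rfl fun i hi => ?_
  rw [← mul_sum, hV.sum_eq i hi, mul_one]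

/-- The termwise form of Gibbs' inequality: summed over outputs it makes relative entropies
nonnegative, and for infinite series it supplies a summable minorant. -/
lemma mul_log_div_ge {v q : ℝ} (hv : 0 ≤ v) (hq : 0 ≤ q) (h : 0 < v → 0 < q) :
    v - q ≤ v * Real.log (v / q) := by
  rcases hv.eq_or_lt with rfl | hv'
  · simpa using hq
  · have := Real.one_sub_inv_le_log_of_pos (div_pos hv' (h hv'))
    have h2 := mul_le_mul_of_nonneg_left this hv
    have h3 : v * (1 - (v / q)⁻¹) = v - q := by have := h hv'; field_simp
    linarith

lemma InSimplex.rowEntropy_nonneg (hb : 0 < b) (hN : 0 < N) (hy : InSimplex N b y)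
    (hV : IsFiniteChannel N J V) {i : ℕ} (hi : i ∈ Icc 1 N) : 0 ≤ rowEntropy N J V y i := by
  have h : ∑ j ∈ range (J + 1), (V i j - outLaw N V y j) ≤ rowEntropy N J V y i :=
    sum_le_sum fun j _ => mul_log_div_ge (hV.nonneg i j) (hy.outLaw_nonneg hb hN hV j)
      (hy.outLaw_pos hb hN hV hi)
  rwa [sum_sub_distrib, hV.sum_eq i hi, hy.sum_outLaw hb hN hV, sub_self] at h

lemma InSimplex.div_outLaw_le (hb : 0 < b) (hN : 0 < N) (hy : InSimplex N b y)
    (hV : IsFiniteChannel N J V) {i : ℕ} (hi : i ∈ Icc 1 N) (j : ℕ) :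
    V i j / outLaw N V y j ≤ 1 / runLaw N y i := by
  have hP := hy.runLaw_pos hb hN hi
  rcases (hV.nonneg i j).eq_or_lt with h | h
  · rw [← h]; simp; exact hP.le
  · rw [div_le_div_iff₀ (hy.outLaw_pos hb hN hV hi h) hP]
    have := hy.runLaw_mul_le_outLaw hb hN hV hi j
    linarith

lemma InSimplex.rowEntropy_le (hb : 0 < b) (hN : 0 < N) (hy : InSimplex N b y)
    (hV : IsFiniteChannel N J V) {i : ℕ} (hi : i ∈ Icc 1 N) :
    rowEntropy N J V y i ≤ Real.log (1 / runLaw N y i) := by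
  have hP := hy.runLaw_pos hb hN hi
  have h : rowEntropy N J V y i ≤ ∑ j ∈ range (J + 1), V i j * Real.log (1 / runLaw N y i) := by
    refine sum_le_sum fun j _ => ?_
    rcases (hV.nonneg i j).eq_or_lt with h | h
    · simp [← h]
    · refine mul_le_mul_of_nonneg_left (Real.log_le_log ?_ (hy.div_outLaw_le hb hN hV hi j)) h.le
      exact div_pos h (hy.outLaw_pos hb hN hV hi h)
  rwa [← sum_mul, hV.sum_eq i hi, one_mul] at h

/-- Mutual information is at most the input entropy, here bounded crudely by `p log (1 / p) ≤ 1 - p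
≤ 1` for each input. -/
lemma InSimplex.sum_runLaw_mul_rowEntropy_le (hb : 0 < b) (hN : 0 < N) (hy : InSimplex N b y)
    (hV : IsFiniteChannel N J V) :
    ∑ i ∈ Icc 1 N, runLaw N y i * rowEntropy N J V y i ≤ N := by
  have : ∑ i ∈ Icc 1 N, runLaw N y i * rowEntropy N J V y i ≤ ∑ i ∈ Icc 1 N, 1 := by
    refine sum_le_sum fun i hi => ?_
    have hP := hy.runLaw_pos hb hN hi
    have h1 := hy.rowEntropy_le hb hN hV hi
    have h2 := Real.log_le_sub_one_of_pos (one_div_pos.2 hP)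
    calc _ ≤ runLaw N y i * (1 / runLaw N y i - 1) :=
          mul_le_mul_of_nonneg_left (h1.trans h2) hP.le
      _ = 1 - runLaw N y i := by field_simp
      _ ≤ 1 := by linarith
  simpa using this

lemma IsFiniteChannel.le_one (hV : IsFiniteChannel N J V) {i j : ℕ} (hi : i ∈ Icc 1 N)
    (hj : j ≤ J) : V i j ≤ 1 := by
  rw [← hV.sum_eq i hi]
  exact single_le_sum (f := V i) (fun k _ => hV.nonneg i k) (by simp; omega)

/-- `runDensity` is the reciprocal of the mean run length, so this recovers the form of the
heuristic score. -/
lemma InSimplex.value_eq (hb : 0 < b) (hN : 0 < N) (hy : InSimplex N b y) (D : ℝ) :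
    value N J V D y = runDensity N y *
      (∑ i ∈ Icc 1 N, runLaw N y i * rowEntropy N J V y i -
        ∑ i ∈ Icc 1 N, runLaw N y i * D * V i 0) := by
  have hs := hy.runDensity_pos hb hN
  rw [← sum_sub_distrib, mul_sum]
  refine sum_congr rfl fun i hi => ?_
  have := cast_pos_of_mem_Icc hi
  unfold score runLaw
  field_simp

lemma InSimplex.value_le (hb : 0 < b) (hN : 0 < N) (hy : InSimplex N b y)
    (hV : IsFiniteChannel N J V) {D : ℝ} (hD : 0 ≤ D) : value N J V D y ≤ N := by
  have hs := hy.runDensity_pos hb hN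
  have hs1 := hy.runDensity_le_one hb
  rw [hy.value_eq hb hN]
  have h1 := hy.sum_runLaw_mul_rowEntropy_le hb hN hV
  have h2 : 0 ≤ ∑ i ∈ Icc 1 N, runLaw N y i * D * V i 0 :=
    sum_nonneg fun i hi => mul_nonneg (mul_nonneg (hy.runLaw_pos hb hN hi).le hD) (hV.nonneg _ _)
  have h3 : (0 : ℝ) ≤ N := by positivity
  nlinarith

/-- The denominator `i` matters at `i = N`: the longest run length has a nearly nonnegative score,
which later keeps the value from being very negative when the gap is small. -/
lemma InSimplex.neg_div_le_score (hb : 0 < b) (hN : 0 < N) (hy : InSimplex N b y)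
    (hV : IsFiniteChannel N J V) {D : ℝ} (hD : 0 ≤ D) {i : ℕ} (hi : i ∈ Icc 1 N) :
    -(D / i) ≤ score N J V D y i := by
  have := cast_pos_of_mem_Icc hi
  unfold score
  rw [← neg_div]
  gcongr
  have h1 := hy.rowEntropy_nonneg hb hN hV hi
  have h2 := hV.le_one hi (Nat.zero_le J)
  nlinarith

lemma InSimplex.neg_le_score (hb : 0 < b) (hN : 0 < N) (hy : InSimplex N b y)
    (hV : IsFiniteChannel N J V) {D : ℝ} (hD : 0 ≤ D) {i : ℕ} (hi : i ∈ Icc 1 N) :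
    -D ≤ score N J V D y i := by
  have h1 := hy.neg_div_le_score hb hN hV hD hi
  have : (1 : ℝ) ≤ i := by exact_mod_cast (mem_Icc.1 hi).1
  have := div_le_self hD this
  linarith

lemma InSimplex.neg_le_value (hb : 0 < b) (hN : 0 < N) (hy : InSimplex N b y)
    (hV : IsFiniteChannel N J V) {D : ℝ} (hD : 0 ≤ D) : -D ≤ value N J V D y := by
  have : ∑ i ∈ Icc 1 N, y i * (-D) ≤ value N J V D y :=
    sum_le_sum fun i hi => mul_le_mul_of_nonneg_left (hy.neg_le_score hb hN hV hD hi)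
      (hy.pos hb hi).le
  rwa [← sum_mul, hy.sum_eq, one_mul] at this

/-! ### The Frank-Wolfe step and its guaranteed gain -/

/-- The output mass per transmitted bit. -/
def outMass (N : ℕ) (V : ℕ → ℕ → ℝ) (y : ℕ → ℝ) (j : ℕ) : ℝ := ∑ i ∈ Icc 1 N, y i / i * V i j

lemma InSimplex.outMass_eq (hb : 0 < b) (hN : 0 < N) (hy : InSimplex N b y) (j : ℕ) :
    outMass N V y j = runDensity N y * outLaw N V y j := by
  have hs := hy.runDensity_pos hb hN
  unfold outMass outLaw
  rw [mul_sum]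
  refine sum_congr rfl fun i _ => ?_
  unfold runLaw
  field_simp

lemma sum_outMass (hV : IsFiniteChannel N J V) (y : ℕ → ℝ) :
    ∑ j ∈ range (J + 1), outMass N V y j = runDensity N y := by
  unfold outMass runDensity
  rw [sum_comm]
  refine sum_congr rfl fun i hi => ?_
  rw [← mul_sum, hV.sum_eq i hi, mul_one]

/-- From `log (m' / m) ≤ m' / m - 1`, which turns a relative entropy term into a chi-square term
plus a linear term. The masses `m`, `m'` are left unnormalised, so the totals `s`, `s'` enter only
through a term whose sum over `j` is explicit. -/
lemma mass_mul_log_ge {m m' s s' : ℝ} (hm : 0 ≤ m) (hm' : 0 ≤ m') (h : 0 < m' → 0 < m)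
    (hs : 0 < s) (hs' : 0 < s') :
    -((m' - m) ^ 2 / m) - (m' - m) + m' * (Real.log s' - Real.log s) ≤
      m' * (Real.log (m / s) - Real.log (m' / s')) := by
  rcases hm'.eq_or_lt with rfl | h'
  · rcases hm.eq_or_lt with rfl | h0
    · simp
    · simp only [zero_mul]
      have : (0 - m) ^ 2 / m = m := by field_simp; ring
      rw [this]; linarith
  · have h0 := h h'
    rw [Real.log_div h0.ne' hs.ne', Real.log_div h'.ne' hs'.ne']
    have h1 := Real.log_le_sub_one_of_pos (div_pos h' h0)
    rw [Real.log_div h'.ne' h0.ne'] at h1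
    have h2 := mul_le_mul_of_nonneg_left h1 hm'
    have h3 : m' * (m' / m - 1) = (m' - m) ^ 2 / m + (m' - m) := by field_simp; ring
    nlinarith

/-- A second-order lower bound of the concave function `value` by its tangent. -/
lemma tangent_sub_le_value {b' : ℝ} {y' : ℕ → ℝ} (hb : 0 < b) (hb' : 0 < b') (hN : 0 < N)
    (hy : InSimplex N b y) (hy' : InSimplex N b' y') (hV : IsFiniteChannel N J V) (D : ℝ) :
    ∑ i ∈ Icc 1 N, y' i * score N J V D y i -
      ∑ j ∈ range (J + 1), (outMass N V y' j - outMass N V y j) ^ 2 / outMass N V y j ≤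
    value N J V D y' := by
  have hs := hy.runDensity_pos hb hN
  have hs' := hy'.runDensity_pos hb' hN
  -- The penalties and the terms `log V` cancel; what remains is minus a multiple of the relative
  -- entropy between the two output laws.
  have e1 : value N J V D y' - ∑ i ∈ Icc 1 N, y' i * score N J V D y i =
      ∑ j ∈ range (J + 1), outMass N V y' j *
        (Real.log (outLaw N V y j) - Real.log (outLaw N V y' j)) := by
    unfold value
    rw [← sum_sub_distrib]
    simp only [outMass, sum_mul]
    rw [sum_comm]
    refine sum_congr rfl fun i hi => ?_
    have hi0 := cast_pos_of_mem_Icc hi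
    have : y' i * score N J V D y' i - y' i * score N J V D y i =
        y' i / i * (rowEntropy N J V y' i - rowEntropy N J V y i) := by
      unfold score; field_simp; ring
    rw [this]
    unfold rowEntropy
    rw [← sum_sub_distrib, mul_sum]
    refine sum_congr rfl fun j _ => ?_
    rcases (hV.nonneg i j).eq_or_lt with h | h
    · simp [← h]
    · rw [Real.log_div h.ne' (hy.outLaw_pos hb hN hV hi h).ne',
        Real.log_div h.ne' (hy'.outLaw_pos hb' hN hV hi h).ne']
      ring
  have e2 : ∑ j ∈ range (J + 1), (-((outMass N V y' j - outMass N V y j) ^ 2 / outMass N V y j) -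
      (outMass N V y' j - outMass N V y j) +
      outMass N V y' j * (Real.log (runDensity N y') - Real.log (runDensity N y))) ≤
      ∑ j ∈ range (J + 1), outMass N V y' j *
        (Real.log (outLaw N V y j) - Real.log (outLaw N V y' j)) := by
    refine sum_le_sum fun j _ => ?_
    have o1 : outLaw N V y j = outMass N V y j / runDensity N y := by
      rw [hy.outMass_eq hb hN]; field_simp
    have o2 : outLaw N V y' j = outMass N V y' j / runDensity N y' := by
      rw [hy'.outMass_eq hb' hN]; field_simp
    rw [o1, o2]
    refine mass_mul_log_ge ?_ ?_ ?_ hs hs'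
    · rw [hy.outMass_eq hb hN]; exact mul_nonneg hs.le (hy.outLaw_nonneg hb hN hV j)
    · rw [hy'.outMass_eq hb' hN]; exact mul_nonneg hs'.le (hy'.outLaw_nonneg hb' hN hV j)
    · intro h
      obtain ⟨i, hi, h⟩ := exists_ne_zero_of_sum_ne_zero h.ne'
      rw [hy.outMass_eq hb hN]
      exact mul_pos hs (hy.outLaw_pos hb hN hV hi
        ((hV.nonneg i j).lt_of_ne (right_ne_zero_of_mul h).symm))
  rw [sum_add_distrib, sum_sub_distrib, sum_neg_distrib, sum_sub_distrib, ← sum_mul,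
    sum_outMass hV, sum_outMass hV] at e2
  -- The total masses do no harm: `s' log (s' / s) ≥ s' - s` absorbs the linear terms left over in
  -- `e2`.
  have h1 := Real.one_sub_inv_le_log_of_pos (div_pos hs' hs)
  rw [Real.log_div hs'.ne' hs.ne'] at h1
  have h2 := mul_le_mul_of_nonneg_left h1 hs'.le
  have h3 : runDensity N y' * (1 - (runDensity N y' / runDensity N y)⁻¹) =
    runDensity N y' - runDensity N y := by field_simp
  linarith

/-- A step of size `γ` from `y` towards the smoothed vertex `k` of the simplex. -/
def simplexStep (N : ℕ) (γ μ : ℝ) (k : ℕ) (y : ℕ → ℝ) (i : ℕ) : ℝ :=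
  (1 - γ) * y i + γ * μ / N + if i = k then γ * (1 - μ) else 0

/-- The smoothed vertex `k` of the simplex. -/
def smoothVertex (N : ℕ) (μ : ℝ) (k i : ℕ) : ℝ := μ / N + if i = k then 1 - μ else 0

lemma simplexStep_eq (γ μ : ℝ) (k : ℕ) (y : ℕ → ℝ) (i : ℕ) :
    simplexStep N γ μ k y i = (1 - γ) * y i + γ * smoothVertex N μ k i := by
  unfold simplexStep smoothVertex
  split_ifs <;> ring

lemma sum_smoothVertex_mul {μ : ℝ} {k : ℕ} (hk : k ∈ Icc 1 N) (f : ℕ → ℝ) :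
    ∑ i ∈ Icc 1 N, smoothVertex N μ k i * f i =
      (1 - μ) * f k + μ / N * ∑ i ∈ Icc 1 N, f i := by
  simp only [smoothVertex, add_mul, sum_add_distrib, ite_mul, zero_mul, sum_ite_eq', hk, if_true,
    mul_sum]
  ring

lemma inSimplex_smoothVertex {μ : ℝ} (hμ1 : μ ≤ 1) (hN : 0 < N) {k : ℕ} (hk : k ∈ Icc 1 N) :
    InSimplex N (μ / N) (smoothVertex N μ k) := by
  constructor
  · intro i _
    unfold smoothVertex
    split_ifs <;> linarith
  · have := sum_smoothVertex_mul (μ := μ) hk fun _ => 1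
    simp only [mul_one, sum_const, Nat.card_Icc, Nat.add_sub_cancel, nsmul_eq_mul] at this
    rw [this]
    have : (N : ℝ) ≠ 0 := by exact_mod_cast hN.ne'
    field_simp
    ring

lemma InSimplex.simplexStep {γ μ : ℝ} (hγ : 0 ≤ γ) (hγ1 : γ ≤ 1) (hμ1 : μ ≤ 1)
    (hN : 0 < N) {k : ℕ} (hk : k ∈ Icc 1 N) (hy : InSimplex N (μ / N) y) :
    InSimplex N (μ / N) (simplexStep N γ μ k y) := by
  have hv := inSimplex_smoothVertex hμ1 hN hk
  constructor
  · intro i hi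
    rw [simplexStep_eq]
    nlinarith [hv.le i hi, hy.le i hi]
  · simp only [simplexStep_eq, sum_add_distrib, ← mul_sum, hv.sum_eq, hy.sum_eq]
    ring

lemma InSimplex.outMass_nonneg (hb : 0 < b) (hN : 0 < N) (hy : InSimplex N b y)
    (hV : IsFiniteChannel N J V) (j : ℕ) : 0 ≤ outMass N V y j := by
  rw [hy.outMass_eq hb hN]
  exact mul_nonneg (hy.runDensity_pos hb hN).le (hy.outLaw_nonneg hb hN hV j)

/-- The linear gain is `γ g`, reduced by the share `μ` of the direction spent on smoothing. The
quadratic loss is bounded because the smoothed weights of `y` dominate every probability vector up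
to the factor `N / μ`. -/
lemma value_add_le_value_simplexStep {γ μ D g : ℝ} (hγ : 0 ≤ γ) (hγ1 : γ ≤ 1) (hμ : 0 < μ)
    (hμ1 : μ ≤ 1) (hD : 0 ≤ D) (hN : 0 < N) {k : ℕ} (hk : k ∈ Icc 1 N)
    (hy : InSimplex N (μ / N) y) (hV : IsFiniteChannel N J V)
    (hg : value N J V D y + g ≤ score N J V D y k) :
    value N J V D y + γ * ((1 - μ) * g - μ * (N + D)) - γ ^ 2 * (N / μ + 1) ≤
      value N J V D (simplexStep N γ μ k y) := by
  have hN' : (0 : ℝ) < N := by exact_mod_cast hN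
  have hb : 0 < μ / N := div_pos hμ hN'
  have hv := inSimplex_smoothVertex hμ1 hN hk
  have hy' := hy.simplexStep hγ hγ1 hμ1 hN hk
  have ht := tangent_sub_le_value hb hb hN hy hy' hV D
  have e1 : ∑ i ∈ Icc 1 N, simplexStep N γ μ k y i * score N J V D y i =
      (1 - γ) * value N J V D y + γ * ((1 - μ) * score N J V D y k +
        μ / N * ∑ i ∈ Icc 1 N, score N J V D y i) := by
    rw [← sum_smoothVertex_mul hk]
    unfold value
    simp only [simplexStep_eq, add_mul, sum_add_distrib, mul_sum, mul_assoc]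
  have e2 : -(μ * D) ≤ μ / N * ∑ i ∈ Icc 1 N, score N J V D y i := by
    have : ∑ i ∈ Icc 1 N, (-D) ≤ ∑ i ∈ Icc 1 N, score N J V D y i :=
      sum_le_sum fun i hi => hy.neg_le_score hb hN hV hD hi
    simp only [sum_const, Nat.card_Icc, Nat.add_sub_cancel, nsmul_eq_mul] at this
    calc -(μ * D) = μ / N * (N * -D) := by field_simp
      _ ≤ _ := mul_le_mul_of_nonneg_left this hb.le
  have e3 : ∑ j ∈ range (J + 1),
      (outMass N V (simplexStep N γ μ k y) j - outMass N V y j) ^ 2 / outMass N V y j ≤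
      γ ^ 2 * (N / μ + 1) := by
    have hB : 0 ≤ (N : ℝ) / μ := by positivity
    have : ∀ j ∈ range (J + 1),
        (outMass N V (simplexStep N γ μ k y) j - outMass N V y j) ^ 2 / outMass N V y j ≤
        γ ^ 2 * (N / μ * outMass N V (smoothVertex N μ k) j + outMass N V y j) := by
      intro j _
      have d : outMass N V (simplexStep N γ μ k y) j - outMass N V y j =
          γ * (outMass N V (smoothVertex N μ k) j - outMass N V y j) := by
        unfold outMass
        rw [← sum_sub_distrib, ← sum_sub_distrib, mul_sum]
        refine sum_congr rfl fun i _ => ?_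
        rw [simplexStep_eq]; ring
      have m0 := hy.outMass_nonneg hb hN hV j
      have v0 := hv.outMass_nonneg hb hN hV j
      -- With `a ≤ (N / μ) m` one has `(a - m) ^ 2 / m ≤ (N / μ) a + m`, which sums to at most `N /
      -- μ + 1`.
      have dom : outMass N V (smoothVertex N μ k) j ≤ N / μ * outMass N V y j := by
        unfold outMass
        rw [mul_sum]
        refine sum_le_sum fun i hi => ?_
        have hi0 := cast_pos_of_mem_Icc hi
        rw [← mul_assoc]
        refine mul_le_mul_of_nonneg_right ?_ (hV.nonneg i j)
        rw [← mul_div_assoc]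
        gcongr
        calc smoothVertex N μ k i ≤ 1 := hv.le_one hb hi
          _ = N / μ * (μ / N) := by field_simp
          _ ≤ _ := mul_le_mul_of_nonneg_left (hy.le i hi) hB
      rw [d, mul_pow, mul_div_assoc]
      refine mul_le_mul_of_nonneg_left ?_ (sq_nonneg γ)
      rcases m0.eq_or_lt with h | h
      · rw [← h]; simp; positivity
      · rw [div_le_iff₀ h]
        nlinarith [mul_nonneg v0 m0, mul_le_mul_of_nonneg_left dom v0]
    refine (sum_le_sum this).trans ?_
    rw [← mul_sum, sum_add_distrib, ← mul_sum, sum_outMass hV, sum_outMass hV]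
    refine mul_le_mul_of_nonneg_left ?_ (sq_nonneg γ)
    have a1 := hv.runDensity_le_one hb
    have a2 := hy.runDensity_le_one hb
    nlinarith
  rw [e1] at ht
  have hle := hy.value_le hb hN hV hD
  have h4 : (1 - μ) * (value N J V D y + g) ≤ (1 - μ) * score N J V D y k :=
    mul_le_mul_of_nonneg_left hg (by linarith)
  have h5 : γ * (value N J V D y + ((1 - μ) * g - μ * (N + D))) ≤
      γ * ((1 - μ) * score N J V D y k + μ / N * ∑ i ∈ Icc 1 N, score N J V D y i) := by
    refine mul_le_mul_of_nonneg_left ?_ hγ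
    nlinarith
  nlinarith

/-- At `r = V / q` the Riemann error `(r - 1) ^ 2 / (K r)`, weighted by `V`, equals `(V r - 2 V + q)
/ K`. The sums of `q` and `V` agree, and `r ≤ 1 / runLaw ≤ N / b`, so the error does not grow with
the number of outputs. The penalty needs an approximation too, since it contains `log 2`. -/
lemma abs_approxScore_sub_score_le {Δ : ℝ} (hb : 0 < b) (hΔ : 0 ≤ Δ) (hN : 0 < N) {K : ℕ}
    (hK : 0 < K) (hy : InSimplex N b y) (hV : IsFiniteChannel N J V) {i : ℕ} (hi : i ∈ Icc 1 N) :
    |approxScore N J V K Δ y i - score N J V (Δ * Real.log 2) y i| ≤ (N / b + Δ) / K := by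
  have hK' : (0 : ℝ) < K := by exact_mod_cast hK
  have hi1 : (1 : ℝ) ≤ i := by exact_mod_cast (mem_Icc.1 hi).1
  have hP := hy.runLaw_pos hb hN hi
  set A := ∑ j ∈ range (J + 1), V i j * logSum K (V i j / outLaw N V y j - 1)
  have a1 : A ≤ rowEntropy N J V y i := by
    refine sum_le_sum fun j _ => ?_
    rcases (hV.nonneg i j).eq_or_lt with h | h
    · simp [← h]
    · exact mul_le_mul_of_nonneg_left
        (logSum_bounds hK (div_pos h (hy.outLaw_pos hb hN hV hi h))).1 h.le
  have hPb : 1 / runLaw N y i ≤ N / b := by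
    unfold runLaw
    have hs := hy.runDensity_pos hb hN
    have hs1 := hy.runDensity_le_one hb
    have hyi := hy.pos hb hi
    have hi0 := cast_pos_of_mem_Icc hi
    have hiN : (i : ℝ) ≤ N := by exact_mod_cast (mem_Icc.1 hi).2
    have : 1 / (y i / i / runDensity N y) = runDensity N y * i / y i := by field_simp
    rw [this]
    refine div_le_div₀ (by positivity) ?_ hb (hy.le i hi)
    nlinarith
  have a2 : rowEntropy N J V y i ≤ A + (N / b) / K := by
    have : rowEntropy N J V y i ≤ ∑ j ∈ range (J + 1),
        (V i j * logSum K (V i j / outLaw N V y j - 1) + V i j * ((N / b) / K)  +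
          (outLaw N V y j - V i j) / K) := by
      refine sum_le_sum fun j _ => ?_
      rcases (hV.nonneg i j).eq_or_lt with h | h
      · have := hy.outLaw_nonneg hb hN hV j
        rw [← h]; simp; positivity
      · have hq := hy.outLaw_pos hb hN hV hi h
        have l := (logSum_bounds hK (div_pos h hq)).2
        have l2 := mul_le_mul_of_nonneg_left l h.le
        have r := (hy.div_outLaw_le hb hN hV hi j).trans hPb
        have e : V i j * ((V i j / outLaw N V y j - 1) ^ 2 / (K * (V i j / outLaw N V y j))) =
            V i j * (V i j / outLaw N V y j) / K + (outLaw N V y j - V i j) / K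
              - V i j / K := by field_simp; ring
        have r2 : V i j * (V i j / outLaw N V y j) / K ≤ V i j * ((N / b) / K) := by
          rw [mul_div_assoc]; gcongr
        have : 0 ≤ V i j / K := by positivity
        rw [mul_add] at l2
        linarith
    refine this.trans_eq ?_
    rw [sum_add_distrib, sum_add_distrib, ← sum_mul, ← sum_div, sum_sub_distrib, hV.sum_eq i hi,
      hy.sum_outLaw hb hN hV]
    ring
  have b0 := logSum_bounds hK (r := 2) (by norm_num)
  rw [show (2 : ℝ) - 1 = 1 by norm_num] at b0
  obtain ⟨b1, b2⟩ := b0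
  have b3 : (1 : ℝ) ^ 2 / (K * 2) ≤ 1 / K := by
    rw [one_pow]; gcongr; linarith
  have v0 := hV.nonneg i 0
  have v1 := hV.le_one hi (Nat.zero_le J)
  have c1 : Δ * logSum K 1 * V i 0 ≤ Δ * Real.log 2 * V i 0 := by gcongr
  have c2 : Δ * Real.log 2 * V i 0 ≤ Δ * logSum K 1 * V i 0 + Δ / K := by
    have h1 : Δ * (Real.log 2 - logSum K 1) ≤ Δ * (1 / K) :=
      mul_le_mul_of_nonneg_left (by linarith) hΔ
    have h2 : 0 ≤ Δ * (Real.log 2 - logSum K 1) := mul_nonneg hΔ (by linarith)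
    have h3 : Δ / K = Δ * (1 / K) := by ring
    nlinarith
  have e : approxScore N J V K Δ y i - score N J V (Δ * Real.log 2) y i =
      ((A - Δ * logSum K 1 * V i 0) - (rowEntropy N J V y i - Δ * Real.log 2 * V i 0)) / i := by
    unfold approxScore score; ring
  have hNb : (0 : ℝ) ≤ N / b / K := by positivity
  have hΔK : 0 ≤ Δ / K := by positivity
  rw [e, abs_div, abs_of_pos (a := (i : ℝ)) (by linarith)]
  refine (div_le_self (abs_nonneg _) hi1).trans ?_
  rw [add_div, abs_le]
  constructor <;> linarith

lemma abs_approxValue_sub_value_le {Δ : ℝ} (hb : 0 < b) (hΔ : 0 ≤ Δ) (hN : 0 < N) {K : ℕ}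
    (hK : 0 < K) (hy : InSimplex N b y) (hV : IsFiniteChannel N J V) :
    |approxValue N J V K Δ y - value N J V (Δ * Real.log 2) y| ≤ (N / b + Δ) / K := by
  unfold approxValue value
  rw [← sum_sub_distrib]
  refine (abs_sum_le_sum_abs _ _).trans ?_
  have : ∀ i ∈ Icc 1 N, |y i * approxScore N J V K Δ y i - y i * score N J V (Δ * Real.log 2) y i|
      ≤ y i * ((N / b + Δ) / K) := by
    intro i hi
    rw [← mul_sub, abs_mul, abs_of_pos (hy.pos hb hi)]
    exact mul_le_mul_of_nonneg_left (abs_approxScore_sub_score_le hb hΔ hN hK hy hV hi)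
      (hy.pos hb hi).le
  refine (sum_le_sum this).trans_eq ?_
  rw [← sum_mul, hy.sum_eq, one_mul]

end Finite

/-! ## Certificates for channels with countably many inputs and outputs -/

/-- Every row of `W` is a probability distribution. -/
structure IsChannel (W : ℕ → ℕ → ℝ) : Prop where
  nonneg : ∀ i j, 0 ≤ W i j
  hasSum : ∀ i, HasSum (W i) 1

/-- The law of the output for the input law `p`. -/
def channelOut (W : ℕ → ℕ → ℝ) (p : ℕ → ℝ) (j : ℕ) : ℝ := ∑' i, p i * W i j

/-- The relative entropy of the `i`-th row with respect to `q`. -/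
def rowDiv (W : ℕ → ℕ → ℝ) (q : ℕ → ℝ) (i : ℕ) : ℝ := ∑' j, W i j * Real.log (W i j / q j)

/-- Tonelli's theorem for double series. -/
lemma hasSum_swap_of_nonneg {F : ℕ → ℕ → ℝ} {f : ℕ → ℝ} {c : ℝ} (hF : ∀ i j, 0 ≤ F i j)
    (h1 : ∀ i, HasSum (F i) (f i)) (h2 : HasSum f c) :
    (∀ j, Summable fun i => F i j) ∧ HasSum (fun j => ∑' i, F i j) c := by
  have hs : Summable fun x : ℕ × ℕ => F x.1 x.2 := by
    rw [summable_prod_of_nonneg fun x => hF x.1 x.2]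
    refine ⟨fun i => (h1 i).summable, ?_⟩
    simp only [(h1 _).tsum_eq]
    exact h2.summable
  have hc : HasSum (fun x : ℕ × ℕ => F x.1 x.2) c := by
    have h3 := hs.hasSum.prod_fiberwise (f := fun x : ℕ × ℕ => F x.1 x.2) h1
    rw [← h3.unique h2]
    exact hs.hasSum
  have hc' : HasSum (fun x : ℕ × ℕ => F x.2 x.1) c := (Equiv.prodComm ℕ ℕ).hasSum_iff.2 hc
  have h4 : ∀ j, Summable fun i => F i j := fun j => hc'.summable.prod_factor j
  exact ⟨h4, hc'.prod_fiberwise fun j => (h4 j).hasSum⟩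

section

variable {W : ℕ → ℕ → ℝ} (hW : IsChannel W) {p : ℕ → ℝ} (hp : ∀ i, 0 ≤ p i) {c : ℝ}
  (hc : HasSum p c)
include hW hp hc

lemma IsChannel.summable_mul (j : ℕ) : Summable fun i => p i * W i j :=
  (hasSum_swap_of_nonneg (fun i j => mul_nonneg (hp i) (hW.nonneg i j))
    (fun i => by simpa using (hW.hasSum i).mul_left (p i)) hc).1 j

lemma IsChannel.hasSum_channelOut : HasSum (channelOut W p) c :=
  (hasSum_swap_of_nonneg (fun i j => mul_nonneg (hp i) (hW.nonneg i j))
    (fun i => by simpa using (hW.hasSum i).mul_left (p i)) hc).2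

lemma IsChannel.mul_le_channelOut (i j : ℕ) : p i * W i j ≤ channelOut W p j :=
  le_hasSum (hW.summable_mul hp hc j).hasSum i fun k _ => mul_nonneg (hp k) (hW.nonneg k j)

omit hc in
lemma IsChannel.channelOut_nonneg (j : ℕ) : 0 ≤ channelOut W p j :=
  tsum_nonneg fun k => mul_nonneg (hp k) (hW.nonneg k j)

end

lemma mul_log_div_le {v q A : ℝ} (hv : 0 ≤ v) (hA : v ≤ A * q) (hA0 : 0 < A) :
    v * Real.log (v / q) ≤ v * Real.log A := by
  rcases hv.eq_or_lt with rfl | h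
  · simp
  · have hq : 0 < q := pos_of_mul_pos_right (h.trans_le hA) hA0.le
    refine mul_le_mul_of_nonneg_left (Real.log_le_log (div_pos h hq) ?_) hv
    rwa [div_le_iff₀ hq]

/-- The terms are squeezed between `v - q` and `v log A`. Convergence has to be known each time,
because `∑'` of a divergent series is `0` and would make entropy bounds meaningless. -/
lemma summable_mul_log_div {v q : ℕ → ℝ} {A : ℝ} (hv : ∀ j, 0 ≤ v j) (hq : ∀ j, 0 ≤ q j)
    (hA : ∀ j, v j ≤ A * q j) (hA0 : 0 < A) (hvs : Summable v) (hqs : Summable q) :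
    Summable fun j => v j * Real.log (v j / q j) := by
  have h1 : ∀ j, v j - q j ≤ v j * Real.log (v j / q j) := fun j =>
    mul_log_div_ge (hv j) (hq j) fun h => pos_of_mul_pos_right (h.trans_le (hA j)) hA0.le
  have h2 : ∀ j, v j * Real.log (v j / q j) ≤ v j * Real.log A := fun j =>
    mul_log_div_le (hv j) (hA j) hA0
  have h3 : Summable fun j => v j * Real.log (v j / q j) - (v j - q j) :=
    Summable.of_nonneg_of_le (fun j => sub_nonneg.2 (h1 j)) (fun j => sub_le_sub_right (h2 j) _)
      ((hvs.mul_right _).sub (hvs.sub hqs))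
  simpa using h3.add (hvs.sub hqs)

lemma memorylessRate_mul_log_two (G : ℕ → ℝ) (P : RunLengthDist) :
    memorylessRate G P * Real.log 2 =
      ∑' i, P.prob i * rowDiv (transition G) (channelOut (transition G) P.prob) i := by
  have hl : Real.log 2 ≠ 0 := (Real.log_pos one_lt_two).ne'
  unfold memorylessRate rowDiv channelOut
  rw [← tsum_mul_right]
  refine tsum_congr fun i => ?_
  rw [← tsum_mul_right, ← tsum_mul_left]
  refine tsum_congr fun j => ?_
  unfold Real.logb
  field_simp

lemma RunLengthDist.one_le_mean (P : RunLengthDist) : 1 ≤ P.mean := by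
  refine hasSum_le (fun r => ?_) P.hasSum_one P.finite_mean.hasSum
  rcases Nat.eq_zero_or_pos r with rfl | h
  · simp [P.prob_zero]
  · have : (1 : ℝ) ≤ r := by exact_mod_cast h
    have := P.nonneg r
    nlinarith

/-- An output law `q` whose relative entropies are at most `i κ + D W_{i0}` bounds the information
rate of every input law. -/
lemma tsum_mul_rowDiv_le {W : ℕ → ℕ → ℝ} (hW : IsChannel W) (P : RunLengthDist) {q A : ℕ → ℝ}
    {κ D : ℝ} (hq : ∀ j, 0 ≤ q j) (hqs : Summable q) (hq1 : ∑' j, q j ≤ 1)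
    (hA0 : ∀ i, 1 ≤ i → 0 < A i) (hA : ∀ i, 1 ≤ i → ∀ j, W i j ≤ A i * q j)
    (hdiv : ∀ i, 1 ≤ i → rowDiv W q i ≤ i * κ + D * W i 0) :
    Summable (fun i => P.prob i * rowDiv W (channelOut W P.prob) i) ∧
    ∑' i, P.prob i * rowDiv W (channelOut W P.prob) i ≤
      κ * P.mean + D * ∑' i, P.prob i * W i 0 := by
  set Q := channelOut W P.prob with hQ
  have hP := P.nonneg
  have hQ0 : ∀ j, 0 ≤ Q j := hW.channelOut_nonneg hP
  have hQs : HasSum Q 1 := hW.hasSum_channelOut hP P.hasSum_one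
  have hPQ : ∀ i j, P.prob i * W i j ≤ Q j := hW.mul_le_channelOut hP P.hasSum_one
  have hF0 : ∀ j i, 0 ≤ P.prob i * W i j * (q j / Q j) := fun j i =>
    mul_nonneg (mul_nonneg (hP i) (hW.nonneg i j)) (div_nonneg (hq j) (hQ0 j))
  have hF1 : ∀ j, HasSum (fun i => P.prob i * W i j * (q j / Q j)) (Q j * (q j / Q j)) := fun j =>
    (hW.summable_mul hP P.hasSum_one j).hasSum.mul_right _
  -- Equality holds unless `Q j = 0`, where division by zero makes the left side `0`.
  have hle : ∀ j, Q j * (q j / Q j) ≤ q j := by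
    intro j
    rcases (hQ0 j).eq_or_lt with h | h
    · rw [← h]; simpa using hq j
    · rw [mul_div_cancel₀ _ h.ne']
  have hFs : Summable fun j => Q j * (q j / Q j) :=
    Summable.of_nonneg_of_le (fun j => mul_nonneg (hQ0 j) (div_nonneg (hq j) (hQ0 j))) hle hqs
  obtain ⟨hF2, hF3⟩ := hasSum_swap_of_nonneg hF0 hF1 hFs.hasSum
  have hF4 : ∑' j, Q j * (q j / Q j) ≤ 1 := (hFs.tsum_le_tsum hle hqs).trans hq1
  -- By `log (q / Q) ≤ q / Q - 1`, replacing `Q` by `q` changes row `i` in the favourable direction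
  -- up to `h i - P_i`, and these corrections sum to at most `0`. Arguing row by row proves the
  -- inequality behind the duality without first knowing that the sum of `P_i` times the relative
  -- entropy to `q` converges.
  set h : ℕ → ℝ := fun i => ∑' j, P.prob i * W i j * (q j / Q j) with hh
  have hpos : ∀ i, 0 ≤ P.prob i * rowDiv W Q i := by
    intro i
    rcases (hP i).eq_or_lt with h0 | h0
    · simp [← h0]
    · refine mul_nonneg (hP i) ?_
      have hAA : ∀ j, W i j ≤ 1 / P.prob i * Q j := by
        intro j
        rw [one_div, inv_mul_eq_div, le_div_iff₀ h0]
        linarith [hPQ i j]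
      have hs := summable_mul_log_div (hW.nonneg i) hQ0 hAA (by positivity) (hW.hasSum i).summable
        hQs.summable
      have := hasSum_le (fun j => mul_log_div_ge (hW.nonneg i j) (hQ0 j) fun h =>
        (mul_pos h0 h).trans_le (hPQ i j)) ((hW.hasSum i).sub hQs) hs.hasSum
      rw [sub_self] at this
      exact this
  have hup : ∀ i, P.prob i * rowDiv W Q i ≤
      κ * (i * P.prob i) + D * (P.prob i * W i 0) - P.prob i + h i := by
    intro i
    rcases (hP i).eq_or_lt with h0 | h0
    · simp [← h0, hh]
    have hi : 1 ≤ i := by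
      rcases Nat.eq_zero_or_pos i with rfl | hi
      · simp [P.prob_zero] at h0
      · exact hi
    have hAA : ∀ j, W i j ≤ 1 / P.prob i * Q j := by
      intro j
      rw [one_div, inv_mul_eq_div, le_div_iff₀ h0]
      linarith [hPQ i j]
    have hs := (summable_mul_log_div (hW.nonneg i) hQ0 hAA (by positivity) (hW.hasSum i).summable
      hQs.summable).mul_left (P.prob i)
    have hs' := (summable_mul_log_div (hW.nonneg i) hq (hA i hi) (hA0 i hi)
      (hW.hasSum i).summable hqs).mul_left (P.prob i)
    have key : P.prob i * rowDiv W Q i ≤ P.prob i * rowDiv W q i - P.prob i * 1 + h i := by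
      unfold rowDiv
      rw [← tsum_mul_left, ← tsum_mul_left]
      refine hasSum_le (fun j => ?_) hs.hasSum
        ((hs'.hasSum.sub ((hW.hasSum i).mul_left (P.prob i))).add (hF2 i).hasSum)
      rcases (hW.nonneg i j).eq_or_lt with h1 | h1
      · simp [← h1]
      · have q0 : 0 < q j := pos_of_mul_pos_right (h1.trans_le (hA i hi j)) (hA0 i hi).le
        have Q0 : 0 < Q j := (mul_pos h0 h1).trans_le (hPQ i j)
        have l := Real.log_le_sub_one_of_pos (div_pos q0 Q0)
        rw [Real.log_div q0.ne' Q0.ne'] at l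
        have l2 := mul_le_mul_of_nonneg_left l (mul_pos h0 h1).le
        rw [Real.log_div h1.ne' q0.ne', Real.log_div h1.ne' Q0.ne']
        linarith
    have := mul_le_mul_of_nonneg_left (hdiv i hi) h0.le
    linarith
  have hD : Summable fun i => P.prob i * W i 0 := hW.summable_mul hP P.hasSum_one 0
  have hS : HasSum (fun i => κ * (i * P.prob i) + D * (P.prob i * W i 0) - P.prob i + h i)
      (κ * P.mean + D * ∑' i, P.prob i * W i 0 - 1 + ∑' j, Q j * (q j / Q j)) :=
    (((P.finite_mean.hasSum.mul_left κ).add (hD.hasSum.mul_left D)).sub P.hasSum_one).add hF3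
  have hsum := Summable.of_nonneg_of_le hpos hup hS.summable
  refine ⟨hsum, ?_⟩
  have := hasSum_le hup hsum.hasSum hS
  linarith

lemma transition_zero (G : ℕ → ℝ) (i : ℕ) : transition G i 0 = G 0 ^ i := by
  induction i with
  | zero => simp [transition]
  | succ i ih => simp [transition, ih, pow_succ']

lemma heuristicRate_mul_log_two (G : ℕ → ℝ) (Δ : ℝ) (P : RunLengthDist) :
    heuristicRate G Δ P * Real.log 2 = 1 / P.mean *
      (∑' i, P.prob i * rowDiv (transition G) (channelOut (transition G) P.prob) i -
        Δ * Real.log 2 * ∑' i, P.prob i * transition G i 0) := by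
  rw [← memorylessRate_mul_log_two, ← tsum_mul_left]
  unfold heuristicRate
  rw [mul_assoc, sub_mul, ← tsum_mul_right]
  congr 2
  refine tsum_congr fun i => ?_
  rw [transition_zero]
  ring

lemma heuristicRate_le_of_certificate {G : ℕ → ℝ} (hW : IsChannel (transition G))
    (P : RunLengthDist) {q A : ℕ → ℝ} {κ Δ : ℝ} (hq : ∀ j, 0 ≤ q j) (hqs : Summable q)
    (hq1 : ∑' j, q j ≤ 1) (hA0 : ∀ i, 1 ≤ i → 0 < A i)
    (hA : ∀ i, 1 ≤ i → ∀ j, transition G i j ≤ A i * q j)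
    (hdiv : ∀ i, 1 ≤ i → rowDiv (transition G) q i ≤
      i * κ + Δ * Real.log 2 * transition G i 0) :
    heuristicRate G Δ P * Real.log 2 ≤ κ := by
  have h := (tsum_mul_rowDiv_le hW P hq hqs hq1 hA0 hA hdiv).2
  have hm : 0 < P.mean := one_pos.trans_le P.one_le_mean
  rw [heuristicRate_mul_log_two, one_div, inv_mul_eq_div, div_le_iff₀ hm]
  linarith

/-! ## Transfer from the truncated channel -/

/-- The first `J + 1` columns of `W`, normalised. -/
def truncRow (J : ℕ) (W : ℕ → ℕ → ℝ) (i j : ℕ) : ℝ := W i j / ∑ k ∈ range (J + 1), W i k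

/-- The run-length distribution described by a probability vector. -/
def InSimplex.dist {N : ℕ} {b : ℝ} {y : ℕ → ℝ} (hb : 0 < b) (hN : 0 < N) (hy : InSimplex N b y) :
    RunLengthDist where
  prob r := if 1 ≤ r ∧ r ≤ N then runLaw N y r else 0
  nonneg r := by
    split_ifs with h
    · exact (hy.runLaw_pos hb hN (mem_Icc.2 h)).le
    · exact le_rfl
  prob_zero := by simp
  hasSum_one := by
    have : HasSum (fun r => if 1 ≤ r ∧ r ≤ N then runLaw N y r else 0)
        (∑ r ∈ Icc 1 N, if 1 ≤ r ∧ r ≤ N then runLaw N y r else 0) :=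
      hasSum_sum_of_ne_finset_zero fun r hr => by
        rw [mem_Icc] at hr
        simp [hr]
    rwa [sum_congr rfl fun r hr => if_pos (mem_Icc.1 hr), hy.sum_runLaw hb hN] at this
  finite_mean := summable_of_ne_finset_zero (s := Icc 1 N) fun r hr => by
    rw [mem_Icc] at hr
    simp [hr]

section Transfer

variable {N J : ℕ} {b : ℝ} {y : ℕ → ℝ} (hb : 0 < b) (hN : 0 < N) (hy : InSimplex N b y)
include hb hN hy

lemma InSimplex.tsum_dist_mul (f : ℕ → ℝ) :
    ∑' i, (hy.dist hb hN).prob i * f i = ∑ i ∈ Icc 1 N, runLaw N y i * f i := by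
  rw [tsum_eq_sum (s := Icc 1 N)]
  · refine sum_congr rfl fun i hi => ?_
    simp [InSimplex.dist, mem_Icc.1 hi]
  · intro i hi
    rw [mem_Icc] at hi
    simp [InSimplex.dist, hi]

lemma InSimplex.mean_dist : (hy.dist hb hN).mean = 1 / runDensity N y := by
  rw [← hy.sum_mul_runLaw, RunLengthDist.mean]
  exact (tsum_congr fun r => mul_comm _ _).trans
    ((hy.tsum_dist_mul hb hN fun i => (i : ℝ)).trans (sum_congr rfl fun _ _ => mul_comm _ _))

variable {W : ℕ → ℕ → ℝ} (hW : IsChannel W) {τ : ℝ}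
  (hτ : ∀ i ∈ Icc 1 N, 1 - τ ≤ ∑ j ∈ range (J + 1), W i j) (hτ1 : τ < 1)

omit hb hN hy in
include hW hτ hτ1 in
lemma isFiniteChannel_truncRow : IsFiniteChannel N J (truncRow J W) := by
  constructor
  · exact fun i j => div_nonneg (hW.nonneg i j) (sum_nonneg fun k _ => hW.nonneg i k)
  · intro i hi
    unfold truncRow
    rw [← sum_div]
    refine div_self (ne_of_gt ?_)
    linarith [hτ i hi]

omit hb hN hy in
include hτ hτ1 in
lemma mul_truncRow {i : ℕ} (hi : i ∈ Icc 1 N) (j : ℕ) :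
    (∑ k ∈ range (J + 1), W i k) * truncRow J W i j = W i j := by
  unfold truncRow
  refine mul_div_cancel₀ _ (ne_of_gt ?_)
  linarith [hτ i hi]

-- Columns beyond `J` contribute nonnegatively and can be dropped. In the others `W = w V` with row
-- mass `w ≥ 1 - τ`, and `Q ≤ outLaw`, so each row keeps at least `w (log w + rowEntropy)`, where `w
-- log w ≥ w - 1 ≥ -τ`.
include hW hτ hτ1 in
lemma InSimplex.sum_mul_rowEntropy_le :
    ∑ i ∈ Icc 1 N, runLaw N y i * rowEntropy N J (truncRow J W) y i - τ * (1 + N) ≤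
    ∑' i, (hy.dist hb hN).prob i * rowDiv W (channelOut W (hy.dist hb hN).prob) i := by
  set Q := channelOut W (hy.dist hb hN).prob
  set V := truncRow J W with hVdef
  have hV : IsFiniteChannel N J V := isFiniteChannel_truncRow hW hτ hτ1
  have hQe : ∀ j, Q j = ∑ i ∈ Icc 1 N, runLaw N y i * W i j := fun j =>
    hy.tsum_dist_mul hb hN fun i => W i j
  have hp := fun i hi => hy.runLaw_pos hb hN (i := i) hi
  have hQ0 : ∀ j, 0 ≤ Q j := hW.channelOut_nonneg (hy.dist hb hN).nonneg
  have hQs : HasSum Q 1 := hW.hasSum_channelOut (hy.dist hb hN).nonneg (hy.dist hb hN).hasSum_one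
  have hPQ : ∀ i ∈ Icc 1 N, ∀ j, runLaw N y i * W i j ≤ Q j := by
    intro i hi j
    rw [hQe]
    exact single_le_sum (f := fun i => runLaw N y i * W i j)
      (fun k hk => mul_nonneg (hp k hk).le (hW.nonneg k j)) hi
  have hs : ∀ i ∈ Icc 1 N, Summable fun j => runLaw N y i * (W i j * Real.log (W i j / Q j)) := by
    intro i hi
    refine (summable_mul_log_div (A := 1 / runLaw N y i) (hW.nonneg i) hQ0 (fun j => ?_)
      (one_div_pos.2 (hp i hi)) (hW.hasSum i).summable hQs.summable).mul_left _
    rw [one_div, inv_mul_eq_div, le_div_iff₀ (hp i hi)]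
    linarith [hPQ i hi j]
  rw [hy.tsum_dist_mul hb hN]
  have e1 : ∑ i ∈ Icc 1 N, runLaw N y i * rowDiv W Q i =
      ∑' j, ∑ i ∈ Icc 1 N, runLaw N y i * (W i j * Real.log (W i j / Q j)) := by
    rw [Summable.tsum_finsetSum hs]
    refine sum_congr rfl fun i _ => ?_
    rw [tsum_mul_left]; rfl
  have e2 : ∑ j ∈ range (J + 1), ∑ i ∈ Icc 1 N, runLaw N y i * (W i j * Real.log (W i j / Q j)) ≤
      ∑' j, ∑ i ∈ Icc 1 N, runLaw N y i * (W i j * Real.log (W i j / Q j)) := by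
    refine Summable.sum_le_tsum _ (fun j _ => ?_) (summable_sum hs)
    -- The left side vanishes by the definition of `Q`, so every column sum is nonnegative even
    -- though individual terms may be negative.
    have : ∑ i ∈ Icc 1 N, runLaw N y i * (W i j - Q j) ≤
        ∑ i ∈ Icc 1 N, runLaw N y i * (W i j * Real.log (W i j / Q j)) :=
      sum_le_sum fun i hi => mul_le_mul_of_nonneg_left (mul_log_div_ge (hW.nonneg i j) (hQ0 j)
        fun h => (mul_pos (hp i hi) h).trans_le (hPQ i hi j)) (hp i hi).le
    simp only [mul_sub, sum_sub_distrib, ← sum_mul, ← hQe, hy.sum_runLaw hb hN] at this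
    linarith
  have e3 : ∑ i ∈ Icc 1 N, runLaw N y i * (rowEntropy N J V y i - τ * (1 + rowEntropy N J V y i)) ≤
      ∑ j ∈ range (J + 1), ∑ i ∈ Icc 1 N, runLaw N y i * (W i j * Real.log (W i j / Q j)) := by
    rw [sum_comm]
    refine sum_le_sum fun i hi => ?_
    rw [← mul_sum]
    refine mul_le_mul_of_nonneg_left ?_ (hp i hi).le
    set w := ∑ k ∈ range (J + 1), W i k with hw
    have hw0 : 0 < w := by linarith [hτ i hi]
    have hw1 : w ≤ 1 := sum_le_hasSum _ (fun k _ => hW.nonneg i k) (hW.hasSum i)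
    have t : ∑ j ∈ range (J + 1), w * (V i j * Real.log w + V i j * Real.log (V i j / outLaw N V y j))
        ≤ ∑ j ∈ range (J + 1), W i j * Real.log (W i j / Q j) := by
      refine sum_le_sum fun j _ => ?_
      have hWV : w * V i j = W i j := mul_truncRow hτ hτ1 hi j
      rcases (hV.nonneg i j).eq_or_lt with h | h
      · rw [← hWV, ← h]; simp
      · have hq := hy.outLaw_pos hb hN hV hi h
        have hWp : 0 < W i j := hWV ▸ mul_pos hw0 h
        have hQp : 0 < Q j := (mul_pos (hp i hi) hWp).trans_le (hPQ i hi j)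
        have hQq : Q j ≤ outLaw N V y j := by
          rw [hQe]
          refine sum_le_sum fun k hk => mul_le_mul_of_nonneg_left ?_ (hp k hk).le
          rw [← mul_truncRow hτ hτ1 hk j]
          refine mul_le_of_le_one_left (hV.nonneg k j) ?_
          exact sum_le_hasSum _ (fun l _ => hW.nonneg k l) (hW.hasSum k)
        have hl := Real.log_le_log hQp hQq
        rw [← mul_add, ← mul_assoc, hWV]
        refine mul_le_mul_of_nonneg_left ?_ hWp.le
        rw [Real.log_div hWp.ne' hQp.ne', Real.log_div h.ne' hq.ne', ← hWV,
          Real.log_mul hw0.ne' h.ne']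
        linarith
    rw [← mul_sum, sum_add_distrib, ← sum_mul, hV.sum_eq i hi] at t
    refine le_trans ?_ t
    have hR := hy.rowEntropy_nonneg hb hN hV hi
    have hl := mul_le_mul_of_nonneg_left (Real.one_sub_inv_le_log_of_pos hw0) hw0.le
    rw [mul_sub, mul_inv_cancel₀ hw0.ne'] at hl
    have := hτ i hi
    change _ ≤ w * (1 * Real.log w + rowEntropy N J V y i)
    nlinarith
  rw [e1]
  refine le_trans ?_ (e3.trans e2)
  have hS := hy.sum_runLaw_mul_rowEntropy_le hb hN hV
  have e4 : ∑ i ∈ Icc 1 N, runLaw N y i * (rowEntropy N J V y i - τ * (1 + rowEntropy N J V y i)) =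
      (1 - τ) * ∑ i ∈ Icc 1 N, runLaw N y i * rowEntropy N J V y i -
        τ * ∑ i ∈ Icc 1 N, runLaw N y i := by
    rw [mul_sum, mul_sum, ← sum_sub_distrib]
    exact sum_congr rfl fun i _ => by ring
  rw [e4, hy.sum_runLaw hb hN]
  have hτ0 : 0 ≤ τ := by
    have h1 := hτ 1 (by simp; omega)
    have h2 : ∑ k ∈ range (J + 1), W 1 k ≤ 1 :=
      sum_le_hasSum _ (fun k _ => hW.nonneg 1 k) (hW.hasSum 1)
    linarith
  nlinarith

end Transfer

lemma InSimplex.value_sub_le_heuristicRate {G : ℕ → ℝ} {N J : ℕ} {b : ℝ} {y : ℕ → ℝ} (hb : 0 < b)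
    (hN : 0 < N) (hy : InSimplex N b y) (hW : IsChannel (transition G)) {τ : ℝ}
    (hτ : ∀ i ∈ Icc 1 N, 1 - τ ≤ ∑ j ∈ range (J + 1), transition G i j) (hτ1 : τ < 1)
    {Δ : ℝ} (hΔ : 0 ≤ Δ) :
    value N J (truncRow J (transition G)) (Δ * Real.log 2) y - τ * (1 + N) ≤
      heuristicRate G Δ (hy.dist hb hN) * Real.log 2 := by
  have hl : 0 ≤ Real.log 2 := Real.log_nonneg one_le_two
  have hs := hy.runDensity_pos hb hN
  have hs1 := hy.runDensity_le_one hb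
  have hV : IsFiniteChannel N J (truncRow J (transition G)) := isFiniteChannel_truncRow hW hτ hτ1
  rw [heuristicRate_mul_log_two, hy.mean_dist, one_div_one_div, hy.value_eq hb hN]
  have h1 := hy.sum_mul_rowEntropy_le hb hN hW hτ hτ1
  have h2 : Δ * Real.log 2 * ∑' i, (hy.dist hb hN).prob i * transition G i 0 ≤
      ∑ i ∈ Icc 1 N, runLaw N y i * (Δ * Real.log 2) * truncRow J (transition G) i 0 := by
    rw [hy.tsum_dist_mul hb hN fun i => transition G i 0, mul_sum]
    refine sum_le_sum fun i hi => ?_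
    have hp := (hy.runLaw_pos hb hN hi).le
    rw [mul_left_comm, ← mul_assoc]
    refine mul_le_mul_of_nonneg_left ?_ (by positivity)
    rw [← mul_truncRow hτ hτ1 hi]
    exact mul_le_of_le_one_left (hV.nonneg i 0)
      (sum_le_hasSum _ (fun l _ => hW.nonneg i l) (hW.hasSum i))
  have hτ0 : 0 ≤ τ := by
    have h1 := hτ 1 (by simp; omega)
    have h2 : ∑ k ∈ range (J + 1), transition G 1 k ≤ 1 :=
      sum_le_hasSum _ (fun k _ => hW.nonneg 1 k) (hW.hasSum 1)
    linarith
  have h3 : 0 ≤ τ * (1 + N) := by positivity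
  have h4 := mul_le_mul_of_nonneg_left (add_le_add h1 (neg_le_neg h2)) hs.le
  have h5 : runDensity N y * (τ * (1 + N)) ≤ τ * (1 + N) := mul_le_of_le_one_left h3 hs1
  linarith

/-! ### A dual output law that covers all run lengths -/

/-- A heavy-tailed law on the positive integers. -/
def heavyLaw (i : ℕ) : ℝ := 1 / (i * (i + 1))

lemma heavyLaw_nonneg (i : ℕ) : 0 ≤ heavyLaw i := by unfold heavyLaw; positivity

lemma hasSum_heavyLaw : HasSum heavyLaw 1 := by
  rw [← hasSum_nat_add_iff' 1]
  simp only [sum_range_one]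
  have h0 : heavyLaw 0 = 0 := by simp [heavyLaw]
  rw [h0, sub_zero, hasSum_iff_tendsto_nat_of_nonneg fun i => heavyLaw_nonneg _]
  have e : ∀ n : ℕ, ∑ i ∈ range n, heavyLaw (i + 1) = 1 - 1 / ((n : ℝ) + 1) := by
    intro n
    induction n with
    | zero => simp
    | succ n ih =>
      rw [sum_range_succ, ih]
      unfold heavyLaw
      push_cast
      field_simp
      ring
  simp only [e]
  simpa using tendsto_const_nhds.sub tendsto_one_div_add_atTop_nhds_zero_nat (a := (1 : ℝ))

/-- The output law used as a certificate: a mixture of a law on `{0, …, J}` and of the output law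
of heavy-tailed run lengths. -/
def mixedOut (J : ℕ) (W : ℕ → ℕ → ℝ) (β : ℝ) (q : ℕ → ℝ) (j : ℕ) : ℝ :=
  (1 - β) * (if j ≤ J then q j else 0) + β * channelOut W heavyLaw j

section Certificate

variable {N J : ℕ} {b : ℝ} {y : ℕ → ℝ} {W : ℕ → ℕ → ℝ} (hW : IsChannel W) {β : ℝ} (hβ : 0 < β)
  (hβ1 : β < 1)

include hW hβ hβ1

lemma mixedOut_nonneg {q : ℕ → ℝ} (hq : ∀ j, 0 ≤ q j) (j : ℕ) : 0 ≤ mixedOut J W β q j := by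
  have := hW.channelOut_nonneg heavyLaw_nonneg j
  unfold mixedOut
  have : 0 ≤ if j ≤ J then q j else 0 := by split_ifs <;> simp [hq]
  have : 0 ≤ 1 - β := by linarith
  positivity

omit hβ hβ1 in
lemma hasSum_mixedOut {q : ℕ → ℝ} (hq1 : ∑ j ∈ range (J + 1), q j = 1) :
    HasSum (mixedOut J W β q) 1 := by
  have h1 : HasSum (fun j => if j ≤ J then q j else 0)
      (∑ j ∈ range (J + 1), if j ≤ J then q j else 0) :=
    hasSum_sum_of_ne_finset_zero fun j hj => by
      rw [mem_range] at hj
      exact if_neg (by omega)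
  have h2 : (∑ j ∈ range (J + 1), if j ≤ J then q j else 0) = 1 := by
    rw [← hq1]
    exact sum_congr rfl fun j hj => if_pos (by rw [mem_range] at hj; omega)
  rw [h2] at h1
  have := (h1.mul_left (1 - β)).add
    ((hW.hasSum_channelOut heavyLaw_nonneg hasSum_heavyLaw).mul_left β)
  rw [show (1 - β) * 1 + β * 1 = 1 by ring] at this
  exact this

/-- The heavy-tailed component contains row `i` with weight `β / (i (i + 1))`. As this decays only
polynomially, the resulting relative entropies are logarithmic in `i`, while the certificate allows
linear growth. -/
lemma le_mul_mixedOut {q : ℕ → ℝ} (hq : ∀ j, 0 ≤ q j) {i : ℕ} (hi : 1 ≤ i) (j : ℕ) :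
    W i j ≤ i * (i + 1) / β * mixedOut J W β q j := by
  have hi0 : (0 : ℝ) < i := by exact_mod_cast hi
  have h1 := hW.mul_le_channelOut heavyLaw_nonneg hasSum_heavyLaw i j
  have h2 : β * channelOut W heavyLaw j ≤ mixedOut J W β q j := by
    unfold mixedOut
    have : 0 ≤ if j ≤ J then q j else 0 := by split_ifs <;> simp [hq]
    have : 0 ≤ 1 - β := by linarith
    nlinarith
  calc W i j = i * (i + 1) / β * (β * (heavyLaw i * W i j)) := by unfold heavyLaw; field_simp
    _ ≤ _ := by gcongr; exact (mul_le_mul_of_nonneg_left h1 hβ.le).trans h2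

lemma summable_mixedOut_term {q : ℕ → ℝ} (hq : ∀ j, 0 ≤ q j)
    (hq1 : ∑ j ∈ range (J + 1), q j = 1) {i : ℕ} (hi : 1 ≤ i) :
    Summable fun j => W i j * Real.log (W i j / mixedOut J W β q j) := by
  have hi0 : (0 : ℝ) < i := by exact_mod_cast hi
  exact summable_mul_log_div (hW.nonneg i) (mixedOut_nonneg hW hβ hβ1 hq)
    (le_mul_mixedOut hW hβ hβ1 hq hi) (by positivity) (hW.hasSum i).summable
    (hasSum_mixedOut hW hq1).summable

lemma rowDiv_mixedOut_le {q : ℕ → ℝ} (hq : ∀ j, 0 ≤ q j)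
    (hq1 : ∑ j ∈ range (J + 1), q j = 1) {i : ℕ} (hi : 1 ≤ i) :
    rowDiv W (mixedOut J W β q) i ≤ Real.log (i * (i + 1) / β) := by
  have hi0 : (0 : ℝ) < i := by exact_mod_cast hi
  have := hasSum_le (fun j => mul_log_div_le (hW.nonneg i j) (le_mul_mixedOut hW hβ hβ1 hq hi j)
    (by positivity)) (summable_mixedOut_term hW hβ hβ1 hq hq1 hi).hasSum
    ((hW.hasSum i).mul_right _)
  simpa [rowDiv] using this

/-- Up to column `J` the mixture is at least `(1 - β) q`; the mass beyond, at most `τ`, pays the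
universal logarithmic bound. -/
lemma InSimplex.rowDiv_mixedOut_le (hb : 0 < b) (hN : 0 < N) (hy : InSimplex N b y) {τ : ℝ}
    (hτ : ∀ i ∈ Icc 1 N, 1 - τ ≤ ∑ j ∈ range (J + 1), W i j) (hτ1 : τ < 1) {i : ℕ}
    (hi : i ∈ Icc 1 N) :
    rowDiv W (mixedOut J W β (outLaw N (truncRow J W) y)) i ≤
      rowEntropy N J (truncRow J W) y i + Real.log (1 / (1 - β)) +
        τ * Real.log (i * (i + 1) / β) := by
  have hV := isFiniteChannel_truncRow hW hτ hτ1
  set V := truncRow J W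
  set q := outLaw N V y with hqdef
  have hi1 := (mem_Icc.1 hi).1
  have hi0 : (0 : ℝ) < i := by exact_mod_cast hi1
  have hq : ∀ j, 0 ≤ q j := hy.outLaw_nonneg hb hN hV
  have hq1 : ∑ j ∈ range (J + 1), q j = 1 := hy.sum_outLaw hb hN hV
  have hs := summable_mixedOut_term hW hβ hβ1 hq hq1 hi1
  set w := ∑ k ∈ range (J + 1), W i k with hw
  have hw0 : 0 < w := by linarith [hτ i hi]
  have hw1 : w ≤ 1 := sum_le_hasSum _ (fun k _ => hW.nonneg i k) (hW.hasSum i)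
  have hβ0 : 0 < 1 - β := by linarith
  have hL : 0 ≤ Real.log (1 / (1 - β)) := Real.log_nonneg (by rw [le_div_iff₀ hβ0]; linarith)
  have hL2 : 0 ≤ Real.log (i * (i + 1) / β) := by
    refine Real.log_nonneg ?_
    rw [le_div_iff₀ hβ]
    have : (1 : ℝ) ≤ i := by exact_mod_cast hi1
    nlinarith
  have h1 : ∑ j ∈ range (J + 1), W i j * Real.log (W i j / mixedOut J W β q j) ≤
      w * (rowEntropy N J V y i + Real.log (1 / (1 - β))) := by
    have : ∑ j ∈ range (J + 1), W i j * Real.log (W i j / mixedOut J W β q j) ≤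
        ∑ j ∈ range (J + 1),
          w * (V i j * Real.log (V i j / q j) + V i j * Real.log (1 / (1 - β))) := by
      refine sum_le_sum fun j hj => ?_
      have hWV : w * V i j = W i j := mul_truncRow hτ hτ1 hi j
      rcases (hV.nonneg i j).eq_or_lt with h | h
      · rw [← hWV, ← h]; simp
      · have hqj := hy.outLaw_pos hb hN hV hi h
        have hWp : 0 < W i j := hWV ▸ mul_pos hw0 h
        have hm : (1 - β) * q j ≤ mixedOut J W β q j := by
          unfold mixedOut
          rw [if_pos (by rw [mem_range] at hj; omega)]
          have := hW.channelOut_nonneg heavyLaw_nonneg j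
          nlinarith
        have hm0 : 0 < (1 - β) * q j := mul_pos hβ0 hqj
        rw [← mul_add, ← mul_assoc, hWV]
        refine mul_le_mul_of_nonneg_left ?_ hWp.le
        rw [← Real.log_mul (by positivity) (by positivity)]
        refine Real.log_le_log (div_pos hWp (hm0.trans_le hm)) ?_
        calc W i j / mixedOut J W β q j ≤ V i j / ((1 - β) * q j) := by
              refine div_le_div₀ h.le ?_ hm0 hm
              rw [← hWV]
              exact mul_le_of_le_one_left h.le hw1
          _ = V i j / q j * (1 / (1 - β)) := by field_simp
    refine this.trans_eq ?_
    rw [← mul_sum, sum_add_distrib, ← sum_mul, hV.sum_eq i hi, one_mul]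
    rfl
  have h2 : ∑' j, W i (j + (J + 1)) * Real.log (W i (j + (J + 1)) / mixedOut J W β q (j + (J + 1)))
      ≤ (1 - w) * Real.log (i * (i + 1) / β) := by
    have t1 : HasSum (fun j => W i (j + (J + 1))) (1 - w) :=
      (hasSum_nat_add_iff' (J + 1)).2 (hW.hasSum i)
    exact hasSum_le (fun j => mul_log_div_le (hW.nonneg i _) (le_mul_mixedOut hW hβ hβ1 hq hi1 _)
      (by positivity)) ((summable_nat_add_iff (J + 1)).2 hs).hasSum (t1.mul_right _)
  have h3 : rowDiv W (mixedOut J W β q) i = _ := (hs.sum_add_tsum_nat_add (J + 1)).symm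
  rw [h3]
  have hR := hy.rowEntropy_nonneg hb hN hV hi
  have h4 : w * (rowEntropy N J V y i + Real.log (1 / (1 - β))) ≤
      rowEntropy N J V y i + Real.log (1 / (1 - β)) :=
    mul_le_of_le_one_left (by positivity) hw1
  have h5 : (1 - w) * Real.log (i * (i + 1) / β) ≤ τ * Real.log (i * (i + 1) / β) :=
    mul_le_mul_of_nonneg_right (by linarith [hτ i hi]) hL2
  linarith

end Certificate

/-! ### From a small gap to near-optimality -/

set_option maxHeartbeats 1000000 in
/-- If the score of every run length is at most the value up to a small error, then the run-length
law is nearly optimal. -/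
lemma InSimplex.heuristicRate_le_add {G : ℕ → ℝ} {N J M : ℕ} {b : ℝ} {y : ℕ → ℝ} (hb : 0 < b)
    (hN : 0 < N) (hy : InSimplex N b y) (hW : IsChannel (transition G)) {τ : ℝ} (hM : 100 ≤ M)
    (hNM : (M : ℝ) ^ 4 ≤ N) (hNM2 : (N : ℝ) ≤ 2 * M ^ 4)
    (hτM : τ ≤ 2 / M ^ 15)
    (hτ : ∀ i ∈ Icc 1 N, 1 - τ ≤ ∑ j ∈ range (J + 1), transition G i j)
    {Δ : ℝ} (hΔ : 0 ≤ Δ) (hΔM : Δ ≤ M)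
    (hscore : ∀ i ∈ Icc 1 N, score N J (truncRow J (transition G)) (Δ * Real.log 2) y i ≤
      value N J (truncRow J (transition G)) (Δ * Real.log 2) y + 2 / M ^ 2)
    (P : RunLengthDist) :
    heuristicRate G Δ P ≤ heuristicRate G Δ (hy.dist hb hN) + 1 / M := by
  have hM' : (100 : ℝ) ≤ M := by exact_mod_cast hM
  have hM0 : (0 : ℝ) < M := by linarith
  have hl2 : 0 < Real.log 2 := Real.log_pos one_lt_two
  have hlb : 0.69 < Real.log 2 := by linarith [Real.log_two_gt_d9]
  have hlu : Real.log 2 < 0.7 := by linarith [Real.log_two_lt_d9]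
  have hτ0 : 0 ≤ τ := by
    have h1 := hτ 1 (by simp; omega)
    have h2 : ∑ k ∈ range (J + 1), transition G 1 k ≤ 1 :=
      sum_le_hasSum _ (fun k _ => hW.nonneg 1 k) (hW.hasSum 1)
    linarith
  have p15 : (1 : ℝ) ≤ M ^ 15 := one_le_pow₀ (by linarith)
  have pw : ∀ m n : ℕ, m ≤ n → (M : ℝ) ^ m ≤ M ^ n := fun m n h =>
    pow_le_pow_right₀ (by linarith) h
  have hτ1 : τ < 1 := by
    refine hτM.trans_lt ?_
    rw [div_lt_one (by positivity)]
    have := pw 1 15 (by norm_num)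
    rw [pow_one] at this
    linarith
  set V := truncRow J (transition G) with hVdef
  have hV : IsFiniteChannel N J V := isFiniteChannel_truncRow hW hτ hτ1
  set v := value N J V (Δ * Real.log 2) y with hv
  -- `β` is both the mixing weight and the unit of error: the gap is `2 β`, and each truncation loss
  -- is at most `β`. Since `β ≤ 1 / (100 M)`, a few multiples of it fit into the target `log 2 / M`.
  set β : ℝ := 1 / M ^ 2 with hβ
  have hβ0 : 0 < β := by positivity
  have hMβ : β * M ^ 2 = 1 := by rw [hβ]; field_simp
  have hM2 : (100 : ℝ) * M ≤ M ^ 2 := by nlinarith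
  have hβM : β * 100 ≤ 1 / M := by
    rw [hβ, div_mul_eq_mul_div, one_mul, div_le_div_iff₀ (by positivity) hM0]; linarith
  have hM100 : 1 / (M : ℝ) ≤ 1 / 100 := one_div_le_one_div_of_le (by norm_num) hM'
  have hβ1 : β < 1 := by linarith
  have hnum : 2 / (M : ℝ) ^ 15 * (7 * M ^ 10) ≤ β := by
    rw [hβ, div_mul_eq_mul_div, div_le_div_iff₀ (by positivity) (by positivity)]
    calc 2 * (7 * (M : ℝ) ^ 10) * (M : ℝ) ^ 2 = 14 * (M : ℝ) ^ 12 := by ring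
      _ ≤ (M : ℝ) * (M : ℝ) ^ 14 := mul_le_mul (by linarith) (pw 12 14 (by norm_num)) (by positivity) hM0.le
      _ = 1 * (M : ℝ) ^ 15 := by ring
  have hτN : τ * (1 + N) ≤ β := by
    have : τ * (1 + N) ≤ 2 / M ^ 15 * (3 * M ^ 4) := by
      have := one_le_pow₀ (n := 4) (show (1 : ℝ) ≤ M by linarith)
      refine mul_le_mul hτM (by linarith) (by positivity) (by positivity)
    refine this.trans (le_trans ?_ hnum)
    have := pw 4 10 (by norm_num)
    gcongr
    norm_num
  have hlow : v - β ≤ heuristicRate G Δ (hy.dist hb hN) * Real.log 2 :=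
    (sub_le_sub_left hτN _).trans (hy.value_sub_le_heuristicRate hb hN hW hτ hτ1 hΔ)
  set q := outLaw N V y with hq
  have hq0 : ∀ j, 0 ≤ q j := hy.outLaw_nonneg hb hN hV
  have hq1 : ∑ j ∈ range (J + 1), q j = 1 := hy.sum_outLaw hb hN hV
  -- The dual bound is `κ = v - β + log 2 / M`, exactly `log 2 / M` above the guaranteed `v - β`.
  -- For `i ≤ N` the excess over `i v` and the penalty is at most `5 β i`, so `6 β ≤ log 2 / M` is
  -- what is needed.
  have hcert : heuristicRate G Δ P * Real.log 2 ≤ v - β + Real.log 2 / M := by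
    refine heuristicRate_le_of_certificate hW P (mixedOut_nonneg hW hβ0 hβ1 hq0)
      (hasSum_mixedOut hW hq1).summable (hasSum_mixedOut hW hq1).tsum_eq.le
      (A := fun i => i * (i + 1) / β) (fun i hi => ?_)
      (fun i hi => le_mul_mixedOut hW hβ0 hβ1 hq0 hi) (fun i hi => ?_)
    · have : (0 : ℝ) < i := by exact_mod_cast hi
      positivity
    have hi1 : (1 : ℝ) ≤ i := by exact_mod_cast hi
    have hlM : Real.log 2 / M = Real.log 2 * (1 / M) := by ring
    have hDl : Δ * Real.log 2 ≤ M := by nlinarith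
    rcases le_or_gt i N with hiN | hiN
    · have hmem : i ∈ Icc 1 N := mem_Icc.2 ⟨hi, hiN⟩
      have h1 := hy.rowDiv_mixedOut_le hW hβ0 hβ1 hb hN hτ hτ1 hmem
      have h2 := hscore i hmem
      have h3 : rowEntropy N J V y i = i * score N J V (Δ * Real.log 2) y i +
          Δ * Real.log 2 * V i 0 := by unfold score; field_simp; ring
      have h4 : Real.log (1 / (1 - β)) ≤ 2 * β := by
        have hβ' : 0 < 1 - β := by linarith
        refine (Real.log_le_sub_one_of_pos (one_div_pos.2 hβ')).trans ?_
        have : β ≤ 1 / 2 := by linarith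
        rw [div_sub_one hβ'.ne', div_le_iff₀ hβ']
        nlinarith
      have h5 : τ * Real.log (i * (i + 1) / β) + τ * M ≤ β := by
        have hiN' : (i : ℝ) ≤ 2 * M ^ 4 := (by exact_mod_cast hiN : (i : ℝ) ≤ N).trans hNM2
        have l1 : Real.log (i * (i + 1) / β) ≤ i * (i + 1) / β := Real.log_le_self (by positivity)
        have l2 : (i : ℝ) * (i + 1) / β ≤ 2 * M ^ 4 * (3 * M ^ 4) * M ^ 2 := by
          rw [hβ, div_div_eq_mul_div, div_one]
          have := one_le_pow₀ (n := 4) (show (1 : ℝ) ≤ M by linarith)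
          gcongr
          linarith
        have l3 := pw 1 10 (by norm_num)
        rw [pow_one] at l3
        have l4 : τ * (Real.log (i * (i + 1) / β) + M) ≤ 2 / M ^ 15 * (7 * M ^ 10) := by
          have : Real.log (i * (i + 1) / β) + M ≤ 7 * M ^ 10 := by
            calc _ ≤ 2 * (M : ℝ) ^ 4 * (3 * M ^ 4) * M ^ 2 + M ^ 10 :=
                  add_le_add (l1.trans l2) l3
              _ = 7 * M ^ 10 := by ring
          refine (mul_le_mul_of_nonneg_left this hτ0).trans ?_
          gcongr
        linarith [l4.trans hnum]
      have h6 : Δ * Real.log 2 * V i 0 ≤ Δ * Real.log 2 * transition G i 0 + τ * M := by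
        rw [← mul_truncRow hτ hτ1 hmem 0]
        have a1 := hτ i hmem
        have a2 := hV.nonneg i 0
        have a3 := hV.le_one hmem (Nat.zero_le J)
        have a4 : 0 ≤ Δ * Real.log 2 := by positivity
        have a5 : (1 - ∑ j ∈ range (J + 1), transition G i j) * V i 0 ≤ τ := by
          calc _ ≤ τ * V i 0 := mul_le_mul_of_nonneg_right (by linarith) a2
            _ ≤ τ := mul_le_of_le_one_right hτ0 a3
        have a6 := mul_le_mul_of_nonneg_left a5 a4
        have a7 := mul_le_mul_of_nonneg_right hDl hτ0
        linarith
      have h7 : (i : ℝ) * score N J V (Δ * Real.log 2) y i ≤ i * (v + 2 * β) := by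
        refine mul_le_mul_of_nonneg_left (h2.trans_eq ?_) (by linarith)
        rw [hβ]; ring
      have h8 : (3 : ℝ) * β ≤ i * (3 * β) := le_mul_of_one_le_left (by positivity) hi1
      have h9 : (i : ℝ) * (v + 2 * β) + i * (3 * β) ≤ i * (v - β + Real.log 2 / M) := by
        rw [← mul_add]
        refine mul_le_mul_of_nonneg_left ?_ (by linarith)
        rw [hlM]
        nlinarith
      linarith
    -- Beyond `N` the iterate gives no information; only the logarithmic bound is used, against `κ ≥
    -- 1 / (2 M)`.
    · have h1 := _root_.rowDiv_mixedOut_le hW hβ0 hβ1 hq0 hq1 hi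
      have hNi : (N : ℝ) ≤ i := by exact_mod_cast hiN.le
      have hMi : (M : ℝ) ^ 4 ≤ i := hNM.trans hNi
      have s1 : (M : ℝ) ^ 2 ≤ √i := Real.le_sqrt_of_sq_le (by rw [← pow_mul]; exact hMi)
      have s2 : √(i : ℝ) ^ 2 = i := Real.sq_sqrt (by linarith)
      have s0 : 0 < √(i : ℝ) := by positivity
      -- The argument is at most `i ^ 4 = √i ^ 8`. Since `√i ≥ M ^ 2`, the bound `8 √i` is at most
      -- `i / (2 M)`.
      have h2 : Real.log (i * (i + 1) / β) ≤ 8 * √i := by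
        have e : (i : ℝ) * (i + 1) / β ≤ √i ^ 8 := by
          rw [hβ, div_div_eq_mul_div, div_one]
          have : √(i : ℝ) ^ 8 = i * (i * i) * i := by
            calc √(i : ℝ) ^ 8 = (√(i : ℝ) ^ 2) ^ 4 := by ring
              _ = _ := by rw [s2]; ring
          rw [this]
          have e1 : (M : ℝ) ^ 2 ≤ i := (pw 2 4 (by norm_num)).trans hMi
          have e2 : (i : ℝ) + 1 ≤ i * i := by
            have : (100 : ℝ) ≤ i := by
              have := pw 1 4 (by norm_num)
              rw [pow_one] at this
              linarith
            nlinarith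
          gcongr
        refine (Real.log_le_log (by positivity) e).trans ?_
        rw [Real.log_pow]
        have := Real.log_le_self s0.le
        push_cast
        linarith
      -- The value cannot be very negative: the score of run length `N` is at least `-D / N ≥ -β`
      -- and at most `v + 2 β`.
      have h3 : -β ≤ v + 2 * β := by
        have hNmem : N ∈ Icc 1 N := by simp; omega
        have a1 := hy.neg_div_le_score hb hN hV (D := Δ * Real.log 2) (by positivity) hNmem
        have a2 := hscore N hNmem
        have a3 : Δ * Real.log 2 / N ≤ β := by
          have hN0 : (0 : ℝ) < N := by exact_mod_cast hN
          rw [div_le_iff₀ hN0]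
          have : β * M ^ 4 ≤ β * N := mul_le_mul_of_nonneg_left hNM hβ0.le
          have e : β * (M : ℝ) ^ 4 = M ^ 2 := by
            calc β * (M : ℝ) ^ 4 = β * M ^ 2 * M ^ 2 := by ring
              _ = _ := by rw [hMβ, one_mul]
          nlinarith
        have e : 2 / (M : ℝ) ^ 2 = 2 * β := by rw [hβ]; ring
        rw [e] at a2
        linarith
      have h4 : 8 * √(i : ℝ) ≤ i * (1 / (2 * M)) := by
        rw [mul_one_div, le_div_iff₀ (by positivity)]
        nlinarith
      have h5 : (i : ℝ) * (1 / (2 * M)) ≤ i * (v - β + Real.log 2 / M) := by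
        refine mul_le_mul_of_nonneg_left ?_ (by linarith)
        have : 1 / (2 * (M : ℝ)) = 1 / M / 2 := by field_simp
        rw [this, hlM]
        nlinarith
      have h6 : 0 ≤ Δ * Real.log 2 * transition G i 0 :=
        mul_nonneg (by positivity) (hW.nonneg i 0)
      linarith
  have : heuristicRate G Δ P * Real.log 2 ≤
      (heuristicRate G Δ (hy.dist hb hN) + 1 / M) * Real.log 2 := by
    rw [add_mul]
    have : 1 / (M : ℝ) * Real.log 2 = Real.log 2 / M := by ring
    linarith
  exact le_of_mul_le_mul_right this hl2

/-! ## Repetition channels -/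

lemma hasSum_convolution {f g : ℕ → ℝ} {a b : ℝ} (hf0 : ∀ k, 0 ≤ f k) (hg0 : ∀ k, 0 ≤ g k)
    (hf : HasSum f a) (hg : HasSum g b) :
    HasSum (fun n => ∑ k ∈ range (n + 1), f k * g (n - k)) (a * b) := by
  have hf' : Summable fun k => ‖f k‖ := by simpa [abs_of_nonneg (hf0 _)] using hf.summable
  have hg' : Summable fun k => ‖g k‖ := by simpa [abs_of_nonneg (hg0 _)] using hg.summable
  have h1 := (summable_norm_sum_mul_range_of_summable_norm hf' hg').of_norm
  rw [← hf.tsum_eq, ← hg.tsum_eq, tsum_mul_tsum_eq_tsum_sum_range_of_summable_norm hf' hg']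
  exact h1.hasSum

section

variable {G : ℕ → ℝ} (hG0 : ∀ k, 0 ≤ G k)
include hG0

lemma transition_nonneg (i j : ℕ) : 0 ≤ transition G i j := by
  induction i generalizing j with
  | zero => unfold transition; split_ifs <;> norm_num
  | succ i ih => exact sum_nonneg fun k _ => mul_nonneg (hG0 k) (ih _)

lemma isChannel_transition (hG : HasSum G 1) : IsChannel (transition G) := by
  refine ⟨transition_nonneg hG0, fun i => ?_⟩
  induction i with
  | zero => exact hasSum_ite_eq 0 1
  | succ i ih =>
    have := hasSum_convolution hG0 (transition_nonneg hG0 i) hG ih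
    rw [mul_one] at this
    exact this

lemma hasSum_mul_transition (hG : HasSum G 1) {m : ℝ} (hm : HasSum (fun k : ℕ => k * G k) m)
    (i : ℕ) : HasSum (fun j : ℕ => j * transition G i j) (i * m) := by
  induction i with
  | zero =>
    have : (fun j : ℕ => (j : ℝ) * transition G 0 j) = fun _ => 0 := by
      funext j
      rcases Nat.eq_zero_or_pos j with rfl | h
      · simp
      · simp [transition, h.ne']
    rw [this]; simp
  | succ i ih =>
    have hW := isChannel_transition hG0 hG
    have h1 := hasSum_convolution (fun k => mul_nonneg (Nat.cast_nonneg k) (hG0 k))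
      (hW.nonneg i) hm (hW.hasSum i)
    have h2 := hasSum_convolution hG0
      (fun k => mul_nonneg (Nat.cast_nonneg k) (hW.nonneg i k)) hG ih
    have h3 := h1.add h2
    have e : m * 1 + 1 * (i * m) = ((i + 1 : ℕ) : ℝ) * m := by push_cast; ring
    rw [e] at h3
    refine h3.congr_fun fun j => ?_
    simp only [transition]
    rw [mul_sum, ← sum_add_distrib]
    refine sum_congr rfl fun k hk => ?_
    rw [Nat.cast_sub (by rw [mem_range] at hk; omega)]
    ring

/-- Markov's inequality: `i` bits yield `i m` copies on average. -/
lemma one_sub_le_sum_transition (hG : HasSum G 1) {m : ℝ}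
    (hm : HasSum (fun k : ℕ => k * G k) m) (i J : ℕ) :
    1 - i * m / (J + 1) ≤ ∑ j ∈ range (J + 1), transition G i j := by
  have hW := isChannel_transition hG0 hG
  have h1 : HasSum (fun j => if j ∈ range (J + 1) then transition G i j else 0)
      (∑ j ∈ range (J + 1), if j ∈ range (J + 1) then transition G i j else 0) :=
    hasSum_sum_of_ne_finset_zero fun j hj => if_neg hj
  rw [sum_congr rfl fun j hj => if_pos hj] at h1
  have h2 := h1.add ((hasSum_mul_transition hG0 hG hm i).div_const ((J : ℝ) + 1))
  have := hasSum_le (fun j => ?_) (hW.hasSum i) h2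
  · linarith
  · have h0 := hW.nonneg i j
    split_ifs with hj
    · have : 0 ≤ (j : ℝ) * transition G i j / (J + 1) := by positivity
      linarith
    · rw [mem_range, not_lt] at hj
      have : (J : ℝ) + 1 ≤ j := by exact_mod_cast hj
      rw [zero_add, le_div_iff₀ (by positivity)]
      nlinarith

end

lemma transition_const_mul (c : ℝ) (g : ℕ → ℝ) (i j : ℕ) :
    transition (fun k => c * g k) i j = c ^ i * transition g i j := by
  induction i generalizing j with
  | zero => simp [transition]
  | succ i ih =>
    simp only [transition, ih, mul_sum]
    exact sum_congr rfl fun k _ => by ring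

/-- The factor `c ^ i` of row `i` cancels on normalisation. Hence the Poisson weights can be used
without `exp (-lam)`, which field operations cannot produce. -/
lemma truncRow_transition_const_mul {c : ℝ} (hc : c ≠ 0) (g : ℕ → ℝ) (J i j : ℕ) :
    truncRow J (transition fun k => c * g k) i j = truncRow J (transition g) i j := by
  unfold truncRow
  simp only [transition_const_mul, ← mul_sum]
  exact mul_div_mul_left _ _ (pow_ne_zero i hc)

lemma bdc_nonneg {d : ℝ} (h0 : 0 ≤ d) (h1 : d < 1) (k : ℕ) : 0 ≤ bdc d k := by
  rcases k with _ | _ | k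
  · exact h0
  · exact sub_nonneg.2 h1.le
  · exact le_rfl

lemma hasSum_bdc_mul (d : ℝ) (f : ℕ → ℝ) :
    HasSum (fun k => f k * bdc d k) (f 0 * d + f 1 * (1 - d)) := by
  have : HasSum (fun k => f k * bdc d k) (∑ k ∈ range 2, f k * bdc d k) :=
    hasSum_sum_of_ne_finset_zero fun k hk => by
      rcases k with _ | _ | k
      · simp at hk
      · simp at hk
      · simp [bdc]
  simpa [sum_range_succ, bdc] using this

lemma hasSum_bdc (d : ℝ) : HasSum (bdc d) 1 := by
  simpa using hasSum_bdc_mul d fun _ => 1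

lemma hasSum_mul_bdc (d : ℝ) : HasSum (fun k : ℕ => k * bdc d k) (1 - d) := by
  simpa using hasSum_bdc_mul d fun k => (k : ℝ)

lemma prc_nonneg {lam : ℝ} (h : 0 < lam) (k : ℕ) : 0 ≤ prc lam k := by
  unfold prc; positivity

lemma prc_eq (lam : ℝ) : prc lam = fun k => Real.exp (-lam) * (lam ^ k / (k.factorial : ℝ)) := by
  funext k
  unfold prc
  ring

lemma hasSum_pow_div_factorial (lam : ℝ) :
    HasSum (fun k : ℕ => lam ^ k / (k.factorial : ℝ)) (Real.exp lam) := by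
  rw [Real.exp_eq_exp_ℝ]
  exact NormedSpace.expSeries_div_hasSum_exp lam

lemma hasSum_prc (lam : ℝ) : HasSum (prc lam) 1 := by
  rw [prc_eq]
  simpa [← Real.exp_add] using (hasSum_pow_div_factorial lam).mul_left (Real.exp (-lam))

lemma hasSum_mul_prc (lam : ℝ) : HasSum (fun k : ℕ => k * prc lam k) lam := by
  rw [← hasSum_nat_add_iff' 1]
  simp only [sum_range_one, Nat.cast_zero, zero_mul, sub_zero]
  have := (hasSum_prc lam).mul_left lam
  rw [mul_one] at this
  refine this.congr_fun fun k => ?_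
  unfold prc
  rw [Nat.factorial_succ]
  push_cast
  field_simp
  ring

/-! ## Reasoning about programs -/

namespace RealRAM

@[simp] lemma setInt_int (s : Memory) (x n y : ℕ) :
    (s.setInt x n).int y = if y = x then n else s.int y := by
  simp [Memory.setInt, Function.update_apply]

@[simp] lemma setInt_real (s : Memory) (x n : ℕ) : (s.setInt x n).real = s.real := rfl

@[simp] lemma set_int (s : Memory) (a x : ℕ) (v : ℝ) : (s.set a x v).int = s.int := rfl

@[simp] lemma set_real (s : Memory) (a x : ℕ) (v : ℝ) (c i : ℕ) :
    (s.set a x v).real c i = if c = a ∧ i = s.int x then v else s.real c i := by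
  by_cases h : c = a
  · subst h; simp [Memory.set, Function.update_apply]
  · simp [Memory.set, h]

/-- From the memory `s`, the program halts within time `T` on a memory that satisfies `Q`. -/
def WP (p : Program) (T : ℕ) (Q : Memory → Prop) (s : Memory) : Prop :=
  ∃ n s', Runs p s n s' ∧ n ≤ T ∧ Q s'

lemma WP.mono {p : Program} {T T' : ℕ} {Q Q' : Memory → Prop} {s : Memory} (h : WP p T Q s)
    (hT : T ≤ T') (hQ : ∀ s', Q s' → Q' s') : WP p T' Q' s := by
  obtain ⟨n, s', h1, h2, h3⟩ := h
  exact ⟨n, s', h1, h2.trans hT, hQ s' h3⟩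

lemma WP.le {p : Program} {T T' : ℕ} {Q : Memory → Prop} {s : Memory} (h : WP p T Q s)
    (hT : T ≤ T') : WP p T' Q s :=
  h.mono hT fun _ h => h

lemma WP.seq {p q : Program} {T₁ T₂ : ℕ} {R Q : Memory → Prop} {s : Memory} (h : WP p T₁ R s)
    (hq : ∀ s', R s' → WP q T₂ Q s') : WP (.seq p q) (T₁ + T₂) Q s := by
  obtain ⟨n, s', h1, h2, h3⟩ := h
  obtain ⟨n', s'', h4, h5, h6⟩ := hq s' h3
  exact ⟨n + n', s'', .seq h1 h4, by omega, h6⟩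

/-- Sequential composition of a list of programs. -/
def block : List Program → Program
  | [] => .const 63 0
  | [p] => p
  | p :: q :: l => .seq p (block (q :: l))

/-- Whether a program is free of loops. -/
def loopFree : Program → Bool
  | .seq p q => loopFree p && loopFree q
  | .branch _ p q => loopFree p && loopFree q
  | .loop _ _ => false
  | _ => true

/-- A bound on the running time of a program without loops. -/
def cost : Program → ℕ
  | .seq p q => cost p + cost q
  | .branch _ p q => max (cost p) (cost q) + 1
  | _ => 1

open Classical in
/-- The effect of a program without loops. -/
def exec : Program → Memory → Memory
  | .const x n, s => s.setInt x n
  | .intAdd x y z, s => s.setInt x (s.int y + s.int z)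
  | .intSub x y z, s => s.setInt x (s.int y - s.int z)
  | .ofInt a x y, s => s.set a x (s.int y : ℝ)
  | .op o a x b y c z, s => s.set a x (o.eval (s.real b (s.int y)) (s.real c (s.int z)))
  | .seq p q, s => exec q (exec p s)
  | .branch t p q, s => if t.Holds s then exec p s else exec q s
  | .loop _ _, s => s

/-- Reduces code without loops to a function on memories that `simp` can evaluate; `loopFree`,
`cost` and `writesOnly` of concrete code are checked by computation. -/
lemma wp_exec_of_loopFree (p : Program) (hp : loopFree p = true) (s : Memory) :
    WP p (cost p) (fun s' => s' = exec p s) s := by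
  induction p generalizing s with
  | const x n => exact ⟨1, _, .const x n s, le_rfl, rfl⟩
  | intAdd x y z => exact ⟨1, _, .intAdd x y z s, le_rfl, rfl⟩
  | intSub x y z => exact ⟨1, _, .intSub x y z s, le_rfl, rfl⟩
  | ofInt a x y => exact ⟨1, _, .ofInt a x y s, le_rfl, rfl⟩
  | op o a x b y c z => exact ⟨1, _, .op o a x b y c z s, le_rfl, rfl⟩
  | seq p q ihp ihq =>
    simp only [loopFree, Bool.and_eq_true] at hp
    refine (ihp hp.1 s).seq fun s' hs' => ?_
    subst hs'
    exact ihq hp.2 _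
  | branch t p q ihp ihq =>
    simp only [loopFree, Bool.and_eq_true] at hp
    by_cases ht : t.Holds s
    · obtain ⟨n, s', h1, h2, h3⟩ := ihp hp.1 s
      refine ⟨n + 1, s', .branch_true ht h1, ?_, by simp [exec, ht, h3]⟩
      simp only [cost]
      omega
    · obtain ⟨n, s', h1, h2, h3⟩ := ihq hp.2 s
      refine ⟨n + 1, s', .branch_false ht h1, ?_, by simp [exec, ht, h3]⟩
      simp only [cost]
      omega
  | loop t p => simp [loopFree] at hp

lemma wp_exec {p : Program} {T : ℕ} {Q : Memory → Prop} {s : Memory} (hp : loopFree p = true)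
    (hT : cost p ≤ T) (hQ : Q (exec p s)) : WP p T Q s :=
  (wp_exec_of_loopFree p hp s).mono hT fun _ h => h ▸ hQ

lemma wp_exec_seq {p q : Program} {T₁ T₂ : ℕ} {Q : Memory → Prop} {s : Memory}
    (hp : loopFree p = true) (hT : cost p ≤ T₁) (hQ : WP q T₂ Q (exec p s)) :
    WP (.seq p q) (T₁ + T₂) Q s :=
  ((wp_exec_of_loopFree p hp s).mono hT fun _ h => h).seq fun _ h => h ▸ hQ

/-- The invariant carries the round number; that the guard forces `k < B` is the termination
argument. -/
lemma wp_loop {t : Test} {p : Program} (Inv : ℕ → Memory → Prop) (B C : ℕ)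
    (h : ∀ k s, Inv k s → t.Holds s → k < B ∧ WP p C (Inv (k + 1)) s) {s : Memory}
    (h0 : Inv 0 s) :
    WP (.loop t p) (B * (C + 1) + 1) (fun s' => ∃ k, Inv k s' ∧ ¬ t.Holds s') s := by
  have key : ∀ m k s, k + m = B → Inv k s →
      WP (.loop t p) (m * (C + 1) + 1) (fun s' => ∃ k, Inv k s' ∧ ¬ t.Holds s') s := by
    intro m
    induction m with
    | zero =>
      intro k s hk hI
      have ht : ¬ t.Holds s := fun ht => by have := (h k s hI ht).1; omega
      exact ⟨1, s, .loop_false ht, by omega, k, hI, ht⟩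
    | succ m ih =>
      intro k s hk hI
      by_cases ht : t.Holds s
      · obtain ⟨n, s', h1, h2, h3⟩ := (h k s hI ht).2
        obtain ⟨n', s'', h4, h5, h6⟩ := ih (k + 1) s' (by omega) h3
        exact ⟨n + n' + 1, s'', .loop_true ht h1 h4, by rw [add_mul]; omega, h6⟩
      · exact ⟨1, s, .loop_false ht, by omega, k, hI, ht⟩
  exact key B 0 s (by omega) h0

/-- The memory `s'` differs from `s` at most in the integer variables `I` and the arrays `A`. -/
structure Frame (I A : List ℕ) (s s' : Memory) : Prop where
  int : ∀ x, x ∉ I → s'.int x = s.int x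
  real : ∀ a, a ∉ A → s'.real a = s.real a

lemma Frame.refl (I A : List ℕ) (s : Memory) : Frame I A s s := ⟨fun _ _ => rfl, fun _ _ => rfl⟩

lemma Frame.trans {I A : List ℕ} {s s' s'' : Memory} (h : Frame I A s s') (h' : Frame I A s' s'') :
    Frame I A s s'' :=
  ⟨fun x hx => (h'.int x hx).trans (h.int x hx), fun a ha => (h'.real a ha).trans (h.real a ha)⟩

lemma Frame.mono {I A I' A' : List ℕ} {s s' : Memory} (h : Frame I A s s')
    (hI : I ⊆ I') (hA : A ⊆ A') : Frame I' A' s s' :=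
  ⟨fun x hx => h.int x fun h' => hx (hI h'), fun a ha => h.real a fun h' => ha (hA h')⟩

lemma Frame.setInt {I A : List ℕ} {s s' : Memory} {x n : ℕ} (h : Frame I A s s') (hx : x ∈ I) :
    Frame I A s (s'.setInt x n) :=
  ⟨fun y hy => by rw [setInt_int, if_neg (by rintro rfl; exact hy hx), h.int y hy], h.real⟩

lemma Frame.set {I A : List ℕ} {s s' : Memory} {a x : ℕ} {v : ℝ} (h : Frame I A s s')
    (ha : a ∈ A) : Frame I A s (s'.set a x v) :=
  ⟨h.int, fun c hc => by
    funext i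
    rw [set_real, if_neg (by rintro ⟨rfl, -⟩; exact hc ha), h.real c hc]⟩

/-- Whether a program writes only to the integer variables `I` and the arrays `A`. -/
def writesOnly (I A : List ℕ) : Program → Bool
  | .const x _ => x ∈ I
  | .intAdd x _ _ => x ∈ I
  | .intSub x _ _ => x ∈ I
  | .ofInt a _ _ => a ∈ A
  | .op _ a _ _ _ _ _ => a ∈ A
  | .seq p q => writesOnly I A p && writesOnly I A q
  | .branch _ p q => writesOnly I A p && writesOnly I A q
  | .loop _ p => writesOnly I A p

lemma Frame.exec {I A : List ℕ} {s s' : Memory} (h : Frame I A s s') {p : Program}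
    (hp : writesOnly I A p = true) : Frame I A s (exec p s') := by
  induction p generalizing s' with
  | const x n => exact h.setInt (by simpa [writesOnly] using hp)
  | intAdd x y z => exact h.setInt (by simpa [writesOnly] using hp)
  | intSub x y z => exact h.setInt (by simpa [writesOnly] using hp)
  | ofInt a x y => exact h.set (by simpa [writesOnly] using hp)
  | op o a x b y c z => exact h.set (by simpa [writesOnly] using hp)
  | seq p q ihp ihq =>
    simp only [writesOnly, Bool.and_eq_true] at hp
    exact ihq (ihp h hp.1) hp.2
  | branch t p q ihp ihq =>
    simp only [writesOnly, Bool.and_eq_true] at hp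
    simp only [RealRAM.exec]
    split_ifs
    · exact ihp h hp.1
    · exact ihq h hp.2
  | loop t p => exact h

/-- `for v from c to (the value of) b do body` -/
def forTo (v c b : ℕ) (body : Program) : Program :=
  .seq (.const v c) (.loop (.intLe v b) (.seq body (.seq (.const 63 1) (.intAdd v v 63))))

/-- `D k` describes the memory on entry to round `k`. The frame refers to `s₁`, the memory before
any initialisation, rather than to the start `s₀` of the loop, so invariants can mention the
original contents. Variable `63` is scratch space for the increment. -/
lemma wp_forTo {v c b C n : ℕ} {body : Program} {I A : List ℕ} {s₁ s₀ : Memory}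
    (D : ℕ → Memory → Prop) (hF₀ : Frame I A s₁ s₀) (hv : v ∈ I) (h63 : 63 ∈ I) (hb : b ∉ I)
    (hv63 : v ≠ 63) (hn : s₁.int b = n) (hc : c ≤ n + 1) (h0 : D c (s₀.setInt v c))
    (step : ∀ k s, c ≤ k → k ≤ n → s.int v = k → Frame I A s₁ s → D k s →
      WP body C (fun s' => Frame I A s₁ s' ∧ s'.int v = k ∧
        D (k + 1) ((s'.setInt 63 1).setInt v (k + 1))) s) :
    WP (forTo v c b body) ((n + 1) * (C + 3) + 2) (fun s' => Frame I A s₁ s' ∧ D (n + 1) s') s₀ := by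
  have h1 := wp_loop (t := .intLe v b) (p := .seq body (.seq (.const 63 1) (.intAdd v v 63)))
    (fun k s => c + k ≤ n + 1 ∧ s.int v = c + k ∧ Frame I A s₁ s ∧ D (c + k) s) (n + 1) (C + 2)
    (fun k s hI ht => ?_) (s := s₀.setInt v c) ⟨hc, by simp, hF₀.setInt hv, h0⟩
  · refine WP.mono (wp_exec_seq (p := .const v c) (T₁ := 1) rfl le_rfl h1) ?_ ?_
    · ring_nf; rfl
    · rintro s' ⟨k, ⟨hk, hk', hF, hD⟩, ht⟩
      simp only [Test.Holds, hk', hF.int b hb, hn, not_le] at ht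
      have : c + k = n + 1 := by omega
      rw [this] at hD
      exact ⟨hF, hD⟩
  · obtain ⟨hk, hk', hF, hD⟩ := hI
    simp only [Test.Holds, hk', hF.int b hb, hn] at ht
    refine ⟨by omega, ?_⟩
    refine (step (c + k) s (by omega) ht hk' hF hD).seq fun s' ⟨hF', hv', hD'⟩ => ?_
    refine wp_exec rfl le_rfl ?_
    have e : exec (.seq (.const 63 1) (.intAdd v v 63)) s' =
        (s'.setInt 63 1).setInt v (c + k + 1) := by
      simp [exec, hv63, hv']
    rw [e]
    exact ⟨by omega, by simp; omega, (hF'.setInt h63).setInt hv, hD'⟩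

/-- The values of the variables and constants that all parts of the program share. -/
structure Ready (N J : ℕ) (s : Memory) : Prop where
  int_zero : s.int 0 = N
  int_one : s.int 1 = 0
  int_two : s.int 2 = J
  int_three : s.int 3 = J + 1
  zero : s.real 20 0 = 0
  one : s.real 21 0 = 1
  cast : s.real 26 0 = J

/-- `33[0] := logSum J (32[0])` -/
def logSumProg : Program :=
  .seq (.ofInt 33 1 1) (forTo 6 1 2 (block [.ofInt 34 1 6, .op .mul 34 1 34 1 32 1,
    .op .add 34 1 26 1 34 1, .op .div 34 1 32 1 34 1, .op .add 33 1 33 1 34 1]))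

/-- The output cutoff `J` doubles as the number of nodes of the Riemann sum. -/
lemma wp_logSumProg {N J : ℕ} {s : Memory} (hs : Ready N J s) :
    WP logSumProg (8 * (J + 1) + 3) (fun s' => Frame [6, 63] [33, 34] s s' ∧
      s'.real 33 0 = logSum J (s.real 32 0)) s := by
  obtain ⟨-, i1, i2, -, -, -, r26⟩ := hs
  refine WP.mono (wp_exec_seq (T₁ := 1) rfl le_rfl (wp_forTo (C := 5) (n := J) (s₁ := s)
    (I := [6, 63]) (A := [33, 34])
    (fun k s' => s'.real 33 0 = ∑ l ∈ Ico 1 k, s.real 32 0 / (J + l * s.real 32 0))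
    ((Frame.refl _ _ _).exec rfl) (by simp) (by simp) (by simp) (by simp) i2 (by omega) ?_ ?_))
    ?_ ?_
  · simp [exec, i1]
  · intro k s' hk hkn hv hF hD
    refine wp_exec rfl le_rfl ⟨hF.exec rfl, ?_, ?_⟩
    · simp [block, exec, hv]
    · simp [block, exec, hv, hF.int, hF.real, i1, r26, hD, Op.eval, sum_Ico_succ_top hk]
  · omega
  · rintro s' ⟨hF, hD⟩
    exact ⟨hF, hD⟩

lemma Ready.frame {N J : ℕ} {I A : List ℕ} {s s' : Memory} (hs : Ready N J s)
    (h : Frame I A s s') (hI : ∀ x ∈ [0, 1, 2, 3], x ∉ I) (hA : ∀ a ∈ [20, 21, 26], a ∉ A) :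
    Ready N J s' where
  int_zero := (h.int 0 (hI 0 (by simp))).trans hs.int_zero
  int_one := (h.int 1 (hI 1 (by simp))).trans hs.int_one
  int_two := (h.int 2 (hI 2 (by simp))).trans hs.int_two
  int_three := (h.int 3 (hI 3 (by simp))).trans hs.int_three
  zero := by rw [h.real 20 (hA 20 (by simp)), hs.zero]
  one := by rw [h.real 21 (hA 21 (by simp)), hs.one]
  cast := by rw [h.real 26 (hA 26 (by simp)), hs.cast]

/-! ### The transition probabilities -/

/-- `35[0] += ∑ k ≤ j, 3[k] * 4[p + (j - k)]`, where `j` is variable `5` and `p` is variable `7` -/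
def convProg : Program :=
  forTo 6 0 5 (block [.intSub 8 5 6, .intAdd 8 8 7, .op .mul 36 1 3 6 4 8, .op .add 35 1 35 1 36 1])

lemma wp_convProg {N J : ℕ} {s : Memory} (hs : Ready N J s) {j p : ℕ} (hj : s.int 5 = j)
    (hp : s.int 7 = p) :
    WP convProg (7 * (j + 1) + 2) (fun s' => Frame [6, 8, 63] [35, 36] s s' ∧
      s'.real 35 0 = s.real 35 0 + ∑ k ∈ range (j + 1), s.real 3 k * s.real 4 (p + (j - k))) s := by
  obtain ⟨-, i1, -, -, -, -, -⟩ := hs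
  refine WP.mono (wp_forTo (C := 4) (n := j) (s₁ := s) (I := [6, 8, 63]) (A := [35, 36])
    (fun k s' => s'.real 35 0 = s.real 35 0 + ∑ l ∈ range k, s.real 3 l * s.real 4 (p + (j - l)))
    (Frame.refl _ _ _) (by simp) (by simp) (by simp) (by simp) hj (by omega) (by simp)
    fun k s' hk hkn hv hF hD => wp_exec rfl le_rfl ⟨hF.exec rfl, ?_, ?_⟩) (by omega) fun s' h => h
  · simp [block, exec, hv]
  · simp [block, exec, hv, hF.int, hF.real, i1, hj, hp, hD, Op.eval, sum_range_succ, add_assoc,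
      add_comm p]

/-- The next row of the matrix in array `4`, after the row at position `p` (variable `7`). -/
def rowProg : Program :=
  forTo 5 0 2 (.seq (.ofInt 35 1 1) (.seq convProg
    (block [.intAdd 8 7 3, .intAdd 8 8 5, .op .add 4 8 35 1 20 1])))

lemma wp_rowProg {N J : ℕ} {s : Memory} (hs : Ready N J s) {p : ℕ} (hp : s.int 7 = p) :
    WP rowProg ((J + 1) * (7 * (J + 1) + 9) + 2) (fun s' => Frame [5, 6, 8, 63] [4, 35, 36] s s' ∧
      (∀ x < p + (J + 1), s'.real 4 x = s.real 4 x) ∧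
      ∀ j < J + 1, s'.real 4 (p + (J + 1) + j) =
        ∑ k ∈ range (j + 1), s.real 3 k * s.real 4 (p + (j - k))) s := by
  refine WP.mono (wp_forTo (C := 7 * (J + 1) + 6) (n := J) (s₁ := s) (I := [5, 6, 8, 63])
    (A := [4, 35, 36])
    (fun m s' => (∀ x < p + (J + 1), s'.real 4 x = s.real 4 x) ∧
      ∀ j < m, s'.real 4 (p + (J + 1) + j) =
        ∑ k ∈ range (j + 1), s.real 3 k * s.real 4 (p + (j - k)))
    (Frame.refl _ _ _) (by simp) (by simp) (by simp) (by simp) hs.int_two (by omega) (by simp)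
    fun k s' hk hkn hv hF hD => ?_) (by rw [add_assoc]) fun s' h => h
  have hR := hs.frame hF (by decide) (by decide)
  have i1 := hR.int_one
  have hF1 : Frame [5, 6, 8, 63] [4, 35, 36] s (exec (.ofInt 35 1 1) s') := hF.exec rfl
  have hR1 := hs.frame hF1 (by decide) (by decide)
  refine WP.mono (wp_exec_seq (T₁ := 1) rfl le_rfl ((wp_convProg hR1 (j := k) (p := p)
    (by simp [exec, hv]) (by simp [exec, hF.int, hp])).seq (T₂ := 3) fun s₂ ⟨hF2, hD2⟩ => ?_))
    (Nat.le_of_lt_succ (by nlinarith)) fun s' h => h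
  have hF3 := hF1.trans (hF2.mono (by decide) (by decide))
  have hR2 := hs.frame hF3 (by decide) (by decide)
  have i5 : s₂.int 5 = k := by rw [hF2.int 5 (by decide)]; simp [exec, hv]
  have i7 : s₂.int 7 = p := by rw [hF3.int 7 (by decide), hp]
  have r4 : ∀ x, s₂.real 4 x = s'.real 4 x := by
    intro x; rw [hF2.real 4 (by decide)]; simp [exec]
  have e : s₂.real 35 0 = ∑ l ∈ range (k + 1), s.real 3 l * s.real 4 (p + (k - l)) := by
    rw [hD2]
    simp only [exec, i1, set_real, Nat.cast_zero]
    simp only [and_self, if_true, zero_add, hF.real 3 (by decide)]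
    refine sum_congr rfl fun l hl => ?_
    rw [mem_range] at hl
    simp [hD.1 (p + (k - l)) (by omega)]
  refine wp_exec rfl le_rfl ⟨hF3.exec rfl, ?_, ?_, ?_⟩
  · simp [block, exec, i5]
  · intro x hx
    simp only [block, exec, setInt_real, set_real, setInt_int, i7, i5, hR2.int_three]
    rw [if_neg (by simp; omega), r4, hD.1 x hx]
  · intro j hj
    simp only [block, exec, setInt_real, set_real, setInt_int, i7, i5, hR2.int_three]
    rcases Nat.lt_succ_iff_lt_or_eq.1 hj with h | h
    · rw [if_neg (by simp; omega), r4, hD.2 j h]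
    · rw [if_pos (by simp [h])]
      simp [Op.eval, hR2.int_one, hR2.zero, e, h]

/-- The convolution powers of array `3`, as a matrix in array `4`. -/
def matrixProg : Program :=
  .seq (block [.const 7 0, .op .add 4 1 21 1 20 1]) (forTo 4 1 0 (.seq rowProg (.intAdd 7 7 3)))

lemma wp_matrixProg {N J : ℕ} {s : Memory} (hs : Ready N J s) (h4 : ∀ x, s.real 4 x = 0) :
    WP matrixProg ((N + 1) * ((J + 1) * (7 * (J + 1) + 9) + 6) + 4) (fun s' =>
      Frame [4, 5, 6, 7, 8, 63] [4, 35, 36] s s' ∧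
      ∀ i ∈ Icc 1 N, ∀ j < J + 1, s'.real 4 (i * (J + 1) + j) = transition (s.real 3) i j) s := by
  refine WP.mono (wp_exec_seq (T₁ := 2) rfl le_rfl (wp_forTo
    (C := (J + 1) * (7 * (J + 1) + 9) + 3) (n := N) (s₁ := s) (I := [4, 5, 6, 7, 8, 63])
    (A := [4, 35, 36])
    -- On entry to round `m`, variable `7` points at row `m - 1`. Row `0` is a unit vector because
    -- array `4` starts out as zero.
    (fun m s' => s'.int 7 = (m - 1) * (J + 1) ∧
      ∀ i < m, ∀ j < J + 1, s'.real 4 (i * (J + 1) + j) = transition (s.real 3) i j)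
    ((Frame.refl _ _ _).exec rfl) (by simp) (by simp) (by simp) (by simp) hs.int_zero (by omega)
    ⟨?_, ?_⟩ fun k s' hk hkn hv hF hD => ?_)) (by ring_nf; omega) fun s' h => ⟨h.1, fun i hi =>
      h.2.2 i (by rw [mem_Icc] at hi; omega)⟩
  · simp [block, exec]
  · intro i hi j hj
    obtain rfl : i = 0 := by omega
    simp [block, exec, hs.int_one, hs.one, hs.zero, h4, Op.eval, transition]
  · have hR := hs.frame hF (by decide) (by decide)
    refine WP.mono ((wp_rowProg hR hD.1).seq (T₂ := 1) fun s₂ ⟨hF2, hD2, hD3⟩ => ?_) (by omega)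
      fun s' h => h
    have hF3 := hF.trans (hF2.mono (by decide) (by decide))
    refine wp_exec rfl le_rfl ⟨hF3.exec rfl, ?_, ?_, ?_⟩
    · simp [exec, hF2.int, hv]
    · simp only [exec, setInt_int, hF2.int 7 (by decide), hD.1, hF3.int 3 (by decide),
        hs.int_three]
      obtain ⟨k, rfl⟩ : ∃ l, k = l + 1 := ⟨k - 1, by omega⟩
      simp [add_mul]
    · intro i hi j hj
      simp only [exec, setInt_real]
      obtain ⟨k, rfl⟩ : ∃ l, k = l + 1 := ⟨k - 1, by omega⟩
      rw [Nat.add_sub_cancel] at hD2 hD3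
      rcases Nat.lt_succ_iff_lt_or_eq.1 hi with h | h
      · have : i * (J + 1) ≤ k * (J + 1) := Nat.mul_le_mul_right _ (by omega)
        rw [hD2 _ (by omega), hD.2 i h j hj]
      · subst h
        rw [add_mul, one_mul, hD3 j hj, transition]
        refine sum_congr rfl fun l hl => ?_
        rw [hF.real 3 (by decide), hD.2 k (by omega) (j - l) (by omega)]

/-- The rows of the matrix in array `4`, normalised, as a matrix in array `9`. -/
def normProg : Program :=
  .seq (.const 7 0) (forTo 4 1 0 (.seq (block [.intAdd 7 7 3, .ofInt 35 1 1])
    (.seq (forTo 5 0 2 (block [.intAdd 8 7 5, .op .add 35 1 35 1 4 8]))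
      (forTo 5 0 2 (block [.intAdd 8 7 5, .op .div 9 8 4 8 35 1])))))

lemma wp_normProg {N J : ℕ} {s : Memory} (hs : Ready N J s) {U : ℕ → ℕ → ℝ}
    (hU : ∀ i ∈ Icc 1 N, ∀ j < J + 1, s.real 4 (i * (J + 1) + j) = U i j) :
    WP normProg ((N + 1) * (10 * (J + 1) + 9) + 3) (fun s' =>
      Frame [4, 5, 7, 8, 63] [9, 35] s s' ∧
      ∀ i ∈ Icc 1 N, ∀ j < J + 1, s'.real 9 (i * (J + 1) + j) = truncRow J U i j) s := by
  refine WP.mono (wp_exec_seq (T₁ := 1) rfl le_rfl (wp_forTo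
    (C := 10 * (J + 1) + 6) (n := N) (s₁ := s) (I := [4, 5, 7, 8, 63]) (A := [9, 35])
    (fun m s' => s'.int 7 = (m - 1) * (J + 1) ∧
      ∀ i ∈ Icc 1 (m - 1), ∀ j < J + 1, s'.real 9 (i * (J + 1) + j) = truncRow J U i j)
    ((Frame.refl _ _ _).exec rfl) (by simp) (by simp) (by simp) (by simp) hs.int_zero (by omega)
    ⟨?_, ?_⟩ fun k s' hk hkn hv hF hD => ?_)) (by ring_nf; omega) fun s' h => ⟨h.1, h.2.2⟩
  · simp [exec]
  · simp
  · have hR := hs.frame hF (by decide) (by decide)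
    have hkm : k ∈ Icc 1 N := mem_Icc.2 ⟨hk, hkn⟩
    have hp : (k - 1) * (J + 1) + (J + 1) = k * (J + 1) := by
      obtain ⟨k, rfl⟩ : ∃ l, k = l + 1 := ⟨k - 1, by omega⟩
      simp [add_mul]
    refine WP.mono (wp_exec_seq (T₁ := 2) rfl le_rfl ((wp_forTo (C := 2) (n := J) (s₁ := s')
      (I := [5, 7, 8, 63]) (A := [35])
      (fun m s₂ => s₂.int 7 = k * (J + 1) ∧ s₂.real 35 0 = ∑ j ∈ range m, U k j)
      ((Frame.refl _ _ _).exec rfl) (by simp) (by simp) (by simp) (by simp) hR.int_two (by omega)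
      ⟨?_, ?_⟩ fun j s₂ hj hjn hv₂ hF2 hD2 => wp_exec rfl le_rfl ⟨hF2.exec rfl, ?_, ?_, ?_⟩).seq
      fun s₂ ⟨hF2, hi2, hD2⟩ => wp_forTo (C := 2) (n := J) (s₁ := s)
        (I := [4, 5, 7, 8, 63]) (A := [9, 35])
        (fun m s₃ => (s₃.int 7 = k * (J + 1) ∧ s₃.int 4 = k ∧
          s₃.real 35 0 = ∑ j ∈ range (J + 1), U k j) ∧
          (∀ i ∈ Icc 1 (k - 1), ∀ j < J + 1, s₃.real 9 (i * (J + 1) + j) = truncRow J U i j) ∧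
          ∀ j < m, s₃.real 9 (k * (J + 1) + j) = truncRow J U k j)
        (hF.trans (hF2.mono (by decide) (by decide))) (by simp) (by simp) (by simp) (by simp)
        hs.int_two (by omega) ⟨⟨?_, ?_, ?_⟩, ?_, ?_⟩
        fun j s₃ hj hjn hv₃ hF3 hD3 => wp_exec rfl le_rfl
          ⟨hF3.exec rfl, ?_, ⟨?_, ?_, ?_⟩, ?_, ?_⟩)) (by ring_nf; omega) ?_
    · simp [block, exec, hD.1, hR.int_three, hp]
    · simp [block, exec, hR.int_one]
    · simp [block, exec, hv₂]
    · simp [block, exec, hD2.1]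
    · have := hU k hkm j (by omega)
      simp [block, exec, hv₂, hD2.1, hD2.2, hF2.int, hF2.real, hR.int_one, hF.real, this, Op.eval,
        sum_range_succ]
    · simp [hi2]
    · simp [hF2.int, hv]
    · simp [hD2]
    · simpa [hF2.real] using hD.2
    · simp
    · simp [block, exec, hv₃]
    · simp [block, exec, hD3.1.1]
    · simp [block, exec, hD3.1.2.1]
    · simp [block, exec, hD3.1.2.2]
    · intro i hi l hl
      have : i * (J + 1) + l < k * (J + 1) := by
        rw [← hp]
        have : i * (J + 1) ≤ (k - 1) * (J + 1) := Nat.mul_le_mul_right _ (mem_Icc.1 hi).2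
        omega
      simp only [block, exec, setInt_real, set_real, setInt_int, hv₃, hD3.1.1]
      rw [if_neg (by simp; omega), hD3.2.1 i hi l hl]
    · intro l hl
      simp only [block, exec, setInt_real, set_real, setInt_int, hv₃, hD3.1.1]
      rcases Nat.lt_succ_iff_lt_or_eq.1 hl with h | h
      · rw [if_neg (by simp; omega), hD3.2.2 l h]
      · rw [if_pos (by simp [h]), hF3.real 4 (by decide)]
        have := hU k hkm j (by omega)
        simp [Op.eval, hF3.int, hs.int_one, hD3.1.2.2, this, h, truncRow]
    · rintro s₃ ⟨hF3, hD3⟩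
      refine ⟨hF3, hD3.1.2.1, ?_, ?_⟩
      · simp [hD3.1.1]
      · intro i hi j hj
        rw [Nat.add_sub_cancel, mem_Icc] at hi
        simp only [setInt_real]
        rcases eq_or_ne i k with rfl | h
        · exact hD3.2.2 j hj
        · exact hD3.2.1 i (mem_Icc.2 (by omega)) j hj

/-! ### Evaluation of the scores -/

section

variable {N J : ℕ} {V : ℕ → ℕ → ℝ} {y : ℕ → ℝ} {s : Memory}

/-- `40[0] := ∑ i, 2[i] / i` -/
def densProg : Program :=
  .seq (.ofInt 40 1 1) (forTo 4 1 0 (block [.ofInt 35 1 4, .op .div 35 1 2 4 35 1,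
    .op .add 40 1 40 1 35 1]))

lemma wp_densProg (hs : Ready N J s) (hy : ∀ i ∈ Icc 1 N, s.real 2 i = y i) :
    WP densProg ((N + 1) * 6 + 3) (fun s' => Frame [4, 63] [35, 40] s s' ∧
      s'.real 40 0 = runDensity N y) s := by
  have i1 := hs.int_one
  refine WP.mono (wp_exec_seq (T₁ := 1) rfl le_rfl (wp_forTo
    (C := 3) (n := N) (s₁ := s) (I := [4, 63]) (A := [35, 40])
    (fun m s' => s'.real 40 0 = ∑ i ∈ Ico 1 m, y i / i)
    ((Frame.refl _ _ _).exec rfl) (by simp) (by simp) (by simp) (by simp) hs.int_zero (by omega)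
    ?_ fun k s' hk hkn hv hF hD => wp_exec rfl le_rfl ⟨hF.exec rfl, ?_, ?_⟩)) (by omega)
    fun s' h => h
  · simp [exec, i1]
  · simp [block, exec, hv]
  · have := hy k (mem_Icc.2 ⟨hk, hkn⟩)
    simp [block, exec, hv, hF.int, hF.real, i1, hD, Op.eval, sum_Ico_succ_top hk, this]

/-- `1[i] := 2[i] / i / 40[0]` -/
def lawProg : Program :=
  forTo 4 1 0 (block [.ofInt 35 1 4, .op .div 35 1 2 4 35 1, .op .div 1 4 35 1 40 1])

lemma wp_lawProg (hs : Ready N J s) (hy : ∀ i ∈ Icc 1 N, s.real 2 i = y i)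
    (h40 : s.real 40 0 = runDensity N y) :
    WP lawProg ((N + 1) * 6 + 2) (fun s' => Frame [4, 63] [35, 1] s s' ∧
      ∀ i ∈ Icc 1 N, s'.real 1 i = runLaw N y i) s := by
  have i1 := hs.int_one
  refine WP.mono (wp_forTo
    (C := 3) (n := N) (s₁ := s) (I := [4, 63]) (A := [35, 1])
    (fun m s' => ∀ i ∈ Ico 1 m, s'.real 1 i = runLaw N y i)
    (Frame.refl _ _ _) (by simp) (by simp) (by simp) (by simp) hs.int_zero (by omega)
    (by simp) fun k s' hk hkn hv hF hD => wp_exec rfl le_rfl ⟨hF.exec rfl, ?_, ?_⟩) (by omega)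
    fun s' h => h
  · simp [block, exec, hv]
  · intro i hi
    have := hy k (mem_Icc.2 ⟨hk, hkn⟩)
    rw [mem_Ico] at hi
    simp only [block, exec, setInt_real, set_real, set_int, hv]
    rcases Nat.lt_succ_iff_lt_or_eq.1 hi.2 with h | h
    · have h' := hD i (mem_Ico.2 ⟨hi.1, h⟩)
      simp [h.ne, h']
    · simp [h, hF.int, hF.real, i1, Op.eval, this, h40, runLaw]

/-- `5[j] := ∑ i, 1[i] * 9[i, j]` -/
def outProg : Program :=
  forTo 5 0 2 (.seq (block [.ofInt 35 1 1, .intAdd 8 5 1]) (.seq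
    (forTo 4 1 0 (block [.intAdd 8 8 3, .op .mul 36 1 1 4 9 8, .op .add 35 1 35 1 36 1]))
    (.op .add 5 5 35 1 20 1)))

lemma wp_outProg (hs : Ready N J s)
    (hV : ∀ i ∈ Icc 1 N, ∀ j < J + 1, s.real 9 (i * (J + 1) + j) = V i j)
    (h1 : ∀ i ∈ Icc 1 N, s.real 1 i = runLaw N y i) :
    WP outProg ((J + 1) * (6 * (N + 1) + 8) + 2) (fun s' =>
      Frame [4, 5, 8, 63] [35, 36, 5] s s' ∧ ∀ j < J + 1, s'.real 5 j = outLaw N V y j) s := by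
  refine WP.mono (wp_forTo
    (C := 6 * (N + 1) + 5) (n := J) (s₁ := s) (I := [4, 5, 8, 63]) (A := [35, 36, 5])
    (fun m s' => ∀ j < m, s'.real 5 j = outLaw N V y j)
    (Frame.refl _ _ _) (by simp) (by simp) (by simp) (by simp) hs.int_two (by omega)
    (by simp) fun k s' hk hkn hv hF hD => ?_) (by rw [add_assoc]) fun s' h => h
  have i1 : s'.int 1 = 0 := by simp [hF.int, hs.int_one]
  refine WP.mono (wp_exec_seq (T₁ := 2) rfl le_rfl ((wp_forTo (C := 3) (n := N) (s₁ := s')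
    (I := [4, 8, 63]) (A := [35, 36])
    -- Variable `8` walks down column `k` in strides of `J + 1`, as integers cannot be multiplied.
    (fun m s₂ => s₂.int 8 = (m - 1) * (J + 1) + k ∧
      s₂.real 35 0 = ∑ i ∈ Ico 1 m, runLaw N y i * V i k)
    ((Frame.refl _ _ _).exec rfl) (by simp) (by simp) (by simp) (by simp)
    (by rw [hF.int 0 (by decide), hs.int_zero]) (by omega)
    ⟨?_, ?_⟩ fun i s₂ hi hin hv₂ hF2 hD2 => wp_exec rfl le_rfl ⟨hF2.exec rfl, ?_, ?_, ?_⟩).seq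
    (T₂ := 1) fun s₂ ⟨hF2, hD2⟩ => ?_)) (by omega) fun s' h => h
  · simp [block, exec, hv, i1]
  · simp [block, exec, i1]
  · simp [block, exec, hv₂]
  · obtain ⟨l, rfl⟩ : ∃ l, i = l + 1 := ⟨i - 1, by omega⟩
    simp [block, exec, hD2.1, hF2.int, hF.int, hs.int_three, add_mul]
    omega
  · obtain ⟨l, rfl⟩ : ∃ l, i = l + 1 := ⟨i - 1, by omega⟩
    have e : (l + 1) * (J + 1) + k = l * (J + 1) + k + (J + 1) := by ring
    have a1 := hV (l + 1) (mem_Icc.2 ⟨hi, hin⟩) k (by omega)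
    have a2 := h1 (l + 1) (mem_Icc.2 ⟨hi, hin⟩)
    rw [e] at a1
    rw [sum_Ico_succ_top hi]
    simp [block, exec, hv₂, hD2.1, hD2.2, hF2.int, hF2.real, hF.int, hF.real, hs.int_three,
      hs.int_one, a1, a2, Op.eval]
  · have hF3 := hF.trans (hF2.mono (by decide) (by decide))
    have i5 : s₂.int 5 = k := by rw [hF2.int 5 (by decide), hv]
    refine wp_exec rfl le_rfl ⟨hF3.exec rfl, ?_, ?_⟩
    · simp [exec, i5]
    · intro j hj
      simp only [exec, setInt_real, set_real, i5]
      rcases Nat.lt_succ_iff_lt_or_eq.1 hj with h | h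
      · simp [h.ne, hF2.real, hD j h]
      · simp [h, hF3.int, hF3.real, hs.int_one, hs.zero, hD2.2, Op.eval, outLaw]
        rfl

/-- `6[i]` := the approximate score of `i` -/
def scoreProg : Program :=
  .seq (.const 7 0) (forTo 4 1 0 (.seq (block [.intAdd 7 7 3, .ofInt 37 1 1]) (.seq
    (forTo 5 0 2 (.seq (block [.intAdd 8 7 5, .op .div 32 1 9 8 5 5, .op .sub 32 1 32 1 21 1])
      (.seq logSumProg (block [.op .mul 34 1 9 8 33 1, .op .add 37 1 37 1 34 1]))))
    (block [.op .mul 36 1 31 1 9 7, .op .sub 37 1 37 1 36 1, .ofInt 36 1 4,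
      .op .div 6 4 37 1 36 1]))))

lemma wp_scoreProg (hs : Ready N J s) {Δ : ℝ}
    (hV : ∀ i ∈ Icc 1 N, ∀ j < J + 1, s.real 9 (i * (J + 1) + j) = V i j)
    (h5 : ∀ j < J + 1, s.real 5 j = outLaw N V y j) (h31 : s.real 31 0 = Δ * logSum J 1) :
    WP scoreProg ((N + 1) * ((J + 1) * (8 * (J + 1) + 11) + 11) + 3) (fun s' =>
      Frame [4, 5, 6, 7, 8, 63] [6, 32, 33, 34, 36, 37] s s' ∧
      ∀ i ∈ Icc 1 N, s'.real 6 i = approxScore N J V J Δ y i) s := by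
  refine WP.mono (wp_exec_seq (T₁ := 1) rfl le_rfl (wp_forTo
    (C := (J + 1) * (8 * (J + 1) + 11) + 8) (n := N) (s₁ := s) (I := [4, 5, 6, 7, 8, 63])
    (A := [6, 32, 33, 34, 36, 37])
    (fun m s' => s'.int 7 = (m - 1) * (J + 1) ∧
      ∀ i ∈ Ico 1 m, s'.real 6 i = approxScore N J V J Δ y i)
    ((Frame.refl _ _ _).exec rfl) (by simp) (by simp) (by simp) (by simp) hs.int_zero (by omega)
    ⟨by simp [exec], by simp⟩ fun k s' hk hkn hv hF hD => ?_)) (by ring_nf; omega) fun s' h =>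
      ⟨h.1, h.2.2⟩
  have hR := hs.frame hF (by decide) (by decide)
  have hkm : k ∈ Icc 1 N := mem_Icc.2 ⟨hk, hkn⟩
  have hp : (k - 1) * (J + 1) + (J + 1) = k * (J + 1) := by
    obtain ⟨k, rfl⟩ : ∃ l, k = l + 1 := ⟨k - 1, by omega⟩
    simp [add_mul]
  refine WP.mono (wp_exec_seq (T₁ := 2) rfl le_rfl ((wp_forTo (C := 8 * (J + 1) + 8) (n := J)
    (s₁ := s') (I := [5, 6, 7, 8, 63]) (A := [32, 33, 34, 37])
    (fun m s₂ => s₂.int 7 = k * (J + 1) ∧ s₂.real 37 0 =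
      ∑ j ∈ range m, V k j * logSum J (V k j / outLaw N V y j - 1))
    ((Frame.refl _ _ _).exec rfl) (by simp) (by simp) (by simp) (by simp) hR.int_two (by omega)
    ⟨?_, ?_⟩ fun j s₂ hj hjn hv₂ hF2 hD2 => ?_).seq (T₂ := 4) fun s₂ ⟨hF2, hD2⟩ => ?_))
    (by ring_nf; omega) fun s' h => h
  · simp [block, exec, hD.1, hR.int_three, hp]
  · simp [block, exec, hR.int_one]
  · set s₃ := exec (block [.intAdd 8 7 5, .op .div 32 1 9 8 5 5, .op .sub 32 1 32 1 21 1]) s₂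
      with hs₃
    have hF3 : Frame [5, 6, 7, 8, 63] [32, 33, 34, 37] s' s₃ := hF2.exec rfl
    have hR3 := hR.frame hF3 (by decide) (by decide)
    have a1 := hV k hkm j (by omega)
    have a2 := h5 j (by omega)
    have t : s₃.real 32 0 = V k j / outLaw N V y j - 1 := by
      simp [hs₃, block, exec, hv₂, hD2.1, hF2.int, hF2.real, hF.int, hF.real, hs.int_one, hs.one,
        a1, a2, Op.eval]
    have t8 : s₃.int 8 = k * (J + 1) + j := by
      simp [hs₃, block, exec, hv₂, hD2.1]
    have t7 : s₃.int 7 = k * (J + 1) := by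
      simp [hs₃, block, exec, hD2.1]
    have t5 : s₃.int 5 = j := by
      simp [hs₃, block, exec, hv₂]
    have t37 : s₃.real 37 0 = s₂.real 37 0 := by
      simp [hs₃, block, exec]
    refine WP.mono (wp_exec_seq (T₁ := 3) rfl le_rfl ((wp_logSumProg hR3).seq (T₂ := 2)
      fun s₄ ⟨hF4, hD4⟩ => wp_exec rfl le_rfl
        ⟨(hF3.trans (hF4.mono (by decide) (by decide))).exec rfl, ?_, ?_, ?_⟩))
      (by omega) fun s' h => h
    · simp [block, exec, hF4.int, t5]
    · simp [block, exec, hF4.int, t7]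
    · have b1 : s₄.real 9 = s.real 9 := by
        rw [hF4.real 9 (by decide), hF3.real 9 (by decide), hF.real 9 (by decide)]
      simp [block, exec, hF4.int, hF4.real 37 (by decide), t8, hR3.int_one, b1, a1, hD4, t, t37,
        hD2.2, Op.eval, sum_range_succ]
  · have hF3 := hF.trans (hF2.mono (by decide) (by decide))
    have i4 : s₂.int 4 = k := by rw [hF2.int 4 (by decide), hv]
    have a1 := hV k hkm 0 (by omega)
    rw [add_zero] at a1
    refine wp_exec rfl le_rfl ⟨hF3.exec rfl, ?_, ?_, ?_⟩
    · simp [block, exec, i4]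
    · simp [block, exec, hD2.1]
    · intro i hi
      rw [mem_Ico] at hi
      simp only [block, exec, setInt_real, set_real, set_int, i4]
      rcases Nat.lt_succ_iff_lt_or_eq.1 hi.2 with h | h
      · simp [h.ne, hF2.real, hD.2 i (mem_Ico.2 ⟨hi.1, h⟩)]
      · simp [h, hF3.int, hF3.real, hs.int_one, hD2.1, hD2.2, a1, h31, Op.eval, approxScore]

/-- `41[0]` := the approximate value plus `22[0]`; variable `10` := the run length with the best
approximate score -/
def bestProg : Program :=
  .seq (block [.const 10 1, .ofInt 41 1 1]) (.seq
    (forTo 4 1 0 (block [.op .mul 36 1 2 4 6 4, .op .add 41 1 41 1 36 1,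
      .branch (.realLe 6 10 6 4) (.intAdd 10 4 1) (.const 63 0)]))
    (.op .add 41 1 41 1 22 1))

/-- The gap threshold in `22[0]` is added to the value here, so that the stopping test becomes a
single comparison with the best score. -/
lemma wp_bestProg (hN : 0 < N) (hs : Ready N J s) {c : ℕ → ℝ}
    (hy : ∀ i ∈ Icc 1 N, s.real 2 i = y i) (h6 : ∀ i ∈ Icc 1 N, s.real 6 i = c i) :
    WP bestProg ((N + 1) * 7 + 5) (fun s' =>
      Frame [4, 10, 63] [36, 41] s s' ∧
      s'.real 41 0 = ∑ i ∈ Icc 1 N, y i * c i + s.real 22 0 ∧ s'.int 10 ∈ Icc 1 N ∧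
      ∀ i ∈ Icc 1 N, c i ≤ c (s'.int 10)) s := by
  have i1 := hs.int_one
  refine WP.mono (wp_exec_seq (T₁ := 2) rfl le_rfl ((wp_forTo
    (C := 4) (n := N) (s₁ := s) (I := [4, 10, 63]) (A := [36, 41])
    (fun m s' => s'.real 41 0 = ∑ i ∈ Ico 1 m, y i * c i ∧ s'.int 10 ∈ Icc 1 N ∧
      ∀ i ∈ Ico 1 m, c i ≤ c (s'.int 10))
    ((Frame.refl _ _ _).exec rfl) (by simp) (by simp) (by simp) (by simp) hs.int_zero (by omega)
    ⟨?_, ?_, ?_⟩ fun k s' hk hkn hv hF hD => wp_exec rfl le_rfl ⟨hF.exec rfl, ?_⟩).seq (T₂ := 1)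
    fun s' ⟨hF, hD1, hD2, hD3⟩ => wp_exec rfl le_rfl ⟨hF.exec rfl, ?_, ?_, ?_⟩)) (by omega)
    fun s' h => h
  · simp [block, exec, i1]
  · simp [block, exec]; omega
  · simp
  · have hkm : k ∈ Icc 1 N := mem_Icc.2 ⟨hk, hkn⟩
    have a1 := hy k hkm
    have a2 := h6 k hkm
    have a3 := h6 _ hD.2.1
    have i1' : s'.int 1 = 0 := by simp [hF.int, i1]
    have e : ∀ x, s'.real 6 x = s.real 6 x := fun x => by rw [hF.real 6 (by decide)]
    simp only [block, exec, Test.Holds, Memory.get, set_int, set_real, hv]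
    simp only [e, a3, a2, Nat.reduceEqDiff, false_and, and_self, if_false, if_true]
    split_ifs with h
    · refine ⟨?_, ?_, ?_, ?_⟩
      · simp [hv]
      · simp [i1', hD.1, hF.real, a1, Op.eval, sum_Ico_succ_top hk]
      · simpa [i1'] using hkm
      · intro i hi
        rw [mem_Ico] at hi
        simp only [setInt_int, i1']
        norm_num
        rcases Nat.lt_succ_iff_lt_or_eq.1 hi.2 with h' | h'
        · exact (hD.2.2 i (mem_Ico.2 ⟨hi.1, h'⟩)).trans h
        · rw [h']
    · refine ⟨?_, ?_, ?_, ?_⟩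
      · simp [hv]
      · simp [i1', hD.1, hF.real, a1, Op.eval, sum_Ico_succ_top hk]
      · simpa using hD.2.1
      · intro i hi
        rw [mem_Ico] at hi
        simp only [setInt_int, set_int]
        norm_num
        rcases Nat.lt_succ_iff_lt_or_eq.1 hi.2 with h' | h'
        · exact hD.2.2 i (mem_Ico.2 ⟨hi.1, h'⟩)
        · rw [h']; exact (not_le.1 h).le
  · simp [exec, hF.int, i1, hD1, hF.real, Op.eval]
    rfl
  · simpa [exec] using hD2
  · simpa [exec] using hD3

/-- Evaluation of the run-length law and of the approximate scores -/
def evalProg : Program :=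
  .seq densProg (.seq lawProg (.seq outProg (.seq scoreProg bestProg)))

lemma wp_evalProg (hN : 0 < N) (hs : Ready N J s) {Δ : ℝ}
    (hV : ∀ i ∈ Icc 1 N, ∀ j < J + 1, s.real 9 (i * (J + 1) + j) = V i j)
    (hy : ∀ i ∈ Icc 1 N, s.real 2 i = y i) (h31 : s.real 31 0 = Δ * logSum J 1) :
    WP evalProg (100 * (N + 1) * (J + 1) ^ 2) (fun s' =>
      Frame [4, 5, 6, 7, 8, 10, 63] [1, 5, 6, 32, 33, 34, 35, 36, 37, 40, 41] s s' ∧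
      (∀ i ∈ Icc 1 N, s'.real 1 i = runLaw N y i) ∧
      s'.real 41 0 = approxValue N J V J Δ y + s.real 22 0 ∧ s'.int 10 ∈ Icc 1 N ∧
      s'.real 6 (s'.int 10) = approxScore N J V J Δ y (s'.int 10) ∧
      ∀ i ∈ Icc 1 N, approxScore N J V J Δ y i ≤ approxScore N J V J Δ y (s'.int 10)) s := by
  refine WP.le ((wp_densProg hs hy).seq fun s₁ ⟨hF1, h1⟩ => (wp_lawProg (J := J) (y := y) ?_ ?_ h1).seq
    fun s₂ ⟨hF2, h2⟩ => (wp_outProg (V := V) (y := y) ?_ ?_ h2).seq fun s₃ ⟨hF3, h3⟩ =>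
    (wp_scoreProg (J := J) (y := y) (V := V) (Δ := Δ) ?_ ?_ h3 ?_).seq fun s₄ ⟨hF4, h4⟩ =>
    (wp_bestProg (J := J) (y := y) (c := approxScore N J V J Δ y) hN ?_ ?_ h4).mono le_rfl
      fun s₅ ⟨hF5, h5⟩ => ⟨?_, ?_, ?_, h5.2.1, ?_, h5.2.2⟩) ?_
  · exact hs.frame hF1 (by decide) (by decide)
  · simpa [hF1.real] using hy
  · exact (hs.frame hF1 (by decide) (by decide)).frame hF2 (by decide) (by decide)
  · simpa [hF1.real, hF2.real] using hV
  · exact ((hs.frame hF1 (by decide) (by decide)).frame hF2 (by decide) (by decide)).frame hF3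
      (by decide) (by decide)
  · simpa [hF1.real, hF2.real, hF3.real] using hV
  · simpa [hF1.real, hF2.real, hF3.real] using h31
  · exact (((hs.frame hF1 (by decide) (by decide)).frame hF2 (by decide) (by decide)).frame hF3
      (by decide) (by decide)).frame hF4 (by decide) (by decide)
  · simpa [hF1.real, hF2.real, hF3.real, hF4.real] using hy
  · exact ((((hF1.mono (by decide) (by decide)).trans (hF2.mono (by decide) (by decide))).trans
      (hF3.mono (by decide) (by decide))).trans (hF4.mono (by decide) (by decide))).trans
      (hF5.mono (by decide) (by decide))
  · simpa [hF3.real, hF4.real, hF5.real] using h2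
  · rw [h5.1, hF4.real 22 (by decide), hF3.real 22 (by decide), hF2.real 22 (by decide),
      hF1.real 22 (by decide)]
    rfl
  · rw [hF5.real 6 (by decide), h4 _ h5.2.1]
  · have h1 : 1 ≤ N + 1 := by omega
    have h2 : 1 ≤ J + 1 := by omega
    generalize N + 1 = n at h1 ⊢
    generalize J + 1 = m at h2 ⊢
    have h3 : m ≤ m ^ 2 := Nat.le_self_pow two_ne_zero m
    have h4 : n * m ≤ n * m ^ 2 := Nat.mul_le_mul_left n h3
    have h5 : n ≤ n * m := Nat.le_mul_of_pos_right n h2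
    have h6 : m ≤ n * m := Nat.le_mul_of_pos_left m h1
    have e : n * (m * (8 * m + 11) + 11) = 8 * (n * m ^ 2) + 11 * (n * m) + 11 * n := by ring
    have e2 : m * (6 * n + 8) = 6 * (n * m) + 8 * m := by ring
    rw [e, e2, mul_assoc]
    omega

/-- A step of the iteration: `2[i] := 25[0] * 2[i] + 28[0]` for all `i`, and then
`2[b] += 29[0]` for `b` the value of variable `10`. -/
def updateProg : Program :=
  .seq (forTo 4 1 0 (block [.op .mul 36 1 25 1 2 4, .op .add 2 4 36 1 28 1]))
    (.op .add 2 10 2 10 29 1)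

lemma wp_updateProg (hs : Ready N J s) {γ μ : ℝ} (hy : ∀ i ∈ Icc 1 N, s.real 2 i = y i)
    (h25 : s.real 25 0 = 1 - γ) (h28 : s.real 28 0 = γ * μ / N)
    (h29 : s.real 29 0 = γ * (1 - μ)) :
    WP updateProg ((N + 1) * 5 + 3) (fun s' =>
      Frame [4, 63] [2, 36] s s' ∧
      ∀ i ∈ Icc 1 N, s'.real 2 i = simplexStep N γ μ (s.int 10) y i) s := by
  have i1 := hs.int_one
  refine WP.mono ((wp_forTo
    (C := 2) (n := N) (s₁ := s) (I := [4, 63]) (A := [2, 36])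
    (fun m s' => (∀ i ∈ Ico 1 m, s'.real 2 i = (1 - γ) * y i + γ * μ / N) ∧
      ∀ i ∈ Icc m N, s'.real 2 i = y i)
    (Frame.refl _ _ _) (by simp) (by simp) (by simp) (by simp) hs.int_zero (by omega)
    (by simpa using hy) fun k s' hk hkn hv hF hD =>
      wp_exec rfl le_rfl ⟨hF.exec rfl, ?_, ?_, ?_⟩).seq (T₂ := 1)
    fun s' ⟨hF, hD, _⟩ => wp_exec rfl le_rfl ⟨hF.exec rfl, ?_⟩) (by omega) fun s' h => h
  · simp [block, exec, hv]
  · intro i hi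
    rw [mem_Ico] at hi
    simp only [block, exec, setInt_real, set_real, set_int, hv]
    rcases Nat.lt_succ_iff_lt_or_eq.1 hi.2 with h | h
    · simp [h.ne, hD.1 i (mem_Ico.2 ⟨hi.1, h⟩)]
    · simp [h, hF.int, hF.real, i1, h25, h28, Op.eval, hD.2 k (mem_Icc.2 ⟨le_rfl, hkn⟩)]
  · intro i hi
    rw [mem_Icc] at hi
    have h : i ≠ k := by omega
    simp [block, exec, hv, h, hD.2 i (mem_Icc.2 ⟨by omega, hi.2⟩)]
  · intro i hi
    have h := hD i hi
    by_cases hb : i = s.int 10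
    · subst hb
      simp [exec, hF.int, hF.real, i1, h, h29, Op.eval, simplexStep]
    · simp [exec, hF.int, hb, h, simplexStep]

end

/-! ### The parameters -/

/-- `x` := the least integer that is at least `c` and exceeds `a[0]`; `t[0]` := `x` -/
def countUp (x t a c : ℕ) : Program :=
  .seq (block [.const x c, .ofInt t 1 x]) (.loop (.realLe t 1 a 1)
    (block [.const 63 1, .intAdd x x 63, .ofInt t 1 x]))

/-- Counting stands in for rounding, at a cost linear in the result. The result strictly exceeds the
real, so a natural number `n` is turned into `n + 1`; hence the values `M ^ 4 + 1` and `M ^ 20 + 1`.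
-/
lemma wp_countUp {x t a c : ℕ} {s : Memory} (i1 : s.int 1 = 0) (hx : x ≠ 1) (hx63 : x ≠ 63)
    (hta : a ≠ t) (hr : 0 ≤ s.real a 0) :
    WP (countUp x t a c) (4 * (⌊s.real a 0⌋₊ + 1) + 3) (fun s' => Frame [x, 63] [t] s s' ∧
      s'.int x = max c (⌊s.real a 0⌋₊ + 1) ∧ s'.real t 0 = s'.int x) s := by
  set r := s.real a 0 with hrdef
  refine WP.mono (wp_exec_seq (T₁ := 2) rfl le_rfl (wp_loop (fun k s' => Frame [x, 63] [t] s s' ∧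
    -- The last disjunction remembers that the previous test succeeded, which makes the final count
    -- the least possible.
    s'.int x = c + k ∧ s'.real t 0 = s'.int x ∧ (k = 0 ∨ (c + k : ℝ) ≤ r + 1)) (⌊r⌋₊ + 1) 3
    ?_ ⟨?_, ?_, ?_, ?_⟩)) (by omega) ?_
  · rintro k s' ⟨hF, hk, ht, -⟩ hle
    have i1' : s'.int 1 = 0 := by rw [hF.int 1 (by simp; omega), i1]
    have hle' : (c + k : ℝ) ≤ r := by
      simp only [Test.Holds, Memory.get, i1', ht, hk, hF.real a (by simpa using hta)] at hle
      exact_mod_cast hle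
    refine ⟨?_, wp_exec rfl le_rfl ⟨hF.exec (by simp [writesOnly, block]), ?_, ?_, Or.inr ?_⟩⟩
    · have : (k : ℝ) ≤ r := by have : (0 : ℝ) ≤ c := by positivity
                               linarith
      exact Nat.lt_succ_of_le (Nat.le_floor this)
    · simp [block, exec, hx63, hk, add_assoc]
    · simp [block, exec, i1', hx.symm, hx63]
    · push_cast; linarith
  · exact (Frame.refl _ _ _).exec (by simp [writesOnly, block])
  · simp [block, exec]
  · simp [block, exec, i1, hx.symm]
  · simp
  · rintro s' ⟨k, ⟨hF, hk, ht, hk'⟩, hnot⟩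
    refine ⟨hF, ?_, ht⟩
    have i1' : s'.int 1 = 0 := by rw [hF.int 1 (by simp; omega), i1]
    have hlt : r < (c + k : ℝ) := by
      simp only [Test.Holds, Memory.get, i1', ht, hk, hF.real a (by simpa using hta), not_le] at hnot
      exact_mod_cast hnot
    have h1 : ⌊r⌋₊ + 1 ≤ c + k := by
      have : ⌊r⌋₊ < c + k := (Nat.floor_lt hr).2 (by exact_mod_cast hlt)
      omega
    rw [hk]
    rcases Nat.eq_zero_or_pos k with rfl | hpos
    · omega
    · obtain ⟨l, rfl⟩ : ∃ l, k = l + 1 := ⟨k - 1, by omega⟩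
      have h2 : ((c + l : ℕ) : ℝ) ≤ r := by
        push_cast
        rcases hk' with h | h
        · omega
        · push_cast at h; linarith
      have h3 := Nat.le_floor h2
      omega

/-- The state after the parameters have been computed from the input `[ε, p, Δ]`. -/
structure HasParams (M : ℕ) (p Δ : ℝ) (s : Memory) : Prop where
  ready : Ready (M ^ 4 + 1) (M ^ 20 + 1) s
  cell_param : s.real 14 0 = p
  threshold : s.real 22 0 = 1 / M ^ 2
  stay : s.real 25 0 = 1 - 1 / M ^ 16
  castN : s.real 27 0 = (M ^ 4 + 1 : ℕ)
  spread : s.real 28 0 = 1 / M ^ 16 * (1 / M ^ 8) / (M ^ 4 + 1 : ℕ)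
  gain : s.real 29 0 = 1 / M ^ 16 * (1 - 1 / M ^ 8)
  penalty : s.real 31 0 = Δ * logSum (M ^ 20 + 1) 1
  zero_three : ∀ x, s.real 3 x = 0
  zero_four : ∀ x, s.real 4 x = 0

/-- Reads the input; the bound `L` on the mean number of copies is copied from `src[0]`. -/
def inputProg (src : ℕ) : Program :=
  block [.const 4 1, .const 5 2, .const 6 1, .ofInt 20 1 1, .ofInt 21 1 6,
    .op .add 14 1 0 4 20 1, .op .add 13 1 0 5 20 1, .op .add 10 1 src 1 20 1,
    .op .div 11 1 21 1 0 1, .op .add 11 1 11 1 13 1, .op .add 11 1 11 1 10 1]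

/-- Powers of `12[0]`. -/
def powersProg : Program :=
  block [.op .mul 15 1 12 1 12 1, .op .mul 16 1 15 1 15 1, .op .mul 17 1 16 1 16 1,
    .op .mul 18 1 17 1 17 1, .op .mul 19 1 18 1 16 1]

/-- The remaining parameters. -/
def constantsProg : Program :=
  block [.const 63 1, .intAdd 3 2 63, .op .div 22 1 21 1 15 1, .op .div 23 1 21 1 17 1,
    .op .div 24 1 21 1 18 1, .op .sub 25 1 21 1 24 1, .op .mul 28 1 24 1 23 1,
    .op .div 28 1 28 1 27 1, .op .sub 29 1 21 1 23 1, .op .mul 29 1 24 1 29 1,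
    .op .add 32 1 21 1 20 1]

/-- The computation of all parameters. -/
def setupProg (src : ℕ) : Program :=
  .seq (inputProg src) (.seq (countUp 9 12 11 100) (.seq powersProg (.seq (countUp 0 27 16 0)
    (.seq (countUp 2 26 19 0) (.seq constantsProg (.seq logSumProg (.op .mul 31 1 13 1 33 1)))))))

/-- Powers of `M` are formed as reals, where multiplication exists, and counted back into integers;
this is affordable since `M ^ 20` is far below the total time. `hsrc` covers the two sources of `L`:
the constant `1` or the channel parameter. -/
lemma wp_setupProg {src : ℕ} {ε p Δ L : ℝ} (hε : 0 < ε) (hΔ : 0 ≤ Δ) (hL : 0 ≤ L)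
    (hsrc : src = 21 ∧ L = 1 ∨ src = 14 ∧ L = p) {M : ℕ}
    (hM : M = max 100 (⌊1 / ε + Δ + L⌋₊ + 1)) :
    WP (setupProg src) (100 * M ^ 20) (HasParams M p Δ) (initial [ε, p, Δ]) := by
  set s₀ := initial [ε, p, Δ] with hs₀
  have z : ∀ x, s₀.int x = 0 := fun x => rfl
  have r0 : s₀.real 0 0 = ε := rfl
  have r1 : s₀.real 0 1 = p := rfl
  have r2 : s₀.real 0 2 = Δ := rfl
  have rz : ∀ a x, a ≠ 0 → s₀.real a x = 0 := fun a x ha => if_neg ha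
  set s₁ := exec (inputProg src) s₀ with hs₁
  have hF1 : Frame [4, 5, 6] [20, 21, 14, 13, 10, 11] s₀ s₁ := (Frame.refl _ _ _).exec rfl
  have a1 : s₁.int 1 = 0 := by rw [hF1.int 1 (by decide), z]
  have a20 : s₁.real 20 0 = 0 := by simp [hs₁, inputProg, block, exec, z]
  have a21 : s₁.real 21 0 = 1 := by simp [hs₁, inputProg, block, exec, z]
  have a14 : s₁.real 14 0 = p := by simp [hs₁, inputProg, block, exec, z, r1, Op.eval]
  have a13 : s₁.real 13 0 = Δ := by simp [hs₁, inputProg, block, exec, z, r2, Op.eval]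
  have a11 : s₁.real 11 0 = 1 / ε + Δ + L := by
    rcases hsrc with ⟨rfl, rfl⟩ | ⟨rfl, rfl⟩ <;>
      simp [hs₁, inputProg, block, exec, z, r0, r1, r2, Op.eval]
  have hX : 0 ≤ 1 / ε + Δ + L := by positivity
  have hfl : ⌊1 / ε + Δ + L⌋₊ + 1 ≤ M := hM ▸ le_max_right _ _
  have hM1 : 1 ≤ M := by omega
  have pw1 : 1 ≤ M ^ 20 := Nat.one_le_pow _ _ hM1
  have pwM : M ≤ M ^ 20 := Nat.le_self_pow (by norm_num) M
  have pw4 : M ^ 4 ≤ M ^ 20 := Nat.pow_le_pow_right hM1 (by norm_num)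
  refine WP.le (wp_exec_seq (T₁ := 11) rfl le_rfl ((wp_countUp (c := 100) a1 (by decide)
    (by decide) (by decide) (by rw [a11]; exact hX)).seq (T₂ := 8 * M ^ 20 + 8 * M ^ 20 + 60 * M ^ 20)
    fun s₂ ⟨hF2, i9, r12⟩ => ?_)) ?_
  · rw [a11, ← hM] at i9
    rw [i9] at r12
    set s₃ := exec powersProg s₂ with hs₃
    have hF3 : Frame [] [15, 16, 17, 18, 19] s₂ s₃ := (Frame.refl _ _ _).exec rfl
    have b1 : s₂.int 1 = 0 := by rw [hF2.int 1 (by decide), a1]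
    have b15 : s₃.real 15 0 = M ^ 2 := by
      simp [hs₃, powersProg, block, exec, b1, r12, Op.eval]; ring
    have b16 : s₃.real 16 0 = (M ^ 4 : ℕ) := by
      simp [hs₃, powersProg, block, exec, b1, r12, Op.eval]; ring
    have b17 : s₃.real 17 0 = M ^ 8 := by
      simp [hs₃, powersProg, block, exec, b1, r12, Op.eval]; ring
    have b18 : s₃.real 18 0 = M ^ 16 := by
      simp [hs₃, powersProg, block, exec, b1, r12, Op.eval]; ring
    have b19 : s₃.real 19 0 = (M ^ 20 : ℕ) := by
      simp [hs₃, powersProg, block, exec, b1, r12, Op.eval]; ring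
    have b1' : s₃.int 1 = 0 := by rw [hF3.int 1 (by decide), b1]
    refine WP.le (wp_exec_seq (T₁ := 5) rfl le_rfl ((wp_countUp (c := 0) b1' (by decide)
      (by decide) (by decide) (by rw [b16]; positivity)).seq
      (T₂ := 8 * M ^ 20 + 50 * M ^ 20) fun s₄ ⟨hF4, i0, r27⟩ => ?_)) ?_
    · rw [b16, Nat.floor_natCast, max_eq_right (Nat.zero_le _)] at i0
      rw [i0] at r27
      have c1 : s₄.int 1 = 0 := by rw [hF4.int 1 (by decide), b1']
      have c19 : s₄.real 19 0 = (M ^ 20 : ℕ) := by rw [hF4.real 19 (by decide), b19]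
      refine WP.le ((wp_countUp (c := 0) c1 (by decide)
        (by decide) (by decide) (by rw [c19]; positivity)).seq
        (T₂ := 42 * M ^ 20) fun s₅ ⟨hF5, i2, r26⟩ => ?_) ?_
      · rw [c19, Nat.floor_natCast, max_eq_right (Nat.zero_le _)] at i2
        rw [i2] at r26
        set s₆ := exec constantsProg s₅ with hs₆
        have hF6 : Frame [3, 63] [22, 23, 24, 25, 28, 29, 32] s₅ s₆ := (Frame.refl _ _ _).exec rfl
        have hF : Frame [0, 2, 3, 4, 5, 6, 9, 63] [10, 11, 12, 13, 14, 15, 16, 17, 18, 19, 20, 21, 22,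
            23, 24, 25, 26, 27, 28, 29, 32] s₀ s₆ :=
          (((((hF1.mono (by decide) (by decide)).trans (hF2.mono (by decide) (by decide))).trans
            (hF3.mono (by decide) (by decide))).trans (hF4.mono (by decide) (by decide))).trans
            (hF5.mono (by decide) (by decide))).trans (hF6.mono (by decide) (by decide))
        have d1 : s₅.int 1 = 0 := by rw [hF5.int 1 (by decide), c1]
        have d0 : s₅.int 0 = M ^ 4 + 1 := by rw [hF5.int 0 (by decide), i0]
        have d : ∀ a ∉ [15, 16, 17, 18, 19, 12, 26, 27], s₅.real a = s₁.real a := by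
          intro a ha
          simp only [List.mem_cons, not_or] at ha
          rw [hF5.real a (by simp; omega), hF4.real a (by simp; omega),
            hF3.real a (by simp; omega), hF2.real a (by simp; omega)]
        have d3 : ∀ a ∉ [26, 27], s₅.real a = s₃.real a := by
          intro a ha
          simp only [List.mem_cons, not_or] at ha
          rw [hF5.real a (by simp; omega), hF4.real a (by simp; omega)]
        have d20 : s₅.real 20 0 = 0 := by rw [d 20 (by decide), a20]
        have d21 : s₅.real 21 0 = 1 := by rw [d 21 (by decide), a21]
        have d15 : s₅.real 15 0 = M ^ 2 := by rw [d3 15 (by decide), b15]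
        have d17 : s₅.real 17 0 = M ^ 8 := by rw [d3 17 (by decide), b17]
        have d18 : s₅.real 18 0 = M ^ 16 := by rw [d3 18 (by decide), b18]
        have d27 : s₅.real 27 0 = (M ^ 4 + 1 : ℕ) := by rw [hF5.real 27 (by decide), r27]
        have hR : Ready (M ^ 4 + 1) (M ^ 20 + 1) s₆ := by
          constructor
          · rw [hF6.int 0 (by decide), d0]
          · rw [hF6.int 1 (by decide), d1]
          · rw [hF6.int 2 (by decide), i2]
          · simp [hs₆, constantsProg, block, exec, i2]
          · rw [hF6.real 20 (by decide), d20]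
          · rw [hF6.real 21 (by decide), d21]
          · rw [hF6.real 26 (by decide), r26]
        refine WP.le (wp_exec_seq (T₁ := 11) rfl le_rfl ((wp_logSumProg hR).seq (T₂ := 1)
          fun s₇ ⟨hF7, hD7⟩ => wp_exec rfl le_rfl ?_)) ?_
        · have e32 : s₆.real 32 0 = 1 := by
            simp [hs₆, constantsProg, block, exec, d1, d20, d21, Op.eval]
          have e1 : s₇.int 1 = 0 := by rw [hF7.int 1 (by decide), hR.int_one]
          have e13 : s₇.real 13 0 = Δ := by
            rw [hF7.real 13 (by decide), hF6.real 13 (by decide), d 13 (by decide), a13]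
          have hF8 : Frame [6, 63] [31, 33, 34] s₆ (exec (.op .mul 31 1 13 1 33 1) s₇) :=
            (hF7.mono (by decide) (by decide)).exec rfl
          constructor
          · exact hR.frame hF8 (by decide) (by decide)
          · rw [hF8.real 14 (by decide), hF6.real 14 (by decide), d 14 (by decide), a14]
          · rw [hF8.real 22 (by decide)]
            simp [hs₆, constantsProg, block, exec, d1, d21, d15, Op.eval]
          · rw [hF8.real 25 (by decide)]
            simp [hs₆, constantsProg, block, exec, d1, d21, d18, Op.eval]
          · rw [hF8.real 27 (by decide), hF6.real 27 (by decide), d27]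
          · rw [hF8.real 28 (by decide)]
            simp [hs₆, constantsProg, block, exec, d1, d21, d18, d17, d27, Op.eval]
          · rw [hF8.real 29 (by decide)]
            simp [hs₆, constantsProg, block, exec, d1, d21, d18, d17, Op.eval]
          · simp [exec, e1, e13, hD7, e32, Op.eval]
          · intro x
            rw [hF8.real 3 (by decide), hF.real 3 (by decide), rz 3 x (by decide)]
          · intro x
            rw [hF8.real 4 (by decide), hF.real 4 (by decide), rz 4 x (by decide)]
        · omega
      · rw [c19, Nat.floor_natCast]
        omega
    · rw [b16, Nat.floor_natCast]
      omega
  · rw [a11]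
    omega

/-! ### The laws of the number of copies -/

/-- The law of the number of copies for the deletion channel, in array `3`. -/
def bdcProg : Program :=
  block [.const 5 1, .op .add 3 1 14 1 20 1, .op .sub 3 5 21 1 14 1]

lemma wp_bdcProg {N J : ℕ} {s : Memory} {d : ℝ} (hs : Ready N J s) (h14 : s.real 14 0 = d)
    (h3 : ∀ x, s.real 3 x = 0) :
    WP bdcProg (8 * (J + 1) + 3) (fun s' => Frame [5, 6, 63] [3, 35, 36] s s' ∧
      ∀ k < J + 1, s'.real 3 k = bdc d k) s := by
  refine wp_exec rfl (by simp [bdcProg, block, cost]) ⟨(Frame.refl _ _ _).exec rfl, ?_⟩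
  intro k _
  rcases k with _ | _ | k <;>
    simp [bdcProg, block, exec, hs.int_one, h14, hs.zero, hs.one, h3, Op.eval, bdc]

/-- A multiple of the law of the number of copies for the Poisson channel, in array `3`. -/
def prcProg : Program :=
  .seq (.op .add 3 1 21 1 20 1) (forTo 5 1 2 (block [.const 63 1, .intSub 6 5 63,
    .op .mul 35 1 3 6 14 1, .ofInt 36 1 5, .op .div 3 5 35 1 36 1]))

lemma wp_prcProg {N J : ℕ} {s : Memory} {lam : ℝ} (hs : Ready N J s) (h14 : s.real 14 0 = lam) :
    WP prcProg (8 * (J + 1) + 3) (fun s' => Frame [5, 6, 63] [3, 35, 36] s s' ∧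
      ∀ k < J + 1, s'.real 3 k = lam ^ k / (k.factorial : ℝ)) s := by
  have i1 := hs.int_one
  refine WP.le (wp_exec_seq (T₁ := 1) rfl le_rfl (wp_forTo (C := 5) (n := J) (s₁ := s)
    (I := [5, 6, 63]) (A := [3, 35, 36])
    (fun m s' => ∀ k < m, s'.real 3 k = lam ^ k / (k.factorial : ℝ))
    ((Frame.refl _ _ _).exec rfl) (by simp) (by simp) (by simp) (by simp) hs.int_two (by omega)
    ?_ fun k s' hk hkn hv hF hD => wp_exec rfl le_rfl ⟨hF.exec rfl, ?_, ?_⟩)) (by omega)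
  · intro k hk
    obtain rfl : k = 0 := by omega
    simp [exec, i1, hs.one, hs.zero, Op.eval]
  · simp [block, exec, hv]
  · intro j hj
    simp only [block, exec, setInt_real, set_real, setInt_int, set_int]
    obtain ⟨l, rfl⟩ : ∃ l, k = l + 1 := ⟨k - 1, by omega⟩
    rcases Nat.lt_succ_iff_lt_or_eq.1 hj with h | h
    · simp [hv, h.ne, hD j h]
    · have := hD l (by omega)
      subst h
      simp [hv, hF.int, hF.real, i1, h14, this, Op.eval, Nat.factorial_succ, pow_succ]
      field_simp

end RealRAM

/-- Convolutions at `j` see only entries up to `j`, so storing the copy law up to `J` loses nothing.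
-/
lemma transition_congr {g g' : ℕ → ℝ} {J : ℕ} (h : ∀ k < J + 1, g k = g' k) (i : ℕ) :
    ∀ j < J + 1, transition g i j = transition g' i j := by
  induction i with
  | zero => intro j _; rfl
  | succ i ih =>
    intro j hj
    refine sum_congr rfl fun k hk => ?_
    rw [mem_range] at hk
    rw [h k (by omega), ih (j - k) (by omega)]

/-! ### Numerical estimates for the chosen parameters -/

lemma approx_error_le {M N K Δ : ℝ} (hM : 100 ≤ M) (hN0 : 0 < N) (hN : N ≤ 2 * M ^ 4)
    (hK : M ^ 20 ≤ K) (hΔM : Δ ≤ M) :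
    (N / (1 / M ^ 8 / N) + Δ) / K ≤ 1 / 2000 * (1 / M ^ 2) := by
  have hM0 : 0 < M := by linarith
  have h1 : N / (1 / M ^ 8 / N) = N * N * M ^ 8 := by field_simp
  have h2 : N * N * M ^ 8 ≤ 2 * M ^ 4 * (2 * M ^ 4) * M ^ 8 := by gcongr
  have h3 : M ≤ M ^ 16 := le_self_pow₀ (by linarith) (by norm_num)
  have h4 : N / (1 / M ^ 8 / N) + Δ ≤ 5 * M ^ 16 := by rw [h1]; linarith
  have hK0 : 0 < K := lt_of_lt_of_le (by positivity) hK
  rw [div_le_iff₀ hK0]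
  refine h4.trans ?_
  calc 5 * M ^ 16 ≤ 1 / 2000 * M ^ 2 * M ^ 16 := by gcongr; nlinarith
    _ = 1 / 2000 * (1 / M ^ 2) * M ^ 20 := by field_simp
    _ ≤ _ := by gcongr

/-- Relative to the step size, the gain is about `1 / M ^ 2`, the smoothing loss at most `3 M ^ 4 /
M ^ 8` and the curvature loss at most `3 M ^ 12 / M ^ 16`. In terms of `x = 1 / M ^ 2` both losses
are of order `x ^ 2`. -/
lemma gain_le {M N D g : ℝ} (hM : 100 ≤ M) (hN : N ≤ 2 * M ^ 4) (hDM : D ≤ M)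
    (hg : 99 / 100 * (1 / M ^ 2) ≤ g) :
    1 / (2 * M ^ 18) ≤ 1 / M ^ 16 * ((1 - 1 / M ^ 8) * g - 1 / M ^ 8 * (N + D)) -
      (1 / M ^ 16) ^ 2 * (N / (1 / M ^ 8) + 1) := by
  have hM0 : 0 < M := by linarith
  have pw : ∀ n : ℕ, 1 ≤ M ^ n := fun n => one_le_pow₀ (by linarith)
  set x := 1 / M ^ 2 with hx
  have hx0 : 0 < x := by positivity
  have hx1 : x ≤ 1 / 10000 := one_div_le_one_div_of_le (by norm_num) (by nlinarith)
  have e8 : 1 / M ^ 8 = x ^ 4 := by rw [hx]; field_simp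
  have e16 : 1 / M ^ 16 = x ^ 8 := by rw [hx]; field_simp
  have e18 : 1 / (2 * M ^ 18) = x ^ 8 * (x / 2) := by rw [hx]; field_simp
  have e4 : M ^ 4 * x ^ 2 = 1 := by rw [hx]; field_simp
  have e12 : N / (1 / M ^ 8) = N * M ^ 8 := by field_simp
  have e12' : M ^ 12 * x ^ 6 = 1 := by rw [hx]; field_simp
  have hM4 : M ≤ M ^ 4 := le_self_pow₀ (by linarith) (by norm_num)
  rw [e12, e8, e16, e18]
  have hx4 : x ^ 4 ≤ 1 / 10000 := by
    calc x ^ 4 ≤ x := pow_le_of_le_one hx0.le (by linarith) (by norm_num)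
      _ ≤ _ := hx1
  have h1 : (98 / 100 : ℝ) * x ≤ (1 - x ^ 4) * g := by
    have : (1 - 1 / 10000 : ℝ) * (99 / 100 * x) ≤ (1 - x ^ 4) * g := by gcongr; linarith
    linarith
  have hxx : x ^ 2 ≤ 1 / 10000 * x := by nlinarith
  have h2 : x ^ 4 * (N + D) ≤ 3 / 10000 * x := by
    calc x ^ 4 * (N + D) ≤ x ^ 4 * (3 * M ^ 4) := by gcongr; linarith
      _ = 3 * x ^ 2 * (M ^ 4 * x ^ 2) := by ring
      _ ≤ _ := by rw [e4]; linarith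
  have h3 : x ^ 8 * (N * M ^ 8 + 1) ≤ 3 / 10000 * x := by
    calc x ^ 8 * (N * M ^ 8 + 1) ≤ x ^ 8 * (2 * M ^ 4 * M ^ 8 + M ^ 12) := by
          gcongr; exact pw 12
      _ = 3 * x ^ 2 * (M ^ 12 * x ^ 6) := by ring
      _ ≤ _ := by rw [e12']; linarith
  have h4 : x ^ 8 * ((1 - x ^ 4) * g - x ^ 4 * (N + D)) - (x ^ 8) ^ 2 * (N * M ^ 8 + 1) =
      x ^ 8 * ((1 - x ^ 4) * g - x ^ 4 * (N + D) - x ^ 8 * (N * M ^ 8 + 1)) := by ring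
  rw [h4]
  refine mul_le_mul_of_nonneg_left ?_ (by positivity)
  linarith

/-! ### The complete algorithm and its running time -/

namespace RealRAM

/-- The uniform vector in array `2`. -/
def initProg : Program := forTo 4 1 0 (.op .div 2 4 21 1 27 1)

lemma wp_initProg {N J : ℕ} {s : Memory} (hs : Ready N J s) (h27 : s.real 27 0 = N) :
    WP initProg ((N + 1) * 4 + 2) (fun s' => Frame [4, 63] [2] s s' ∧
      ∀ i ∈ Icc 1 N, s'.real 2 i = 1 / N) s := by
  refine WP.mono (wp_forTo (C := 1) (n := N) (s₁ := s) (I := [4, 63]) (A := [2])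
    (fun m s' => ∀ i ∈ Ico 1 m, s'.real 2 i = 1 / N)
    (Frame.refl _ _ _) (by simp) (by simp) (by simp) (by simp) hs.int_zero (by omega)
    (by simp) fun k s' hk hkn hv hF hD => wp_exec rfl le_rfl ⟨hF.exec rfl, ?_, ?_⟩) (by omega)
    fun s' h => h
  · simp [exec, hv]
  · intro i hi
    rw [mem_Ico] at hi
    simp only [exec, setInt_real, set_real, hv]
    rcases Nat.lt_succ_iff_lt_or_eq.1 hi.2 with h | h
    · have := hD i (mem_Ico.2 ⟨hi.1, h⟩)
      simpa [h.ne] using this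
    · simp [h, hF.int, hF.real, hs.int_one, hs.one, h27, Op.eval]

/-- The iteration. -/
def iterProg : Program :=
  .seq initProg (.seq evalProg (.loop (.realLe 41 1 6 10) (.seq updateProg evalProg)))

/-- The arrays hold the vector `y` and the quantities computed from it. -/
structure Evaluated (N J : ℕ) (V : ℕ → ℕ → ℝ) (Δ t : ℝ) (y : ℕ → ℝ) (s : Memory) : Prop where
  vec : ∀ i ∈ Icc 1 N, s.real 2 i = y i
  law : ∀ i ∈ Icc 1 N, s.real 1 i = runLaw N y i
  bar : s.real 41 0 = approxValue N J V J Δ y + t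
  mem : s.int 10 ∈ Icc 1 N
  best : s.real 6 (s.int 10) = approxScore N J V J Δ y (s.int 10)
  le_best : ∀ i ∈ Icc 1 N, approxScore N J V J Δ y i ≤ approxScore N J V J Δ y (s.int 10)

lemma wp_iterProg {M N J : ℕ} {s₀ s : Memory} {p Δ : ℝ} {V : ℕ → ℕ → ℝ} (hM : 100 ≤ M)
    (hN : N = M ^ 4 + 1) (hJ : J = M ^ 20 + 1) (hs : HasParams M p Δ s₀)
    (hF₀ : Frame [4, 5, 6, 7, 8, 63] [3, 4, 9, 35, 36] s₀ s) (hΔ : 0 ≤ Δ) (hΔM : Δ ≤ M) (hVc : IsFiniteChannel N J V)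
    (hV : ∀ i ∈ Icc 1 N, ∀ j < J + 1, s.real 9 (i * (J + 1) + j) = V i j) :
    WP iterProg (6 * (6 * M ^ 22) * (100 * (N + 1) * (J + 1) ^ 2)) (fun s' => s'.int 0 = N ∧
      ∃ y, InSimplex N (1 / (M : ℝ) ^ 8 / N) y ∧ (∀ i ∈ Icc 1 N, s'.real 1 i = runLaw N y i) ∧
      ∀ i ∈ Icc 1 N, score N J V (Δ * Real.log 2) y i ≤
        value N J V (Δ * Real.log 2) y + 2 / M ^ 2) s := by
  obtain ⟨hR, -, h22, h25, h27, h28, h29, h31, -, -⟩ := hs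
  replace hR := hR.frame hF₀ (by decide) (by decide)
  rw [← hF₀.real 22 (by decide)] at h22
  rw [← hF₀.real 25 (by decide)] at h25
  rw [← hF₀.real 27 (by decide)] at h27
  rw [← hF₀.real 28 (by decide)] at h28
  rw [← hF₀.real 29 (by decide)] at h29
  rw [← hF₀.real 31 (by decide)] at h31
  have hM' : (100 : ℝ) ≤ M := by exact_mod_cast hM
  have hM0 : (0 : ℝ) < M := by linarith
  have hN0 : 0 < N := by omega
  have hJ0 : 0 < J := by omega
  have hN0' : (0 : ℝ) < N := by exact_mod_cast hN0
  have hNM : (N : ℝ) ≤ 2 * M ^ 4 := by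
    have : (1 : ℝ) ≤ (M : ℝ) ^ 4 := one_le_pow₀ (by linarith)
    rw [hN]; push_cast; linarith
  have hKM : (M : ℝ) ^ 20 ≤ J := by rw [hJ]; push_cast; linarith
  rw [← hN, ← hJ] at hR
  rw [← hN] at h27 h28
  rw [← hJ] at h31
  set D := Δ * Real.log 2 with hD
  have hl2 : Real.log 2 < 1 := by linarith [Real.log_two_lt_d9]
  have hl2' : 0 < Real.log 2 := Real.log_pos one_lt_two
  have hD0 : 0 ≤ D := by positivity
  have hDM : D ≤ M := by nlinarith
  set μ : ℝ := 1 / (M : ℝ) ^ 8 with hμ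
  have hμ0 : 0 < μ := by positivity
  have hμ1 : μ ≤ 1 := by
    rw [hμ, div_le_one (by positivity)]; exact one_le_pow₀ (by linarith)
  set γ : ℝ := 1 / (M : ℝ) ^ 16 with hγ
  have hγ0 : 0 ≤ γ := by positivity
  have hγ1 : γ ≤ 1 := by
    rw [hγ, div_le_one (by positivity)]; exact one_le_pow₀ (by linarith)
  have hb : 0 < μ / N := by positivity
  have hδ := approx_error_le hM' hN0' hNM hKM hΔM
  rw [← hμ] at hδ
  set E := 100 * (N + 1) * (J + 1) ^ 2 with hE
  have hE1 : (N + 1) * 5 + 3 ≤ E := by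
    have : 1 ≤ (J + 1) ^ 2 := Nat.one_le_pow _ _ (by omega)
    have := Nat.mul_le_mul_left (100 * (N + 1)) this
    omega
  have key : ∀ s₂, Frame [4, 5, 6, 7, 8, 10, 63] [1, 2, 5, 6, 32, 33, 34, 35, 36, 37, 40, 41] s s₂ →
      ∀ y, (∀ i ∈ Icc 1 N, s₂.real 2 i = y i) →
      WP evalProg E (fun s' =>
        Frame [4, 5, 6, 7, 8, 10, 63] [1, 2, 5, 6, 32, 33, 34, 35, 36, 37, 40, 41] s s' ∧
        Evaluated N J V Δ (1 / M ^ 2) y s') s₂ := by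
    intro s₂ hF y hy
    refine (wp_evalProg (V := V) (Δ := Δ) hN0 (hR.frame hF (by decide) (by decide)) ?_ hy ?_).mono
      le_rfl fun s₃ ⟨hF3, a1, a2, a3, a4, a5⟩ =>
        ⟨hF.trans (hF3.mono (by decide) (by decide)), ?_, a1, ?_, a3, a4, a5⟩
    · simpa [hF.real] using hV
    · rw [hF.real 31 (by decide), h31]
    · simpa [hF3.real] using hy
    · rw [a2, hF.real 22 (by decide), h22]
  refine WP.le ((wp_initProg hR h27).seq fun s₁ ⟨hF1, hy1⟩ =>
    (key s₁ (hF1.mono (by decide) (by decide)) (fun _ => 1 / N) hy1).seq fun s₂ ⟨hF2, hE2⟩ =>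
    -- The value starts at `-D` or more, rises by `1 / (2 M ^ 18)` per round and never exceeds `N`;
    -- as `N + D ≤ 3 M ^ 4`, there are at most `6 M ^ 22` rounds.
    (wp_loop (fun k s' =>
      Frame [4, 5, 6, 7, 8, 10, 63] [1, 2, 5, 6, 32, 33, 34, 35, 36, 37, 40, 41] s s' ∧
      ∃ y, InSimplex N (μ / N) y ∧ Evaluated N J V Δ (1 / M ^ 2) y s' ∧
        -D + k * (1 / (2 * (M : ℝ) ^ 18)) ≤ value N J V D y) (6 * M ^ 22) (2 * E) ?_
      ⟨hF2, fun _ => 1 / N, ?_, hE2, ?_⟩).mono le_rfl ?_) ?_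
  · rintro k s' ⟨hF, y, hy, hEv, hval⟩ ht
    have i1 : s'.int 1 = 0 := by rw [hF.int 1 (by decide), hR.int_one]
    simp only [Test.Holds, Memory.get, i1, hEv.bar, hEv.best] at ht
    have b1 := abs_le.1 (abs_approxScore_sub_score_le hb hΔ hN0 hJ0 hy hVc hEv.mem)
    have b2 := abs_le.1 (abs_approxValue_sub_value_le hb hΔ hN0 hJ0 hy hVc)
    rw [← hD] at b1 b2
    -- The guard gives an approximate gap of `1 / M ^ 2`; the errors of score and value, each at
    -- most `1 / 2000` of that, leave `99 / 100`.
    have hg : value N J V D y + 99 / 100 * (1 / (M : ℝ) ^ 2) ≤ score N J V D y (s'.int 10) := by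
      have : 0 < 1 / (M : ℝ) ^ 2 := by positivity
      linarith
    have hstep := value_add_le_value_simplexStep hγ0 hγ1 hμ0 hμ1 hD0 hN0 hEv.mem hy hVc hg
    have hgain := gain_le hM' hNM hDM le_rfl
    rw [← hμ, ← hγ] at hgain
    have hy' := hy.simplexStep hγ0 hγ1 hμ1 hN0 hEv.mem
    have hval' : -D + ((k + 1 : ℕ) : ℝ) * (1 / (2 * (M : ℝ) ^ 18)) ≤
        value N J V D (simplexStep N γ μ (s'.int 10) y) := by
      push_cast
      linarith
    refine ⟨?_, ?_⟩
    · have h1 := hval'.trans (hy'.value_le hb hN0 hVc hD0)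
      have h2 : ((k + 1 : ℕ) : ℝ) ≤ 3 * M ^ 4 * (2 * M ^ 18) := by
        have hM4 : (M : ℝ) ≤ (M : ℝ) ^ 4 := le_self_pow₀ (by linarith) (by norm_num)
        rw [mul_one_div] at h1
        rw [← div_le_iff₀ (by positivity)]
        linarith
      have h3 : (3 * M ^ 4 * (2 * M ^ 18) : ℝ) = ((6 * M ^ 22 : ℕ) : ℝ) := by push_cast; ring
      rw [h3] at h2
      exact Nat.lt_of_succ_le (by exact_mod_cast h2)
    · have hR' := hR.frame hF (by decide) (by decide)
      refine WP.le ((wp_updateProg (γ := γ) (μ := μ) hR' hEv.vec ?_ ?_ ?_).seq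
        fun s₃ ⟨hF3, hy3⟩ => (key s₃ (hF.trans (hF3.mono (by decide) (by decide))) _ hy3).mono
        le_rfl fun s₄ ⟨hF4, hE4⟩ => ⟨hF4, _, hy', hE4, hval'⟩) (by omega)
      · rw [hF.real 25 (by decide), h25]
      · rw [hF.real 28 (by decide), h28]
      · rw [hF.real 29 (by decide), h29]
  · constructor
    · intro i _
      exact div_le_div_of_nonneg_right hμ1 hN0'.le
    · simp only [sum_const, Nat.card_Icc, Nat.add_sub_cancel, nsmul_eq_mul]
      field_simp
  · have hy : InSimplex N (1 / (N : ℝ)) (fun _ => 1 / N) := by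
      constructor
      · exact fun i _ => le_rfl
      · simp only [sum_const, Nat.card_Icc, Nat.add_sub_cancel, nsmul_eq_mul]
        field_simp
    simpa using hy.neg_le_value (by positivity) hN0 hVc hD0
  · rintro s' ⟨k, ⟨hF, y, hy, hEv, -⟩, ht⟩
    have i1 : s'.int 1 = 0 := by rw [hF.int 1 (by decide), hR.int_one]
    simp only [Test.Holds, Memory.get, i1, hEv.bar, hEv.best, not_le] at ht
    refine ⟨by rw [hF.int 0 (by decide), hR.int_zero], y, hy, hEv.law, fun i hi => ?_⟩
    have b1 := abs_le.1 (abs_approxScore_sub_score_le hb hΔ hN0 hJ0 hy hVc hi)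
    have b2 := abs_le.1 (abs_approxValue_sub_value_le hb hΔ hN0 hJ0 hy hVc)
    rw [← hD] at b1 b2
    have b3 := hEv.le_best i hi
    have e : 2 / (M : ℝ) ^ 2 = 2 * (1 / (M : ℝ) ^ 2) := by ring
    have : 0 < 1 / (M : ℝ) ^ 2 := by positivity
    rw [e]
    linarith
  · have hB : 1 ≤ M ^ 22 := Nat.one_le_pow _ _ (by omega)
    generalize M ^ 22 = B at hB ⊢
    have h1 : E ≤ B * E := Nat.le_mul_of_pos_left E hB
    have h2 : B ≤ B * E := Nat.le_mul_of_pos_right B (by omega)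
    have e1 : 6 * B * (2 * E + 1) = 12 * (B * E) + 6 * B := by ring
    have e2 : 6 * (6 * B) * E = 36 * (B * E) := by ring
    rw [e1, e2]
    omega

/-- The iteration dominates: `36 M ^ 22` evaluations at cost `100 * 2 M ^ 4 * (2 M ^ 20) ^ 2` give
`28800 M ^ 66`. -/
lemma time_le {M N J : ℕ} (hM : 100 ≤ M) (hN : N = M ^ 4 + 1) (hJ : J = M ^ 20 + 1) :
    100 * M ^ 20 + (8 * (J + 1) + 3 + ((N + 1) * ((J + 1) * (7 * (J + 1) + 9) + 6) + 4 +
      ((N + 1) * (10 * (J + 1) + 9) + 3 + 6 * (6 * M ^ 22) * (100 * (N + 1) * (J + 1) ^ 2)))) ≤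
      48000 * M ^ 66 := by
  have h22 : 1 ≤ M ^ 22 := Nat.one_le_pow _ _ (by omega)
  have h4 : 1 ≤ M ^ 4 := Nat.one_le_pow _ _ (by omega)
  have h20 : 1 ≤ M ^ 20 := Nat.one_le_pow _ _ (by omega)
  have h66 : M ^ 66 = M ^ 22 * (M ^ 4 * (M ^ 20) ^ 2) := by ring
  have hM4 : M ≤ M ^ 4 := Nat.le_self_pow (by norm_num) M
  have hM20 : M ≤ M ^ 20 := Nat.le_self_pow (by norm_num) M
  have hn : N + 1 ≤ 2 * M ^ 4 := by omega
  have hj : J + 1 ≤ 2 * M ^ 20 := by omega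
  rw [h66]
  generalize M ^ 22 = c at *
  generalize M ^ 4 = a at *
  generalize M ^ 20 = b at *
  have hb : b ≤ a * b ^ 2 := by
    calc b ≤ a * (b * b) := by nlinarith [Nat.mul_le_mul h4 (Nat.mul_le_mul h20 le_rfl : 1 * b ≤ b * b)]
      _ = _ := by ring
  have hab : a * b ≤ a * b ^ 2 := Nat.mul_le_mul_left a (Nat.le_self_pow (by norm_num) b)
  have ha : a ≤ a * b := Nat.le_mul_of_pos_right a h20
  have hc : a * b ^ 2 ≤ c * (a * b ^ 2) := Nat.le_mul_of_pos_left _ h22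
  have e1 : (N + 1) * ((J + 1) * (7 * (J + 1) + 9) + 6) ≤
      56 * (a * b ^ 2) + 36 * (a * b) + 12 * a := by
    calc _ ≤ 2 * a * (2 * b * (7 * (2 * b) + 9) + 6) := by gcongr
      _ = _ := by ring
  have e2 : (N + 1) * (10 * (J + 1) + 9) ≤ 40 * (a * b) + 18 * a := by
    calc _ ≤ 2 * a * (10 * (2 * b) + 9) := by gcongr
      _ = _ := by ring
  have e3 : 6 * (6 * c) * (100 * (N + 1) * (J + 1) ^ 2) ≤ 28800 * (c * (a * b ^ 2)) := by
    calc _ ≤ 6 * (6 * c) * (100 * (2 * a) * (2 * b) ^ 2) := by gcongr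
      _ = _ := by ring
  generalize c * (a * b ^ 2) = t at *
  omega

/-- The algorithm: `src` is the constant that bounds the mean number of copies, and `gp` computes
the law of the number of copies, up to a factor. -/
def mainProg (src : ℕ) (gp : Program) : Program :=
  .seq (setupProg src) (.seq gp (.seq matrixProg (.seq normProg iterProg)))

/-- One integer `M` meets all demands: `M ≥ 1 / ε` makes the final error `1 / M` small enough, `M ≥
Δ` controls the penalty, and `M ≥ L ≥ m` controls the truncation. -/
theorem exists_returns_nearOptimal {G g : ℕ → ℝ} (hG0 : ∀ k, 0 ≤ G k) (hG : HasSum G 1)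
    {m L c p Δ ε : ℝ} (hm : HasSum (fun k : ℕ => k * G k) m) (hmL : m ≤ L)
    (hc : c ≠ 0) (hGg : G = fun k => c * g k) {src : ℕ} {gp : Program}
    (hsrc : src = 21 ∧ L = 1 ∨ src = 14 ∧ L = p) (hΔ : 0 ≤ Δ) (hε : 0 < ε)
    (hgp : ∀ (N J : ℕ) (s : Memory), Ready N J s → s.real 14 0 = p → (∀ x, s.real 3 x = 0) →
      WP gp (8 * (J + 1) + 3) (fun s' => Frame [5, 6, 63] [3, 35, 36] s s' ∧
        ∀ k < J + 1, s'.real 3 k = g k) s) :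
    ∃ P : RunLengthDist,
      Returns (mainProg src gp) [ε, p, Δ] P (50000 * (1 / ε + Δ + L + 100) ^ 66) ∧
      ∀ P' : RunLengthDist, heuristicRate G Δ P' ≤ heuristicRate G Δ P + ε := by
  have hW := isChannel_transition hG0 hG
  have hm0 : 0 ≤ m := hm.nonneg fun k => mul_nonneg (Nat.cast_nonneg k) (hG0 k)
  have hL : 0 ≤ L := hm0.trans hmL
  have hε' : 0 < 1 / ε := by positivity
  have hX : 0 ≤ 1 / ε + Δ + L := by positivity
  obtain ⟨M, hM⟩ : ∃ M, M = max 100 (⌊1 / ε + Δ + L⌋₊ + 1) := ⟨_, rfl⟩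
  have hM100 : 100 ≤ M := hM ▸ le_max_left _ _
  have hXM : 1 / ε + Δ + L ≤ M := by
    have h1 : ⌊1 / ε + Δ + L⌋₊ + 1 ≤ M := hM ▸ le_max_right _ _
    have h2 : ((⌊1 / ε + Δ + L⌋₊ + 1 : ℕ) : ℝ) ≤ M := by exact_mod_cast h1
    push_cast at h2
    linarith [Nat.lt_floor_add_one (1 / ε + Δ + L)]
  have hMX : (M : ℝ) ≤ 1 / ε + Δ + L + 100 := by
    have h1 : M ≤ ⌊1 / ε + Δ + L⌋₊ + 100 := by omega
    have h2 : (M : ℝ) ≤ ((⌊1 / ε + Δ + L⌋₊ + 100 : ℕ) : ℝ) := by exact_mod_cast h1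
    push_cast at h2
    linarith [Nat.floor_le hX]
  have hM' : (100 : ℝ) ≤ M := by exact_mod_cast hM100
  have hM0 : (0 : ℝ) < M := by linarith
  obtain ⟨N, hN⟩ : ∃ N, N = M ^ 4 + 1 := ⟨_, rfl⟩
  obtain ⟨J, hJ⟩ : ∃ J, J = M ^ 20 + 1 := ⟨_, rfl⟩
  have hN0 : 0 < N := by omega
  have hN0' : (0 : ℝ) < N := by exact_mod_cast hN0
  have hNM : (M : ℝ) ^ 4 ≤ N := by rw [hN]; push_cast; linarith
  have hNM2 : (N : ℝ) ≤ 2 * M ^ 4 := by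
    have : (1 : ℝ) ≤ (M : ℝ) ^ 4 := one_le_pow₀ (by linarith)
    rw [hN]; push_cast; linarith
  have hJM : (M : ℝ) ^ 20 ≤ J := by rw [hJ]; push_cast; linarith
  have hτ : ∀ i ∈ Icc 1 N, 1 - 2 / (M : ℝ) ^ 15 ≤ ∑ j ∈ range (J + 1), transition G i j := by
    intro i hi
    refine le_trans (sub_le_sub_left ?_ _) (one_sub_le_sum_transition hG0 hG hm i J)
    have hiN : (i : ℝ) ≤ N := by exact_mod_cast (mem_Icc.1 hi).2
    have hmM : m ≤ M := by linarith
    calc i * m / (J + 1) ≤ 2 * (M : ℝ) ^ 4 * M / (M : ℝ) ^ 20 := by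
          gcongr
          · exact hiN.trans hNM2
          · linarith
      _ = 2 / (M : ℝ) ^ 15 := by field_simp
  have hτ1 : 2 / (M : ℝ) ^ 15 < 1 := by
    rw [div_lt_one (by positivity)]
    have : (M : ℝ) ≤ (M : ℝ) ^ 15 := le_self_pow₀ (by linarith) (by norm_num)
    linarith
  have hVc := isFiniteChannel_truncRow hW hτ hτ1
  have hb : 0 < 1 / (M : ℝ) ^ 8 / N := by positivity
  have hΔM : Δ ≤ M := by linarith
  obtain ⟨n, s, hrun, hn, h0, y, hy, hlaw, hscore⟩ : WP (mainProg src gp)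
      (48000 * M ^ 66) (fun s' => s'.int 0 = N ∧
      ∃ y, InSimplex N (1 / (M : ℝ) ^ 8 / N) y ∧ (∀ i ∈ Icc 1 N, s'.real 1 i = runLaw N y i) ∧
      ∀ i ∈ Icc 1 N, score N J (truncRow J (transition G)) (Δ * Real.log 2) y i ≤
        value N J (truncRow J (transition G)) (Δ * Real.log 2) y + 2 / M ^ 2)
      (initial [ε, p, Δ]) := by
    refine WP.le ((wp_setupProg hε hΔ hL hsrc hM).seq fun s₁ h1 =>
      (hgp _ _ s₁ h1.ready h1.cell_param h1.zero_three).seq fun s₂ ⟨hF2, hg2⟩ =>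
      (wp_matrixProg (h1.ready.frame hF2 (by decide) (by decide)) ?_).seq fun s₃ ⟨hF3, h3⟩ =>
      (wp_normProg (U := transition g) ((h1.ready.frame hF2 (by decide) (by decide)).frame hF3
        (by decide) (by decide)) fun i hi j hj => ?_).seq fun s₄ ⟨hF4, h4⟩ =>
      wp_iterProg hM100 hN hJ h1 (((hF2.mono (by decide) (by decide)).trans
        (hF3.mono (by decide) (by decide))).trans (hF4.mono (by decide) (by decide)))
        hΔ hΔM hVc ?_) ?_
    · intro x
      rw [hF2.real 4 (by decide), h1.zero_four]
    · rw [h3 i hi j hj, transition_congr hg2 i j hj]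
    · intro i hi j hj
      rw [hN] at hi
      rw [hJ] at hj ⊢
      rw [h4 i hi j hj, hGg, truncRow_transition_const_mul hc]
    · rw [← hN, ← hJ]
      exact time_le hM100 hN hJ
  refine ⟨hy.dist hb hN0, ⟨n, s, hrun, ?_, fun r => ?_⟩, fun P' => ?_⟩
  · have h1 : n + s.int 0 ≤ 50000 * M ^ 66 := by
      have : M ^ 4 ≤ M ^ 66 := Nat.pow_le_pow_right (by omega) (by norm_num)
      have : 1 ≤ M ^ 66 := Nat.one_le_pow _ _ (by omega)
      omega
    calc ((n + s.int 0 : ℕ) : ℝ) ≤ ((50000 * M ^ 66 : ℕ) : ℝ) := by exact_mod_cast h1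
      _ = 50000 * (M : ℝ) ^ 66 := by push_cast; ring
      _ ≤ _ := by gcongr
  · rw [h0]
    simp only [InSimplex.dist]
    split_ifs with h
    · exact (hlaw r (mem_Icc.2 h)).symm
    · rfl
  · refine (hy.heuristicRate_le_add hb hN0 hW hM100 hNM hNM2 le_rfl hτ hΔ (by linarith) hscore
      P').trans ?_
    have : 1 / (M : ℝ) ≤ ε := by
      rw [div_le_iff₀ hM0, ← div_le_iff₀' hε]
      linarith
    linarith

end RealRAM

/-- Comparison with every competitor bounds the range, so finiteness of the supremum comes with
near-optimality. -/
lemma exists_heuristicRate_ge_iSup_sub {G : ℕ → ℝ} {Δ ε : ℝ} {Q : RunLengthDist → Prop}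
    (h : ∃ P, Q P ∧ ∀ P', heuristicRate G Δ P' ≤ heuristicRate G Δ P + ε) :
    BddAbove (Set.range (heuristicRate G Δ)) ∧ ∃ P, Q P ∧
      heuristicRate G Δ P ≥ (⨆ P' : RunLengthDist, heuristicRate G Δ P') - ε := by
  obtain ⟨P, hQ, hP⟩ := h
  have : Nonempty RunLengthDist := ⟨P⟩
  exact ⟨⟨_, by rintro _ ⟨P', rfl⟩; exact hP P'⟩, P, hQ, sub_le_iff_le_add.2 (ciSup_le hP)⟩

end

theorem mainTheorem3 :
    (∃ (alg : RealRAM.Program) (T : MvPolynomial (Fin 3) ℝ),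
      ∀ d Δ ε : ℝ, 0 ≤ d → d < 1 → 0 ≤ Δ → 0 < ε →
        BddAbove (Set.range (heuristicRate (bdc d) Δ)) ∧
        ∃ P : RunLengthDist,
          RealRAM.Returns alg [ε, d, Δ] P (MvPolynomial.eval ![1 / ε, 1 / (1 - d), Δ] T) ∧
          heuristicRate (bdc d) Δ P ≥ (⨆ P' : RunLengthDist, heuristicRate (bdc d) Δ P') - ε) ∧
    (∃ (alg : RealRAM.Program) (T : MvPolynomial (Fin 4) ℝ),
      ∀ lam Δ ε : ℝ, 0 < lam → 0 ≤ Δ → 0 < ε →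
        BddAbove (Set.range (heuristicRate (prc lam) Δ)) ∧
        ∃ P : RunLengthDist,
          RealRAM.Returns alg [ε, lam, Δ] P (MvPolynomial.eval ![1 / ε, lam, 1 / lam, Δ] T) ∧
          heuristicRate (prc lam) Δ P ≥
            (⨆ P' : RunLengthDist, heuristicRate (prc lam) Δ P') - ε) := by
  -- For deletions the mean number of copies is `1 - d ≤ 1`, so `L = 1` is read from the constant in
  -- array `21`, and `101 = L + 100`. For the Poisson channel `L = lam` is read from array `14`.
  refine ⟨⟨RealRAM.mainProg 21 RealRAM.bdcProg, MvPolynomial.C 50000 *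
    (MvPolynomial.X 0 + MvPolynomial.X 2 + MvPolynomial.C 101) ^ 66, ?_⟩,
    RealRAM.mainProg 14 RealRAM.prcProg, MvPolynomial.C 50000 *
    (MvPolynomial.X 0 + MvPolynomial.X 3 + MvPolynomial.X 1 + MvPolynomial.C 100) ^ 66, ?_⟩
  · intro d Δ ε h0 h1 hΔ hε
    refine exists_heuristicRate_ge_iSup_sub ?_
    have hT : MvPolynomial.eval ![1 / ε, 1 / (1 - d), Δ] (MvPolynomial.C 50000 *
        (MvPolynomial.X 0 + MvPolynomial.X 2 + MvPolynomial.C 101) ^ 66) =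
        50000 * (1 / ε + Δ + 1 + 100) ^ 66 := by
      simp only [map_mul, map_pow, map_add, MvPolynomial.eval_C, MvPolynomial.eval_X,
        Matrix.cons_val]
      congr 2
      ring
    rw [hT]
    exact RealRAM.exists_returns_nearOptimal (c := 1) (g := bdc d) (bdc_nonneg h0 h1)
      (hasSum_bdc d) (hasSum_mul_bdc d) (by linarith) one_ne_zero (by simp) (Or.inl ⟨rfl, rfl⟩)
      hΔ hε fun _ _ _ => RealRAM.wp_bdcProg
  · intro lam Δ ε hlam hΔ hε
    refine exists_heuristicRate_ge_iSup_sub ?_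
    have hT : MvPolynomial.eval ![1 / ε, lam, 1 / lam, Δ] (MvPolynomial.C 50000 *
        (MvPolynomial.X 0 + MvPolynomial.X 3 + MvPolynomial.X 1 + MvPolynomial.C 100) ^ 66) =
        50000 * (1 / ε + Δ + lam + 100) ^ 66 := by
      simp only [map_mul, map_pow, map_add, MvPolynomial.eval_C, MvPolynomial.eval_X,
        Matrix.cons_val]
    rw [hT]
    exact RealRAM.exists_returns_nearOptimal (prc_nonneg hlam) (hasSum_prc lam)
      (hasSum_mul_prc lam) le_rfl (Real.exp_ne_zero _) (prc_eq lam) (Or.inr ⟨rfl, rfl⟩)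
      hΔ hε fun _ _ s hs h _ => RealRAM.wp_prcProg hs h
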